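/- For an integer $n\ge 0$ and $p\in[0,1]$ let $G_{n,p}$ be the random graph on $n$ labelled vertices in which each of the $\binom n2$ possible edges is present independently with probability $p$. For a graph $G$, identify a set of edges of $G$ with its indicator vector in the edge space $(\mathbb Z/2)^{E(G)}$; let $\mathcal C(G)$ (the cycle space) be the subspace spanned by the edge sets of all cycles of $G$, and let $\mathcal T(G)$ (the triangle space) be the subspace spanned by the edge sets of all triangles of $G$. Let $Q$ be the property that every edge of the graph lies in a triangle of the graph. Then $$\max_{p\in[0,1]}\ \Pr\bigl(G_{n,p}\text{ satisfies } Q \text{ and } \mathcal T(G_{n,p})\neq \mathcal C(G_{n,p})\bigr)\longrightarrow 0\qquad (n\to\infty).$$ -/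

import Mathlib

open MeasureTheory Filter Topology unitInterval
open scoped SimpleGraph

namespace TriangleSpace

universe u

variable {V : Type u} (G : SimpleGraph V)

/-- The edge space `(ℤ/2)^{E(G)}` of `G`; addition is symmetric difference of edge sets. -/
abbrev EdgeSpace : Type u := G.edgeSet → ZMod 2

/-- The element of the edge space that represents a set `S` of edges: its indicator on `E(G)`. -/
noncomputable def edgeVec (S : Set (Sym2 V)) : EdgeSpace G :=
  Set.indicator {e : G.edgeSet | (e : Sym2 V) ∈ S} 1

/-- The cycle space of `G`: the `ℤ/2`-span of the (edge sets of) cycles of `G`. -/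
def cycleSpace : Submodule (ZMod 2) (EdgeSpace G) :=
  Submodule.span (ZMod 2)
    {x | ∃ (v : V) (c : G.Walk v v), c.IsCycle ∧ x = edgeVec G {e | e ∈ c.edges}}

/-- The triangle space of `G`: the `ℤ/2`-span of the (edge sets of) triangles of `G`. -/
def triangleSpace : Submodule (ZMod 2) (EdgeSpace G) :=
  Submodule.span (ZMod 2)
    {x | ∃ a b c : V, G.Adj a b ∧ G.Adj b c ∧ G.Adj c a ∧
      x = edgeVec G {s(a, b), s(b, c), s(c, a)}}

/-- Every edge of `G` lies in a triangle of `G`. -/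
def EveryEdgeInTriangle : Prop :=
  ∀ a b : V, G.Adj a b → ∃ c : V, G.Adj b c ∧ G.Adj c a

end TriangleSpace

/-! By duality over ℤ/2, triangles span the cycle space as soon as every cocycle (a symmetric `f`
summing to zero on each triangle) agrees on the edges with a coboundary. Write D = np², the typical
codegree. The range of p is cut at D = (5/4) log n. The constant lies between 1, above which two
edges of small codegree at one vertex can be excluded, and 3/2, below which the expected number of
edges in no triangle, about n²p·exp(-D), is large.

Below the cut, a second moment argument (`pr_everyEdgeInTriangle_le`) gives an edge in no triangle
when p ≥ n^(-3/2), so Q fails. For smaller p there are typically no triangles, so Q leaves no edges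
at all (`pr_triangle_le`).

Above the cut, every cocycle is first shown to be close to a coboundary (`negligible_far`). Reveal
the edges between a small linear-sized set K and its complement. The values of f on them force its
value on every edge whose ends have a common neighbour in K. For fixed values, if many triples were
forced inconsistently, the unrevealed edges would fail to produce a triangle on one of them with
probability only exp(-cn²p) (`pr_no_triangle_le`, given bounded degrees and codegrees). As K is
small, this survives a union bound over all values on the revealed edges. Hence few triples are
inconsistent, and by averaging some vertex z defines, through its forced values, a coboundary that
agrees with the forced values on most pairs. A second union bound shows that the exceptional pairs
contain few edges.

Then closeness is upgraded to equality (`oddNbr_eq_empty`). Subtract the coboundary closest to f and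
call an edge odd if the difference is one there; minimality makes at most half of the edges at each
vertex odd. A triangle has zero or two odd edges, so ∑ (c(v) - 2q(v)) = 0, where c(v) sums the
codegrees of the odd edges at v and q(v) counts ordered adjacent pairs of odd neighbours of v. At a
vertex of large odd degree c - 2q is almost nonnegative, because a set of at most half the
neighbourhood has about as many edges leaving it as inside it, counted by ordered pairs. At a vertex
of small odd degree q ≤ c/4, since small sets are sparse and at most one edge per vertex has small
codegree. So vertices of small odd degree carry little total codegree. But odd edges at vertices of
large odd degree mostly lead to vertices of small odd degree, and carry much. Therefore no vertex
has large odd degree, all c(v) vanish, and Q, which makes every codegree of an edge positive, leaves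
no odd edge. -/

namespace TriangleSpace

/-! ### Random subsets of a finite set: independence and Chernoff bounds. -/

section RandomSubset

open Finset

variable {ι : Type*} [DecidableEq ι]

open Classical in
/-- The indicator of a proposition. -/
noncomputable def ind (P : Prop) : ℝ := if P then 1 else 0

theorem ind_true {P : Prop} (h : P) : ind P = 1 := by simp [ind, h]
theorem ind_false {P : Prop} (h : ¬ P) : ind P = 0 := by simp [ind, h]
theorem ind_nonneg (P : Prop) : 0 ≤ ind P := by unfold ind; split_ifs <;> norm_num
theorem ind_le_one (P : Prop) : ind P ≤ 1 := by unfold ind; split_ifs <;> norm_num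
theorem ind_mono {P Q : Prop} (h : P → Q) : ind P ≤ ind Q := by
  by_cases hP : P
  · rw [ind_true hP, ind_true (h hP)]
  · rw [ind_false hP]; exact ind_nonneg _
theorem ind_or_le (P Q : Prop) : ind (P ∨ Q) ≤ ind P + ind Q := by
  by_cases hP : P <;> by_cases hQ : Q <;> simp [ind, hP, hQ]
theorem ind_and (P Q : Prop) : ind (P ∧ Q) = ind P * ind Q := by
  by_cases hP : P <;> by_cases hQ : Q <;> simp [ind, hP, hQ]
theorem ind_exists_le {α : Type*} (s : Finset α) (P : α → Prop) :
    ind (∃ a ∈ s, P a) ≤ ∑ a ∈ s, ind (P a) := by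
  by_cases h : ∃ a ∈ s, P a
  · obtain ⟨a, ha, hP⟩ := h
    calc ind (∃ a ∈ s, P a) ≤ 1 := ind_le_one _
      _ = ind (P a) := (ind_true hP).symm
      _ ≤ _ := Finset.single_le_sum (f := fun a => ind (P a)) (fun a _ => ind_nonneg _) ha
  · rw [ind_false h]; exact Finset.sum_nonneg fun a _ => ind_nonneg _
theorem ind_forall {α : Type*} (s : Finset α) (P : α → Prop) :
    ind (∀ a ∈ s, P a) = ∏ a ∈ s, ind (P a) := by
  by_cases h : ∀ a ∈ s, P a
  · rw [ind_true h, Finset.prod_eq_one]; intro a ha; exact ind_true (h a ha)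
  · rw [ind_false h]
    push Not at h
    obtain ⟨a, ha, hP⟩ := h
    exact (Finset.prod_eq_zero ha (ind_false hP)).symm

/-- `g` depends only on the coordinates in `A`. -/
def DependsOn (g : Finset ι → ℝ) (A : Finset ι) : Prop := ∀ S T, S ∩ A = T ∩ A → g S = g T

theorem DependsOn.mono {g : Finset ι → ℝ} {A B : Finset ι} (h : DependsOn g A) (hAB : A ⊆ B) :
    DependsOn g B := fun S T hST => h S T <| by
  have := congrArg (· ∩ A) hST
  simpa [Finset.inter_assoc, Finset.inter_eq_right.2 hAB] using this

theorem DependsOn.mul {g h : Finset ι → ℝ} {A : Finset ι} (hg : DependsOn g A)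
    (hh : DependsOn h A) : DependsOn (fun S => g S * h S) A :=
  fun S T hST => by simp only [hg S T hST, hh S T hST]

theorem DependsOn.prod {α : Type*} {s : Finset α} {g : α → Finset ι → ℝ} {A : Finset ι}
    (hg : ∀ a ∈ s, DependsOn (g a) A) : DependsOn (fun S => ∏ a ∈ s, g a S) A :=
  fun S T hST => Finset.prod_congr rfl fun a ha => hg a ha S T hST

theorem dependsOn_comp {A : Finset ι} {g : Finset ι → ℝ} (h : ∀ S, g S = g (S ∩ A)) :
    DependsOn g A := fun S T hST => by rw [h S, h T, hST]

theorem sum_ind_mem (A S : Finset ι) : ∑ e ∈ A, ind (e ∈ S) = ((A ∩ S).card : ℝ) := by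
  rw [← Finset.filter_mem_eq_inter, Finset.card_filter]; push_cast
  exact Finset.sum_congr rfl fun e _ => by simp [ind]

variable [Fintype ι]

/-- The probability that the `p`-random subset of `ι` equals `S`. -/
noncomputable def wt (p : ℝ) (S : Finset ι) : ℝ := ∏ e, if e ∈ S then p else 1 - p

/-- The expectation of a function of the `p`-random subset of `ι`. -/
noncomputable def ex (p : ℝ) (g : Finset ι → ℝ) : ℝ := ∑ S, wt p S * g S

/-- The probability of a property of the `p`-random subset of `ι`. -/
noncomputable def pr (p : ℝ) (P : Finset ι → Prop) : ℝ := ex p fun S => ind (P S)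

variable {p : ℝ}

theorem wt_nonneg (h0 : 0 ≤ p) (h1 : p ≤ 1) (S : Finset ι) : 0 ≤ wt p S :=
  Finset.prod_nonneg fun e _ => by split_ifs <;> linarith

theorem ex_mono (h0 : 0 ≤ p) (h1 : p ≤ 1) {g h : Finset ι → ℝ} (H : ∀ S, g S ≤ h S) :
    ex p g ≤ ex p h :=
  Finset.sum_le_sum fun S _ => mul_le_mul_of_nonneg_left (H S) (wt_nonneg h0 h1 S)

theorem ex_nonneg (h0 : 0 ≤ p) (h1 : p ≤ 1) {g : Finset ι → ℝ} (H : ∀ S, 0 ≤ g S) :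
    0 ≤ ex p g :=
  Finset.sum_nonneg fun S _ => mul_nonneg (wt_nonneg h0 h1 S) (H S)

theorem ex_add (g h : Finset ι → ℝ) : ex p (fun S => g S + h S) = ex p g + ex p h := by
  simp [ex, mul_add, Finset.sum_add_distrib]

theorem ex_sub (g h : Finset ι → ℝ) : ex p (fun S => g S - h S) = ex p g - ex p h := by
  simp [ex, mul_sub, Finset.sum_sub_distrib]

theorem ex_const_mul (c : ℝ) (g : Finset ι → ℝ) : ex p (fun S => c * g S) = c * ex p g := by
  simp only [ex, Finset.mul_sum]; exact Finset.sum_congr rfl fun _ _ => by ring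

theorem ex_mul_const (c : ℝ) (g : Finset ι → ℝ) : ex p (fun S => g S * c) = ex p g * c := by
  simp only [ex, Finset.sum_mul]; exact Finset.sum_congr rfl fun _ _ => by ring

theorem ex_sum {α : Type*} (s : Finset α) (g : α → Finset ι → ℝ) :
    ex p (fun S => ∑ a ∈ s, g a S) = ∑ a ∈ s, ex p (g a) := by
  simp only [ex, Finset.mul_sum]; exact Finset.sum_comm

/-- Expectation of a product of functions of single coordinates. -/
theorem ex_prod_ite (a b : ι → ℝ) :
    ex p (fun S => ∏ e, if e ∈ S then a e else b e) = ∏ e, (p * a e + (1 - p) * b e) := by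
  rw [Finset.prod_add, ex, Finset.powerset_univ]
  refine Finset.sum_congr rfl fun S _ => ?_
  rw [wt, ← Finset.prod_mul_distrib, ← Finset.prod_mul_prod_compl S, Finset.compl_eq_univ_sdiff]
  congr 1
  · exact Finset.prod_congr rfl fun e he => by simp [he]
  · exact Finset.prod_congr rfl fun e he => by
      have : e ∉ S := by simpa using he
      simp [this]

theorem ex_prod_ite_mem (A : Finset ι) (a b : ι → ℝ) :
    ex p (fun S => ∏ e ∈ A, if e ∈ S then a e else b e) = ∏ e ∈ A, (p * a e + (1 - p) * b e) := by
  have := ex_prod_ite (p := p) (fun e => if e ∈ A then a e else 1) (fun e => if e ∈ A then b e else 1)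
  have h1 : ∀ S : Finset ι, (∏ e, if e ∈ S then (if e ∈ A then a e else 1) else
      (if e ∈ A then b e else 1)) = ∏ e ∈ A, if e ∈ S then a e else b e := by
    intro S
    rw [← Finset.prod_subset (Finset.subset_univ A)]
    · exact Finset.prod_congr rfl fun e he => by simp [he]
    · intro e _ he; simp [he]
  simp only [h1] at this
  rw [this, ← Finset.prod_subset (Finset.subset_univ A)]
  · exact Finset.prod_congr rfl fun e he => by simp [he]
  · intro e _ he; simp [he]

@[simp] theorem ex_const (c : ℝ) : ex p (fun _ : Finset ι => c) = c := by
  have := ex_prod_ite_mem (p := p) (∅ : Finset ι) 1 1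
  simp only [Finset.prod_empty] at this
  have h2 := ex_mul_const (p := p) c (fun _ : Finset ι => (1 : ℝ))
  simp only [one_mul] at h2
  rw [h2, this, one_mul]

theorem sum_wt : ∑ S : Finset ι, wt p S = 1 := by
  simpa [ex] using ex_const (ι := ι) (p := p) 1

theorem pr_mono (h0 : 0 ≤ p) (h1 : p ≤ 1) {P Q : Finset ι → Prop} (h : ∀ S, P S → Q S) :
    pr p P ≤ pr p Q := ex_mono h0 h1 fun S => ind_mono (h S)

theorem pr_nonneg (h0 : 0 ≤ p) (h1 : p ≤ 1) (P : Finset ι → Prop) : 0 ≤ pr p P :=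
  ex_nonneg h0 h1 fun _ => ind_nonneg _

theorem pr_le_one (h0 : 0 ≤ p) (h1 : p ≤ 1) (P : Finset ι → Prop) : pr p P ≤ 1 :=
  (ex_mono h0 h1 fun _ => ind_le_one _).trans_eq (ex_const 1)

theorem pr_or_le (h0 : 0 ≤ p) (h1 : p ≤ 1) (P Q : Finset ι → Prop) :
    pr p (fun S => P S ∨ Q S) ≤ pr p P + pr p Q := by
  rw [pr, pr, pr, ← ex_add]; exact ex_mono h0 h1 fun S => ind_or_le _ _

theorem pr_exists_le (h0 : 0 ≤ p) (h1 : p ≤ 1) {α : Type*} (s : Finset α)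
    (P : α → Finset ι → Prop) :
    pr p (fun S => ∃ a ∈ s, P a S) ≤ ∑ a ∈ s, pr p (P a) := by
  simp only [pr]
  rw [← ex_sum]; exact ex_mono h0 h1 fun S => ind_exists_le _ _

/-- Markov's inequality. -/
theorem pr_le_ex (h0 : 0 ≤ p) (h1 : p ≤ 1) {P : Finset ι → Prop} {g : Finset ι → ℝ}
    (hg : ∀ S, 0 ≤ g S) (h : ∀ S, P S → 1 ≤ g S) : pr p P ≤ ex p g :=
  ex_mono h0 h1 fun S => by
    by_cases hP : P S
    · rw [ind_true hP]; exact h S hP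
    · rw [ind_false hP]; exact hg S

/-- Replacing the part of the random set outside `A` by an independent copy. -/
theorem ex_resample (A : Finset ι) (g : Finset ι → ℝ) :
    ex p g = ex p fun S => ex p fun T => g ((S ∩ A) ∪ (T \ A)) := by
  -- Exchanging the parts of S and T outside A is an involution of the pairs (S, T) that preserves
  -- the product weight.
  have key : ∀ S T : Finset ι, wt p S * wt p T =
      wt p ((S ∩ A) ∪ (T \ A)) * wt p ((T ∩ A) ∪ (S \ A)) := by
    intro S T
    simp only [wt, ← Finset.prod_mul_distrib]
    refine Finset.prod_congr rfl fun e _ => ?_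
    by_cases hA : e ∈ A <;> by_cases hS : e ∈ S <;> by_cases hT : e ∈ T <;> simp [hA, hS, hT] <;> ring
  have h1 : ex p g = ∑ x : Finset ι × Finset ι, wt p x.1 * wt p x.2 * g x.1 := by
    rw [Fintype.sum_prod_type, ex]
    refine Finset.sum_congr rfl fun S _ => ?_
    simp only
    rw [← Finset.sum_mul, ← Finset.mul_sum, sum_wt, mul_one]
  have h2 : (ex p fun S => ex p fun T => g ((S ∩ A) ∪ (T \ A))) =
      ∑ x : Finset ι × Finset ι, wt p x.1 * wt p x.2 * g ((x.1 ∩ A) ∪ (x.2 \ A)) := by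
    rw [Fintype.sum_prod_type, ex]
    refine Finset.sum_congr rfl fun S _ => ?_
    rw [ex, Finset.mul_sum]
    exact Finset.sum_congr rfl fun T _ => by ring
  have hinv : ∀ S T : Finset ι, (((S ∩ A) ∪ (T \ A)) ∩ A) ∪ (((T ∩ A) ∪ (S \ A)) \ A) = S := by
    intro S T; ext e; simp only [mem_union, mem_inter, Finset.mem_sdiff]; tauto
  rw [h1, h2]
  symm
  refine Finset.sum_nbij' (fun x => ((x.1 ∩ A) ∪ (x.2 \ A), (x.2 ∩ A) ∪ (x.1 \ A)))
    (fun x => ((x.1 ∩ A) ∪ (x.2 \ A), (x.2 ∩ A) ∪ (x.1 \ A)))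
    (by simp) (by simp) ?_ ?_ ?_
  · rintro ⟨S, T⟩ _; exact Prod.ext (hinv S T) (hinv T S)
  · rintro ⟨S, T⟩ _; exact Prod.ext (hinv S T) (hinv T S)
  · rintro ⟨S, T⟩ _; simp only; rw [key S T]

/-- Functions of disjoint sets of coordinates are independent. -/
theorem ex_mul_of_disjoint {g h : Finset ι → ℝ} {A B : Finset ι} (hg : DependsOn g A)
    (hh : DependsOn h B) (hAB : Disjoint A B) :
    ex p (fun S => g S * h S) = ex p g * ex p h := by
  rw [ex_resample A, ← ex_mul_const]
  congr 1; funext S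
  rw [← ex_const_mul]
  congr 1; funext T
  congr 1
  · apply hg; ext e; simp only [mem_union, mem_inter, Finset.mem_sdiff]; tauto
  · apply hh; ext e
    have : e ∈ A → e ∉ B := fun h1 h2 => Finset.disjoint_left.1 hAB h1 h2
    simp only [mem_union, mem_inter, Finset.mem_sdiff]; tauto

theorem ex_prod_of_disjoint {α : Type*} [DecidableEq α] (s : Finset α) (g : α → Finset ι → ℝ)
    (A : α → Finset ι)
    (hg : ∀ a ∈ s, DependsOn (g a) (A a)) (hA : ∀ a ∈ s, ∀ b ∈ s, a ≠ b → Disjoint (A a) (A b)) :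
    ex p (fun S => ∏ a ∈ s, g a S) = ∏ a ∈ s, ex p (g a) := by
  induction s using Finset.induction_on with
  | empty => simp
  | insert a s ha ih =>
    simp only [Finset.prod_insert ha]
    rw [ex_mul_of_disjoint (A := A a) (B := s.biUnion A) (hg a (by simp)), ih]
    · intro b hb; exact hg b (by simp [hb])
    · intro b hb c hc; exact hA b (by simp [hb]) c (by simp [hc])
    · apply DependsOn.prod; intro b hb
      exact (hg b (by simp [hb])).mono (Finset.subset_biUnion_of_mem A hb)
    · rw [Finset.disjoint_biUnion_right]
      intro b hb; exact hA a (by simp) b (by simp [hb]) (by rintro rfl; exact ha hb)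

/-- The probability that all elements of `A` are present. -/
theorem ex_prod_mem (A : Finset ι) : ex p (fun S => ∏ e ∈ A, ind (e ∈ S)) = p ^ A.card := by
  have := ex_prod_ite_mem (p := p) A 1 0
  simp only [Pi.zero_apply, Pi.one_apply, mul_zero, mul_one, add_zero, prod_const] at this
  rw [← this]
  congr 1; funext S; refine Finset.prod_congr rfl fun e _ => ?_
  by_cases h : e ∈ S <;> simp [ind, h]

/-- The probability that all elements of `A` are absent. -/
theorem ex_prod_notMem (A : Finset ι) :
    ex p (fun S => ∏ e ∈ A, ind (e ∉ S)) = (1 - p) ^ A.card := by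
  have := ex_prod_ite_mem (p := p) A 0 1
  simp only [Pi.zero_apply, Pi.one_apply, mul_zero, mul_one, zero_add, prod_const] at this
  rw [← this]
  congr 1; funext S; refine Finset.prod_congr rfl fun e _ => ?_
  by_cases h : e ∈ S <;> simp [ind, h]

theorem pr_disjoint_le (h1 : p ≤ 1) (A : Finset ι) :
    pr p (fun S => ∀ e ∈ A, e ∉ S) ≤ Real.exp (-(p * A.card)) := by
  have : pr p (fun S => ∀ e ∈ A, e ∉ S) = (1 - p) ^ A.card := by
    rw [← ex_prod_notMem]; unfold pr; simp only [ind_forall]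
  rw [this]
  calc (1 - p) ^ A.card ≤ (Real.exp (-p)) ^ A.card := by
        refine pow_le_pow_left₀ (by linarith) ?_ _
        linarith [Real.add_one_le_exp (-p)]
    _ = _ := by rw [← Real.exp_nat_mul]; ring_nf

/-- Moment generating function of a weighted count. -/
theorem ex_exp_sum_le (h0 : 0 ≤ p) (h1 : p ≤ 1) (A : Finset ι) (a : ι → ℝ) :
    ex p (fun S => Real.exp (∑ e ∈ A, a e * ind (e ∈ S))) ≤
      Real.exp (p * ∑ e ∈ A, (Real.exp (a e) - 1)) := by
  have := ex_prod_ite_mem (p := p) A (fun e => Real.exp (a e)) 1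
  have h2 : ∀ S : Finset ι, Real.exp (∑ e ∈ A, a e * ind (e ∈ S)) =
      ∏ e ∈ A, if e ∈ S then Real.exp (a e) else (1 : ι → ℝ) e := by
    intro S; rw [Real.exp_sum]
    refine Finset.prod_congr rfl fun e _ => ?_
    by_cases h : e ∈ S <;> simp [ind, h]
  simp only [h2]
  rw [this, Finset.mul_sum, Real.exp_sum]
  refine Finset.prod_le_prod (fun e _ => ?_) fun e _ => ?_
  · have := Real.exp_pos (a e)
    simp only [Pi.one_apply]; nlinarith
  · have := Real.add_one_le_exp (p * (Real.exp (a e) - 1))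
    simp only [Pi.one_apply]; linarith

/-- Chernoff bound with parameter `t`, upper tail. -/
theorem pr_card_ge_le (h0 : 0 ≤ p) (h1 : p ≤ 1) (A : Finset ι) (m : ℝ) {t : ℝ} (ht : 0 ≤ t) :
    pr p (fun S => m ≤ ((A ∩ S).card : ℝ)) ≤
      Real.exp (p * A.card * (Real.exp t - 1) - t * m) := by
  have h := ex_exp_sum_le h0 h1 A fun _ => t
  calc pr p (fun S => m ≤ ((A ∩ S).card : ℝ))
      ≤ ex p (fun S => Real.exp (∑ e ∈ A, t * ind (e ∈ S)) * Real.exp (-(t * m))) := by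
        refine pr_le_ex h0 h1 (fun S => by positivity) fun S hS => ?_
        rw [← Real.exp_add, ← Finset.mul_sum, sum_ind_mem]
        apply Real.one_le_exp; nlinarith
    _ ≤ _ := by
        rw [ex_mul_const, sub_eq_add_neg, Real.exp_add]
        gcongr
        refine h.trans_eq ?_
        simp; ring_nf

/-- Chernoff bound with parameter `t`, lower tail. -/
theorem pr_card_le_le (h0 : 0 ≤ p) (h1 : p ≤ 1) (A : Finset ι) (m : ℝ) {t : ℝ} (ht : 0 ≤ t) :
    pr p (fun S => ((A ∩ S).card : ℝ) ≤ m) ≤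
      Real.exp (p * A.card * (Real.exp (-t) - 1) + t * m) := by
  have h := ex_exp_sum_le h0 h1 A fun _ => -t
  calc pr p (fun S => ((A ∩ S).card : ℝ) ≤ m)
      ≤ ex p (fun S => Real.exp (∑ e ∈ A, -t * ind (e ∈ S)) * Real.exp (t * m)) := by
        refine pr_le_ex h0 h1 (fun S => by positivity) fun S hS => ?_
        rw [← Real.exp_add, ← Finset.mul_sum, sum_ind_mem]
        apply Real.one_le_exp; nlinarith
    _ ≤ _ := by
        rw [ex_mul_const, Real.exp_add]
        gcongr
        refine h.trans_eq ?_
        simp; ring_nf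

/-- Lower tail of a count with weights in `[0, m]`. -/
theorem pr_weighted_le (h0 : 0 ≤ p) (h1 : p ≤ 1) (A : Finset ι) (a : ι → ℝ) {m : ℝ} (hm : 0 < m)
    (ha : ∀ e ∈ A, 0 ≤ a e ∧ a e ≤ m) :
    pr p (fun S => ∑ e ∈ A, a e * ind (e ∈ S) ≤ p / 4 * ∑ e ∈ A, a e) ≤
      Real.exp (-(p / (4 * m) * ∑ e ∈ A, a e)) := by
  -- The Chernoff parameter is 1/m, which brings the exponents a/m into [0, 1], where exp(-x) ≤
  -- 1/(1+x) ≤ 1 - x/2. The mean then contributes -1/2 and the threshold p/4 contributes +1/4.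
  have h := ex_exp_sum_le h0 h1 A fun e => -(a e / m)
  have hexp : ∀ e ∈ A, Real.exp (-(a e / m)) - 1 ≤ -(1 / (2 * m)) * a e := by
    intro e he
    have h1 := (ha e he).1
    have h2 := (ha e he).2
    have hx0 : 0 ≤ a e / m := by positivity
    have hx1 : a e / m ≤ 1 := (div_le_one hm).2 h2
    have hb := Real.exp_bound_div_one_sub_of_interval hx0
    have h3 : Real.exp (-(a e / m)) ≤ 1 / (1 + a e / m) := by
      rw [Real.exp_neg, ← one_div]
      apply one_div_le_one_div_of_le (by positivity)
      linarith [Real.add_one_le_exp (a e / m)]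
    have h4 : 1 / (1 + a e / m) ≤ 1 - (a e / m) / 2 := by
      rw [div_le_iff₀ (by positivity)]; nlinarith
    have h5 : -(1 / (2 * m)) * a e = - ((a e / m) / 2) := by field_simp
    rw [h5]; linarith
  calc _ ≤ ex p (fun S => Real.exp (∑ e ∈ A, -(a e / m) * ind (e ∈ S)) *
            Real.exp (1 / m * (p / 4 * ∑ e ∈ A, a e))) := by
        refine pr_le_ex h0 h1 (fun S => by positivity) fun S hS => ?_
        rw [← Real.exp_add]
        apply Real.one_le_exp
        have : ∑ e ∈ A, -(a e / m) * ind (e ∈ S) = -(1 / m * ∑ e ∈ A, a e * ind (e ∈ S)) := by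
          rw [Finset.mul_sum, ← Finset.sum_neg_distrib]
          exact Finset.sum_congr rfl fun e _ => by ring
        rw [this]
        have : 0 ≤ 1 / m * (p / 4 * ∑ e ∈ A, a e - ∑ e ∈ A, a e * ind (e ∈ S)) :=
          mul_nonneg (by positivity) (by linarith)
        linarith
    _ ≤ _ := by
        rw [ex_mul_const]
        refine (mul_le_mul_of_nonneg_right h (by positivity)).trans ?_
        rw [← Real.exp_add]
        apply Real.exp_le_exp.2
        have h6 : ∑ e ∈ A, (Real.exp (-(a e / m)) - 1) ≤ -(1 / (2 * m)) * ∑ e ∈ A, a e := by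
          rw [Finset.mul_sum]; exact Finset.sum_le_sum hexp
        have h7 := mul_le_mul_of_nonneg_left h6 h0
        refine (add_le_add_left h7 _).trans_eq ?_
        field_simp; ring

end RandomSubset

/-! ### The binomial random graph as a random subset of `Sym2 V`. -/

section Bridge

open Finset

variable {V : Type*} [Fintype V] [DecidableEq V]

/-- The random subset also has diagonal coordinates, but `fromEdgeSet` discards them. So the event
is a product over the non-diagonal coordinates alone, and its probability factorises. -/
theorem ind_fromEdgeSet_eq (G : SimpleGraph V) (S : Finset (Sym2 V)) :
    ind (SimpleGraph.fromEdgeSet (S : Set (Sym2 V)) = G) =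
      ∏ e ∈ univ.filter fun e : Sym2 V => ¬ e.IsDiag,
        if e ∈ S then ind (e ∈ G.edgeSet) else ind (e ∉ G.edgeSet) := by
  have h : (SimpleGraph.fromEdgeSet (S : Set (Sym2 V)) = G) ↔
      ∀ e ∈ univ.filter (fun e : Sym2 V => ¬ e.IsDiag), (e ∈ S ↔ e ∈ G.edgeSet) := by
    constructor
    · rintro rfl e he
      simp only [mem_filter, mem_univ, true_and] at he
      simp [he]
    · intro h
      ext a b
      rw [SimpleGraph.fromEdgeSet_adj]
      constructor
      · rintro ⟨h1, h2⟩
        exact (h s(a, b) (by simpa using h2)).1 (by simpa using h1)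
      · intro hab
        exact ⟨by simpa using (h s(a, b) (by simpa using hab.ne)).2 hab, hab.ne⟩
  rw [propext h, ind_forall]
  refine Finset.prod_congr rfl fun e _ => ?_
  by_cases h1 : e ∈ S <;> by_cases h2 : e ∈ G.edgeSet <;> simp [ind, h1, h2]

theorem binomialRandom_real_singleton (p : I) (G : SimpleGraph V) :
    (SimpleGraph.binomialRandom V p).real {G} =
      ex (p : ℝ) fun S : Finset (Sym2 V) =>
        ind (SimpleGraph.fromEdgeSet (S : Set (Sym2 V)) = G) := by
  classical
  simp only [ind_fromEdgeSet_eq]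
  rw [ex_prod_ite_mem, measureReal_def, SimpleGraph.binomialRandom_singleton]
  have h1 : ∀ e : Sym2 V, ((p : ℝ) * ind (e ∈ G.edgeSet) + (1 - p) * ind (e ∉ G.edgeSet)) =
      if e ∈ G.edgeSet then (p : ℝ) else 1 - p := by
    intro e; by_cases h : e ∈ G.edgeSet <;> simp [ind, h]
  simp only [h1]
  rw [Finset.prod_ite, Finset.prod_const, Finset.prod_const]
  have h2 : ((univ.filter fun e : Sym2 V => ¬ e.IsDiag).filter fun e => e ∈ G.edgeSet).card =
      G.edgeSet.ncard := by
    rw [← Set.ncard_coe_finset]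
    congr 1
    ext e
    simp only [coe_filter, mem_filter, mem_univ, true_and, Set.mem_ofPred_eq]
    exact ⟨fun h => h.2, fun h => ⟨G.not_isDiag_of_mem_edgeSet h, h⟩⟩
  have h3 : ((univ.filter fun e : Sym2 V => ¬ e.IsDiag).filter fun e => e ∉ G.edgeSet).card =
      (Nat.card V).choose 2 - G.edgeSet.ncard := by
    have h4 := Finset.card_filter_add_card_filter_not
      (s := univ.filter fun e : Sym2 V => ¬ e.IsDiag) (fun e => e ∈ G.edgeSet)
    have h5 : (univ.filter fun e : Sym2 V => ¬ e.IsDiag).card = (Nat.card V).choose 2 := by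
      rw [Nat.card_eq_fintype_card, ← Sym2.card_subtype_not_diag, Fintype.card_subtype]
    omega
  rw [h2, h3]
  simp

/-- The law `G(V, p)` in terms of the `p`-random subset of `Sym2 V`. -/
theorem binomialRandom_real (p : I) (P : SimpleGraph V → Prop) :
    (SimpleGraph.binomialRandom V p).real {G | P G} =
      pr (p : ℝ) fun S : Finset (Sym2 V) => P (SimpleGraph.fromEdgeSet (S : Set (Sym2 V))) := by
  classical
  have h1 : (SimpleGraph.binomialRandom V p).real {G | P G} =
      ∑ G ∈ univ.filter P, (SimpleGraph.binomialRandom V p).real {G} := by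
    have : MeasurableSingletonClass (SimpleGraph V) := ⟨fun G => by
      convert SimpleGraph.measurable_edgeSet (measurableSet_singleton G.edgeSet) using 1
      ext H; simp⟩
    rw [sum_measureReal_singleton]; simp
  rw [h1, Finset.sum_filter]
  have h2 : ∀ S : Finset (Sym2 V), ind (P (SimpleGraph.fromEdgeSet (S : Set (Sym2 V)))) =
      ∑ G, if P G then ind (SimpleGraph.fromEdgeSet (S : Set (Sym2 V)) = G) else 0 := by
    intro S
    rw [Finset.sum_eq_single (SimpleGraph.fromEdgeSet (S : Set (Sym2 V)))]
    · simp [ind]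
    · intro G _ hG; rw [ind_false (Ne.symm hG)]; simp
    · simp
  unfold pr
  simp only [h2]
  rw [ex_sum]
  refine Finset.sum_congr rfl fun G _ => ?_
  split_ifs
  · exact binomialRandom_real_singleton p G
  · simp

theorem continuous_pr {ι : Type*} [Fintype ι] [DecidableEq ι] (P : Finset ι → Prop) :
    Continuous fun p : ℝ => pr p P := by
  unfold pr ex wt
  refine continuous_finsetSum _ fun S _ => Continuous.mul ?_ continuous_const
  refine continuous_finsetProd _ fun e _ => ?_
  split_ifs <;> fun_prop

/-- The probability is a polynomial in p and the unit interval is compact, so the maximum in the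
theorem is attained. -/
theorem exists_isGreatest_pr {ι : Type*} [Fintype ι] [DecidableEq ι] (P : Finset ι → Prop) :
    ∃ m, IsGreatest (Set.range fun p : I => pr (p : ℝ) P) m :=
  (isCompact_range ((continuous_pr P).comp continuous_subtype_val)).exists_isGreatest
    (Set.range_nonempty _)

end Bridge

/-! ### Duality between the triangle space and cocycles modulo coboundaries. -/

section Duality

variable {V : Type*} {G : SimpleGraph V}

/-- `f` is a `ℤ/2`-valued 1-cocycle of the clique complex of `G`. -/
structure IsCocycle (G : SimpleGraph V) (f : V → V → ZMod 2) : Prop where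
  symm : ∀ a b, f a b = f b a
  tri : ∀ a b c, G.Adj a b → G.Adj b c → G.Adj c a → f a b + f b c + f c a = 0

/-- `f` agrees on the edges of `G` with the coboundary of a function on the vertices. -/
def IsCoboundary (G : SimpleGraph V) (f : V → V → ZMod 2) : Prop :=
  ∃ g : V → ZMod 2, ∀ a b, G.Adj a b → f a b = g a + g b

theorem triangleSpace_le_cycleSpace : triangleSpace G ≤ cycleSpace G := by
  refine Submodule.span_mono ?_
  rintro x ⟨a, b, c, hab, hbc, hca, rfl⟩
  refine ⟨a, .cons hab (.cons hbc (.cons hca .nil)), ?_, ?_⟩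
  · rw [SimpleGraph.Walk.cons_isCycle_iff]
    have h1 := hab.ne; have h2 := hbc.ne; have h3 := hca.ne
    have := h1.symm; have := h2.symm; have := h3.symm
    simp [SimpleGraph.Walk.isPath_def, *]
  · congr 1; ext e; simp

/-- The sum telescopes along the walk modulo 2; in particular it vanishes on closed walks. -/
theorem sum_edges_coboundary {f : Sym2 V → ZMod 2} {g : V → ZMod 2}
    (h : ∀ a b, G.Adj a b → f s(a, b) = g a + g b) {u v : V} (w : G.Walk u v) :
    (w.edges.map f).sum = g u + g v := by
  induction w with
  | nil => simp [CharTwo.add_self_eq_zero]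
  | @cons u v w hadj q ih =>
    simp only [SimpleGraph.Walk.edges_cons, List.map_cons, List.sum_cons, ih, h _ _ hadj]
    linear_combination CharTwo.add_self_eq_zero (g v)

/-- If all cocycles are coboundaries then the triangles span the cycle space. -/
theorem triangleSpace_eq_cycleSpace [Fintype V]
    (h : ∀ f, IsCocycle G f → IsCoboundary G f) : triangleSpace G = cycleSpace G := by
  classical
  refine le_antisymm triangleSpace_le_cycleSpace (Submodule.span_le.2 ?_)
  rintro x ⟨v, c, hc, rfl⟩
  by_contra hx
  -- A functional that kills all triangles but not the given cycle. Its values on single edges form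
  -- a cocycle; if that is a coboundary, its sum around the cycle is zero, a contradiction.
  obtain ⟨ψ, hψx, hψ⟩ := Submodule.exists_dual_map_eq_bot_of_notMem hx inferInstance
  let F : Sym2 V → ZMod 2 := fun e => if he : e ∈ G.edgeSet then ψ (Pi.single ⟨e, he⟩ 1) else 0
  have hF : ∀ s : Finset (Sym2 V), (∀ e ∈ s, e ∈ G.edgeSet) →
      ψ (edgeVec G (s : Set (Sym2 V))) = ∑ e ∈ s, F e := by
    intro s hs
    have h1 : edgeVec G (s : Set (Sym2 V)) =
        ∑ e ∈ s.attach, Pi.single ⟨e.1, hs e.1 e.2⟩ 1 := by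
      ext e
      rw [Finset.sum_apply, edgeVec, Set.indicator_apply]
      simp only [Pi.single_apply]
      by_cases he : (e : Sym2 V) ∈ s
      · rw [Finset.sum_eq_single ⟨e, he⟩]
        · simp [he]
        · rintro ⟨b, hb⟩ _ hne
          rw [if_neg]; rintro rfl; exact hne rfl
        · simp
      · rw [Finset.sum_eq_zero]
        · simp [he]
        · rintro ⟨b, hb⟩ _
          rw [if_neg]; rintro rfl; exact he hb
    rw [h1, map_sum, ← Finset.sum_attach s]
    refine Finset.sum_congr rfl fun e _ => ?_
    simp [F, hs e.1 e.2]
  have hcoc : IsCocycle G fun a b => F s(a, b) := by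
    refine ⟨fun a b => by rw [Sym2.eq_swap], fun a b c hab hbc hca => ?_⟩
    have hmem : edgeVec G {s(a, b), s(b, c), s(c, a)} ∈ triangleSpace G :=
      Submodule.subset_span ⟨a, b, c, hab, hbc, hca, rfl⟩
    have h0 : ψ (edgeVec G {s(a, b), s(b, c), s(c, a)}) = 0 := by
      have := Submodule.mem_map_of_mem (f := ψ) hmem
      rw [hψ] at this; exact (Submodule.mem_bot (ZMod 2)).1 this
    have := hF {s(a, b), s(b, c), s(c, a)} (by
      intro e he
      simp only [Finset.mem_insert, Finset.mem_singleton] at he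
      rcases he with rfl | rfl | rfl <;> assumption)
    simp only [Finset.coe_insert, Finset.coe_singleton] at this
    rw [h0] at this
    have h1 := hab.ne; have h2 := hbc.ne; have h3 := hca.ne
    rw [Finset.sum_insert (by simp; grind), Finset.sum_insert (by simp; grind),
      Finset.sum_singleton] at this
    rw [this]; ring
  obtain ⟨g, hg⟩ := h _ hcoc
  have h2 := hF c.edges.toFinset (fun e he => c.edges_subset_edgeSet (by simpa using he))
  rw [List.sum_toFinset _ hc.1.1.edges_nodup, sum_edges_coboundary hg c,
    CharTwo.add_self_eq_zero] at h2
  apply hψx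
  convert h2 using 3
  ext e; simp

end Duality

/-! ### A cocycle close to a coboundary is a coboundary. -/

section Local

open Finset

variable {V : Type*} [Fintype V] [DecidableEq V]

/-- The adjacency indicator of `G`. -/
noncomputable def adj (G : SimpleGraph V) (u v : V) : ℝ := ind (G.Adj u v)

/-- The number of common neighbours of `u` and `v`. -/
noncomputable def codeg (G : SimpleGraph V) (u v : V) : ℝ := ∑ w, adj G u w * adj G v w

/-- The number of pairs in `S × T` that are adjacent. -/
noncomputable def pairCount (G : SimpleGraph V) (S T : Finset V) : ℝ :=
  ∑ u ∈ S, ∑ w ∈ T, adj G u w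

open Classical in
/-- The set of neighbours of `v`. -/
noncomputable def nbr (G : SimpleGraph V) (v : V) : Finset V := univ.filter fun u => G.Adj v u

open Classical in
/-- The set of neighbours of `v` along edges in the support of `f`. -/
noncomputable def oddNbr (G : SimpleGraph V) (f : V → V → ZMod 2) (v : V) : Finset V :=
  univ.filter fun u => G.Adj v u ∧ f v u = 1

variable {G : SimpleGraph V} {f : V → V → ZMod 2}

omit [Fintype V] [DecidableEq V] in
theorem adj_comm (u v : V) : adj G u v = adj G v u := by simp only [adj, G.adj_comm]

omit [Fintype V] [DecidableEq V] in
theorem adj_nonneg (u v : V) : 0 ≤ adj G u v := ind_nonneg _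

omit [Fintype V] [DecidableEq V] in
theorem adj_self (u : V) : adj G u u = 0 := ind_false (by simp)

omit [DecidableEq V] in
theorem codeg_comm (u v : V) : codeg G u v = codeg G v u := by simp only [codeg, mul_comm]

omit [DecidableEq V] in
theorem codeg_nonneg (u v : V) : 0 ≤ codeg G u v :=
  Finset.sum_nonneg fun _ _ => mul_nonneg (adj_nonneg _ _) (adj_nonneg _ _)

omit [DecidableEq V] in
theorem codeg_pos (hQ : EveryEdgeInTriangle G) {u v : V} (h : G.Adj u v) : 0 < codeg G u v := by
  obtain ⟨w, h1, h2⟩ := hQ u v h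
  refine Finset.sum_pos' (fun _ _ => mul_nonneg (adj_nonneg _ _) (adj_nonneg _ _))
    ⟨w, mem_univ _, ?_⟩
  rw [adj, adj, ind_true h2.symm, ind_true h1]; norm_num

omit [Fintype V] [DecidableEq V] in
theorem pairCount_nonneg (S T : Finset V) : 0 ≤ pairCount G S T :=
  Finset.sum_nonneg fun _ _ => Finset.sum_nonneg fun _ _ => adj_nonneg _ _

omit [DecidableEq V] in
theorem mem_nbr {v u : V} : u ∈ nbr G v ↔ G.Adj v u := by simp [nbr]

omit [DecidableEq V] in
theorem mem_oddNbr {v u : V} : u ∈ oddNbr G f v ↔ G.Adj v u ∧ f v u = 1 := by simp [oddNbr]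

omit [DecidableEq V] in
theorem oddNbr_subset_nbr (v : V) : oddNbr G f v ⊆ nbr G v := fun _ hu =>
  mem_nbr.2 (mem_oddNbr.1 hu).1

omit [DecidableEq V] in
theorem sum_oddNbr (v : V) (h : V → ℝ) :
    ∑ u ∈ oddNbr G f v, h u = ∑ u, ind (G.Adj v u ∧ f v u = 1) * h u := by
  classical
  rw [oddNbr, Finset.sum_filter]
  exact Finset.sum_congr rfl fun u _ => by simp only [ind]; split_ifs <;> simp

omit [DecidableEq V] in
theorem sum_nbr (v : V) (h : V → ℝ) : ∑ u ∈ nbr G v, h u = ∑ u, adj G v u * h u := by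
  classical
  rw [nbr, Finset.sum_filter]
  exact Finset.sum_congr rfl fun u _ => by simp only [adj, ind]; split_ifs <;> simp

-- Double counting of the edges between S and the neighbourhood of v. It turns codegree sums into
-- quantities controlled by the cut and density conditions.
omit [DecidableEq V] in
theorem sum_codeg_eq (S : Finset V) (v : V) :
    ∑ u ∈ S, codeg G u v = pairCount G S (nbr G v) := by
  simp only [codeg, pairCount, sum_nbr, mul_comm]

omit [DecidableEq V] in
theorem sum_rotate (h : V → V → V → ℝ) :
    ∑ u, ∑ v, ∑ w, h u v w = ∑ u, ∑ v, ∑ w, h v w u := by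
  conv_rhs => rw [Finset.sum_comm]
  refine Finset.sum_congr rfl fun u _ => ?_
  rw [Finset.sum_comm]

omit [DecidableEq V] in
/-- Each triangle contains zero or two edges of the support of a cocycle. -/
theorem sum_codeg_oddNbr (hf : IsCocycle G f) :
    ∑ v, ∑ u ∈ oddNbr G f v, codeg G u v =
      2 * ∑ v, pairCount G (oddNbr G f v) (oddNbr G f v) := by
  let F : V → V → ℝ := fun u v => ind (G.Adj u v ∧ f u v = 1)
  have hFs : ∀ u v, F u v = F v u := fun u v => by simp only [F, G.adj_comm u v, hf.symm u v]
  let h1 : V → V → V → ℝ := fun v u w => F v u * (adj G u w * adj G v w)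
  let h2 : V → V → V → ℝ := fun v u w => F v u * (F v w * adj G u w)
  have e1 : ∑ v, ∑ u ∈ oddNbr G f v, codeg G u v = ∑ v, ∑ u, ∑ w, h1 v u w := by
    refine Finset.sum_congr rfl fun v _ => ?_
    rw [sum_oddNbr]
    refine Finset.sum_congr rfl fun u _ => ?_
    simp only [codeg, Finset.mul_sum, h1, F]
  have e2 : ∑ v, pairCount G (oddNbr G f v) (oddNbr G f v) = ∑ v, ∑ u, ∑ w, h2 v u w := by
    refine Finset.sum_congr rfl fun v _ => ?_
    rw [pairCount, sum_oddNbr]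
    refine Finset.sum_congr rfl fun u _ => ?_
    rw [sum_oddNbr, Finset.mul_sum]
  have r1 : ∀ h : V → V → V → ℝ, 3 * ∑ v, ∑ u, ∑ w, h v u w =
      ∑ v, ∑ u, ∑ w, (h v u w + h u w v + h w v u) := by
    intro h
    simp only [Finset.sum_add_distrib]
    rw [← sum_rotate h, ← sum_rotate fun a b c => h b c a, ← sum_rotate h]; ring
  -- The identity holds triangle by triangle only after summing over the three rotations: h1 then
  -- counts the odd edges of the triangle and h2 the vertices at which two odd edges meet. These are
  -- 2 and 1, or 0 and 0.
  have key : ∀ v u w, h1 v u w + h1 u w v + h1 w v u =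
      2 * (h2 v u w + h2 u w v + h2 w v u) := by
    intro v u w
    simp only [h1, h2, hFs u v, hFs w v, hFs w u, adj_comm u v, adj_comm w v, adj_comm w u]
    by_cases a1 : G.Adj v u
    · by_cases a2 : G.Adj u w
      · by_cases a3 : G.Adj v w
        · have ht := hf.tri v u w a1 a2 a3.symm
          rw [hf.symm w v] at ht
          have two : ∀ x : ZMod 2, x = 0 ∨ x = 1 := by decide
          simp only [F, adj, a1, a2, a3, true_and, ind_true]
          rcases two (f v u) with h | h <;> rcases two (f u w) with h' | h' <;>
            rcases two (f v w) with h'' | h'' <;> rw [h, h', h''] at ht ⊢ <;>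
            first | (exfalso; revert ht; decide) | norm_num [ind]
        · simp [F, adj, a3, ind]
      · simp [F, adj, a2, ind]
    · simp [F, adj, a1, ind]
  rw [e1, e2]
  have := r1 h1
  have h3 := r1 h2
  simp only [key, ← Finset.mul_sum] at this
  linarith

/-- A cocycle with small support is zero on the edges, provided that no vertex is incident to more
support edges than other edges and that `G` is sufficiently pseudorandom. -/
theorem oddNbr_eq_empty (hf : IsCocycle G f) {r D θ κ β : ℝ} (hr : 0 < r) (hD : 0 < D)
    (hκ : 0 < κ)
    (hQ : EveryEdgeInTriangle G)
    (hlight : ∀ v u w, G.Adj v u → G.Adj v w → u ≠ w → θ * D < codeg G u v ∨ θ * D < codeg G w v)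
    (hθ : 0 ≤ θ)
    (hsmall : ∀ S : Finset V, (S.card : ℝ) ≤ κ * r → pairCount G S S ≤ θ / 8 * S.card * D)
    (hlarge : ∀ v, ∀ S ⊆ nbr G v, κ * r ≤ S.card → 2 * (S.card : ℝ) ≤ (nbr G v).card →
      9 / 20 * S.card * D ≤ pairCount G S (nbr G v \ S) ∧
      pairCount G S S - pairCount G S (nbr G v \ S) ≤ 1 / 10 * S.card * D)
    (hsparse : ∀ B : Finset V, (B.card : ℝ) ≤ β → pairCount G B B ≤ κ / 60 * r * B.card)
    (hcodeg : ∀ u v, G.Adj u v → codeg G u v ≤ 6 * D)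
    (hhalf : ∀ v, 2 * ((oddNbr G f v).card : ℝ) ≤ (nbr G v).card)
    (htot : ∑ v, ((oddNbr G f v).card : ℝ) ≤ β * (κ * r)) (v : V) :
    oddNbr G f v = ∅ := by
  classical
  set S := oddNbr G f with hS
  -- B consists of the vertices of large odd degree, and X below is the sum of their odd degrees.
  -- The bound `htot` on the total makes B small enough for `hsparse`.
  let B := univ.filter fun v => κ * r < (S v).card
  let c : V → ℝ := fun v => ∑ u ∈ S v, codeg G u v
  let q : V → ℝ := fun v => pairCount G (S v) (S v)
  let X := ∑ v ∈ B, ((S v).card : ℝ)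
  have hκr : 0 < κ * r := mul_pos hκ hr
  have hc0 : ∀ v, 0 ≤ c v := fun v => Finset.sum_nonneg fun u _ => codeg_nonneg _ _
  have htri : ∑ v, c v = 2 * ∑ v, q v := sum_codeg_oddNbr hf
  have hBmem : ∀ v, v ∈ B ↔ κ * r < (S v).card := fun v => by simp [B]
  have hXB : κ * r * B.card ≤ X := by
    have : ∑ v ∈ B, κ * r ≤ X := Finset.sum_le_sum fun v hv => ((hBmem v).1 hv).le
    rw [Finset.sum_const, nsmul_eq_mul] at this; linarith
  have hX0 : 0 ≤ X := Finset.sum_nonneg fun _ _ => Nat.cast_nonneg _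
  have hBβ : (B.card : ℝ) ≤ β := by
    have h1 : X ≤ ∑ v, ((S v).card : ℝ) :=
      Finset.sum_le_sum_of_subset_of_nonneg (subset_univ _) fun _ _ _ => Nat.cast_nonneg _
    have : κ * r * B.card ≤ κ * r * β := by linarith
    exact le_of_mul_le_mul_left this hκr
  -- At most one odd neighbour has codegree ≤ θD with v, so c ≥ (|S| - 1)θD ≥ |S|θD/2 when |S| ≥ 2,
  -- which is four times the bound θ|S|D/8 for q. If |S| ≤ 1 then q = 0.
  have hlow : ∀ v, v ∉ B → 4 * q v ≤ c v := by
    intro v hv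
    have hle : ((S v).card : ℝ) ≤ κ * r := not_lt.1 fun h => hv ((hBmem v).2 h)
    rcases Nat.lt_or_ge (S v).card 2 with hlt | hge
    · have : q v = 0 := by
        refine Finset.sum_eq_zero fun a ha => Finset.sum_eq_zero fun b hb => ?_
        rw [Finset.card_le_one.1 (Nat.lt_succ_iff.1 hlt) a ha b hb, adj_self]
      rw [this]; simpa using hc0 v
    · have h1 := hsmall (S v) hle
      have h2 : ((S v).card - 1 : ℝ) * (θ * D) ≤ c v := by
        by_cases hx : ∃ x ∈ S v, codeg G x v ≤ θ * D
        · obtain ⟨x, hxS, hx⟩ := hx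
          have h3 : ∑ u ∈ (S v).erase x, θ * D ≤ ∑ u ∈ (S v).erase x, codeg G u v := by
            refine Finset.sum_le_sum fun u hu => ?_
            have hu' := Finset.mem_erase.1 hu
            rcases hlight v u x (mem_oddNbr.1 hu'.2).1 (mem_oddNbr.1 hxS).1 hu'.1 with h | h
            · exact h.le
            · exact absurd h (not_lt.2 hx)
          rw [Finset.sum_const, Finset.card_erase_of_mem hxS, nsmul_eq_mul,
            Nat.cast_sub (by omega)] at h3
          refine h3.trans ?_ |>.trans' (by simp)
          exact Finset.sum_le_sum_of_subset_of_nonneg (Finset.erase_subset _ _)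
            fun u _ _ => codeg_nonneg _ _
        · push Not at hx
          have h3 : ∑ u ∈ S v, θ * D ≤ c v := Finset.sum_le_sum fun u hu => (hx u hu).le
          rw [Finset.sum_const, nsmul_eq_mul] at h3
          nlinarith [mul_nonneg hθ hD.le]
      have h4 : (2 : ℝ) ≤ (S v).card := by exact_mod_cast hge
      have h5 : q v ≤ θ / 8 * (S v).card * D := h1
      have h6 := mul_nonneg hθ hD.le
      nlinarith
  have hsplit : ∀ v, c v = pairCount G (S v) (nbr G v \ S v) + q v := by
    intro v
    simp only [c, q, sum_codeg_eq, pairCount, ← Finset.sum_add_distrib]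
    exact Finset.sum_congr rfl fun u _ => (Finset.sum_sdiff (oddNbr_subset_nbr v)).symm
  -- By `hsplit`, c - 2q counts the pairs leaving S inside the neighbourhood minus those within S.
  -- Here `hhalf` is what makes `hlarge` applicable.
  have hhigh : ∀ v ∈ B, 9 / 20 * (S v).card * D ≤ c v ∧ -(1 / 10 * (S v).card * D) ≤ c v - 2 * q v := by
    intro v hv
    obtain ⟨h1, h2⟩ := hlarge v (S v) (oddNbr_subset_nbr v) ((hBmem v).1 hv).le (hhalf v)
    have := hsplit v
    have hq : 0 ≤ q v := pairCount_nonneg _ _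
    constructor
    · linarith
    · have : pairCount G (S v) (S v) = q v := rfl
      linarith
  let Z := ∑ v ∈ Bᶜ, c v
  have hZ0 : 0 ≤ Z := Finset.sum_nonneg fun v _ => hc0 v
  -- In the identity ∑ (c - 2q) = 0, the vertices of B contribute at least -XD/10, and the others at
  -- least Z/2 because there 2q ≤ c/2.
  have h1 : Z ≤ 1 / 5 * X * D := by
    have e0 : ∑ v ∈ B, (c v - 2 * q v) + ∑ v ∈ Bᶜ, (c v - 2 * q v) = 0 := by
      rw [Finset.sum_add_sum_compl, Finset.sum_sub_distrib, ← Finset.mul_sum, htri, sub_self]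
    have e1 : -(1 / 10 * X * D) ≤ ∑ v ∈ B, (c v - 2 * q v) := by
      have : ∑ v ∈ B, -(1 / 10 * ((S v).card : ℝ) * D) ≤ ∑ v ∈ B, (c v - 2 * q v) :=
        Finset.sum_le_sum fun v hv => (hhigh v hv).2
      rwa [Finset.sum_neg_distrib, ← Finset.sum_mul, ← Finset.mul_sum] at this
    have e2 : 1 / 2 * Z ≤ ∑ v ∈ Bᶜ, (c v - 2 * q v) := by
      rw [Finset.mul_sum]
      refine Finset.sum_le_sum fun v hv => ?_
      have := hlow v (Finset.mem_compl.1 hv)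
      linarith
    linarith
  -- An odd edge from B to its complement is also counted in Z, from its other end. The edges inside
  -- B that must be removed cost at most 6D·(κ/60)r|B| ≤ XD/10. The resulting 7/20·XD ≤ Z ≤ 1/5·XD
  -- forces X = 0.
  have h2 : 9 / 20 * X * D - 6 * D * (X / 60) ≤ Z := by
    have a1 : ∑ v ∈ Bᶜ, ∑ u ∈ S v ∩ B, codeg G u v ≤ Z :=
      Finset.sum_le_sum fun v _ => Finset.sum_le_sum_of_subset_of_nonneg Finset.inter_subset_left
        fun _ _ _ => codeg_nonneg _ _
    have a2 : ∑ v ∈ Bᶜ, ∑ u ∈ S v ∩ B, codeg G u v = ∑ u ∈ B, ∑ v ∈ S u \ B, codeg G v u := by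
      rw [Finset.sum_comm' (t' := B) (s' := fun u => S u \ B)]
      · exact Finset.sum_congr rfl fun u _ => Finset.sum_congr rfl fun v _ => codeg_comm _ _
      · intro v u
        simp only [Finset.mem_compl, Finset.mem_inter, Finset.mem_sdiff, hS, mem_oddNbr,
          G.adj_comm u v, hf.symm u v]
        tauto
    have a3 : ∑ u ∈ B, ∑ v ∈ S u \ B, codeg G v u =
        ∑ u ∈ B, c u - ∑ u ∈ B, ∑ v ∈ S u ∩ B, codeg G v u := by
      rw [← Finset.sum_sub_distrib]
      refine Finset.sum_congr rfl fun u _ => ?_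
      rw [eq_sub_iff_add_eq, add_comm]
      exact Finset.sum_inter_add_sum_sdiff _ _ _
    have a4 : ∑ u ∈ B, ∑ v ∈ S u ∩ B, codeg G v u ≤ 6 * D * (X / 60) := by
      calc ∑ u ∈ B, ∑ v ∈ S u ∩ B, codeg G v u ≤ ∑ u ∈ B, ∑ v ∈ S u ∩ B, 6 * D * adj G u v := by
            refine Finset.sum_le_sum fun u _ => Finset.sum_le_sum fun v hv => ?_
            have := (mem_oddNbr.1 (Finset.mem_inter.1 hv).1).1
            rw [adj, ind_true this, mul_one]
            exact hcodeg v u this.symm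
        _ ≤ ∑ u ∈ B, ∑ v ∈ B, 6 * D * adj G u v :=
            Finset.sum_le_sum fun u _ => Finset.sum_le_sum_of_subset_of_nonneg
              Finset.inter_subset_right fun v _ _ => mul_nonneg (by linarith) (adj_nonneg _ _)
        _ = 6 * D * pairCount G B B := by simp only [pairCount, Finset.mul_sum]
        _ ≤ _ := by
            refine mul_le_mul_of_nonneg_left ?_ (by linarith)
            have := hsparse B hBβ
            linarith
    have a5 : 9 / 20 * X * D ≤ ∑ u ∈ B, c u := by
      have : ∑ v ∈ B, 9 / 20 * ((S v).card : ℝ) * D ≤ ∑ v ∈ B, c v :=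
        Finset.sum_le_sum fun v hv => (hhigh v hv).1
      rwa [← Finset.sum_mul, ← Finset.mul_sum] at this
    linarith
  have hXz : X = 0 := by
    by_contra hne
    have : 0 < X := lt_of_le_of_ne hX0 (Ne.symm hne)
    have := mul_pos this hD
    linarith
  have hZz : Z = 0 := by rw [hXz] at h1; linarith
  have hBe : v ∉ B := by
    intro hv
    have := (Finset.sum_eq_zero_iff_of_nonneg fun _ _ => Nat.cast_nonneg _).1 hXz v hv
    have h3 := (hBmem v).1 hv
    rw [this] at h3; linarith
  have hcv : c v = 0 :=
    (Finset.sum_eq_zero_iff_of_nonneg fun u _ => hc0 u).1 hZz v (Finset.mem_compl.2 hBe)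
  -- Now every codegree sum c(v) vanishes, whereas under Q an odd edge has positive codegree.
  by_contra hne
  obtain ⟨u, hu⟩ := Finset.nonempty_iff_ne_empty.2 hne
  have := (Finset.sum_eq_zero_iff_of_nonneg fun u _ => codeg_nonneg _ _).1 hcv u hu
  have h3 := codeg_pos hQ (mem_oddNbr.1 hu).1.symm
  linarith

/-- The number of ordered adjacent pairs on which `f` differs from the coboundary of `g`. -/
noncomputable def defect (G : SimpleGraph V) (f : V → V → ZMod 2) (g : V → ZMod 2) : ℝ :=
  ∑ v, ((oddNbr G (fun a b => f a b + g a + g b) v).card : ℝ)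

omit [DecidableEq V] in
theorem defect_eq (g : V → ZMod 2) :
    defect G f g = ∑ u, ∑ v, ind (G.Adj u v ∧ f u v + g u + g v = 1) := by
  refine Finset.sum_congr rfl fun v _ => ?_
  have := sum_oddNbr (G := G) (f := fun a b => f a b + g a + g b) v fun _ => 1
  simpa using this

/-- Isolates the row and column of v, the only terms that change when g is modified at v. -/
theorem sum_symm_split (h : V → V → ℝ) (hs : ∀ x y, h x y = h y x) (v : V) (hv : h v v = 0) :
    ∑ x, ∑ y, h x y = 2 * ∑ y, h v y + ∑ x ∈ univ.erase v, ∑ y ∈ univ.erase v, h x y := by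
  rw [← Finset.add_sum_erase _ _ (mem_univ v)]
  have : ∀ x, ∑ y, h x y = h v x + ∑ y ∈ univ.erase v, h x y := fun x => by
    rw [← Finset.add_sum_erase _ _ (mem_univ v), hs x v]
  rw [Finset.sum_congr rfl fun x _ => this x, Finset.sum_add_distrib]
  rw [← Finset.add_sum_erase _ (fun y => h v y) (mem_univ v), hv]
  ring

/-- Changing g at a single vertex v exchanges the odd and the even edges at v and affects no others.
So at a global minimum of the defect at most half of the edges at v are odd. -/
theorem exists_minimal_defect (hf : IsCocycle G f) (g₀ : V → ZMod 2) :
    ∃ g : V → ZMod 2, defect G f g ≤ defect G f g₀ ∧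
      ∀ v, 2 * ((oddNbr G (fun a b => f a b + g a + g b) v).card : ℝ) ≤ (nbr G v).card := by
  obtain ⟨g, hg⟩ := Finite.exists_min (defect G f)
  refine ⟨g, hg g₀, fun v => ?_⟩
  have h1 := hg (Function.update g v (g v + 1))
  rw [defect_eq, defect_eq] at h1
  have hsym : ∀ (g' : V → ZMod 2) x y, ind (G.Adj x y ∧ f x y + g' x + g' y = 1) =
      ind (G.Adj y x ∧ f y x + g' y + g' x = 1) := fun g' x y => by
    rw [G.adj_comm x y, hf.symm x y, add_right_comm]
  rw [sum_symm_split _ (hsym g) v (ind_false (by simp)),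
    sum_symm_split _ (hsym _) v (ind_false (by simp))] at h1
  have h2 : ∑ x ∈ univ.erase v, ∑ y ∈ univ.erase v, ind (G.Adj x y ∧ f x y +
      Function.update g v (g v + 1) x + Function.update g v (g v + 1) y = 1) =
      ∑ x ∈ univ.erase v, ∑ y ∈ univ.erase v, ind (G.Adj x y ∧ f x y + g x + g y = 1) := by
    refine Finset.sum_congr rfl fun x hx => Finset.sum_congr rfl fun y hy => ?_
    rw [Function.update_of_ne (Finset.ne_of_mem_erase hx),
      Function.update_of_ne (Finset.ne_of_mem_erase hy)]
  have h3 : ∑ y, ind (G.Adj v y ∧ f v y + Function.update g v (g v + 1) v +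
      Function.update g v (g v + 1) y = 1) =
      (nbr G v).card - ∑ y, ind (G.Adj v y ∧ f v y + g v + g y = 1) := by
    have : ((nbr G v).card : ℝ) = ∑ y, adj G v y := by simpa using sum_nbr (G := G) v fun _ => 1
    rw [this, ← Finset.sum_sub_distrib]
    refine Finset.sum_congr rfl fun y _ => ?_
    by_cases hvy : G.Adj v y
    · have key : ∀ a b c : ZMod 2, a + (b + 1) + c = 1 ↔ ¬ (a + b + c = 1) := by decide
      rw [Function.update_self, Function.update_of_ne hvy.ne', key]
      by_cases h : f v y + g v + g y = 1 <;> simp [ind, adj, h, hvy]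
    · simp [ind, adj, hvy]
  have h4 : ∑ y, ind (G.Adj v y ∧ f v y + g v + g y = 1) =
      ((oddNbr G (fun a b => f a b + g a + g b) v).card : ℝ) := by
    have := sum_oddNbr (G := G) (f := fun a b => f a b + g a + g b) v fun _ => 1
    simpa using this.symm
  rw [h2, h3, h4] at h1
  linarith

omit [Fintype V] [DecidableEq V] in
theorem IsCocycle.add_coboundary (hf : IsCocycle G f) (g : V → ZMod 2) :
    IsCocycle G fun a b => f a b + g a + g b := by
  refine ⟨fun a b => ?_, fun a b c hab hbc hca => ?_⟩
  · simp only [hf.symm a b]; ring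
  · linear_combination hf.tri a b c hab hbc hca + CharTwo.add_self_eq_zero (g a) +
      CharTwo.add_self_eq_zero (g b) + CharTwo.add_self_eq_zero (g c)

/-- In a sufficiently pseudorandom graph in which all edges are in triangles, each cocycle that is
close to a coboundary is a coboundary. -/
theorem IsCocycle.isCoboundary_of_defect_le (hf : IsCocycle G f) {r D θ κ β : ℝ} (hr : 0 < r)
    (hD : 0 < D) (hκ : 0 < κ)
    (hQ : EveryEdgeInTriangle G)
    (hlight : ∀ v u w, G.Adj v u → G.Adj v w → u ≠ w → θ * D < codeg G u v ∨ θ * D < codeg G w v)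
    (hθ : 0 ≤ θ)
    (hsmall : ∀ S : Finset V, (S.card : ℝ) ≤ κ * r → pairCount G S S ≤ θ / 8 * S.card * D)
    (hlarge : ∀ v, ∀ S ⊆ nbr G v, κ * r ≤ S.card → 2 * (S.card : ℝ) ≤ (nbr G v).card →
      9 / 20 * S.card * D ≤ pairCount G S (nbr G v \ S) ∧
      pairCount G S S - pairCount G S (nbr G v \ S) ≤ 1 / 10 * S.card * D)
    (hsparse : ∀ B : Finset V, (B.card : ℝ) ≤ β → pairCount G B B ≤ κ / 60 * r * B.card)
    (hcodeg : ∀ u v, G.Adj u v → codeg G u v ≤ 6 * D)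
    (hnear : ∃ g, defect G f g ≤ β * (κ * r)) : IsCoboundary G f := by
  obtain ⟨g₀, hg₀⟩ := hnear
  obtain ⟨g, hg, hhalf⟩ := exists_minimal_defect hf g₀
  refine ⟨g, fun a b hab => ?_⟩
  have := oddNbr_eq_empty (hf.add_coboundary g) hr hD hκ hQ hlight hθ hsmall hlarge hsparse hcodeg
    hhalf (hg.trans hg₀) a
  have hb : b ∉ oddNbr G (fun a b => f a b + g a + g b) a := by rw [this]; simp
  rw [mem_oddNbr] at hb
  have key : ∀ x y z : ZMod 2, ¬ (x + y + z = 1) → x = y + z := by decide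
  exact key _ _ _ fun h => hb ⟨hab, h⟩

end Local

/-! ### Edge counts, codegrees and dense spots of the random graph. -/

section RandomGraph

open Finset

variable {n : ℕ} {p : ℝ}

/-- The graph with a given set of edges (diagonal pairs are ignored). -/
def gr (S : Finset (Sym2 (Fin n))) : SimpleGraph (Fin n) :=
  SimpleGraph.fromEdgeSet (S : Set (Sym2 (Fin n)))

theorem gr_adj {S : Finset (Sym2 (Fin n))} {u v : Fin n} :
    (gr S).Adj u v ↔ s(u, v) ∈ S ∧ u ≠ v := by simp [gr]

theorem adj_gr {S : Finset (Sym2 (Fin n))} {u v : Fin n} (h : u ≠ v) :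
    adj (gr S) u v = ind (s(u, v) ∈ S) := by simp [adj, gr_adj, h]

/-- The unordered pairs obtained from a set of ordered pairs. -/
def pairSet (R : Finset (Fin n × Fin n)) : Finset (Sym2 (Fin n)) := R.image fun x => s(x.1, x.2)

theorem mem_pairSet {R : Finset (Fin n × Fin n)} {e : Sym2 (Fin n)} :
    e ∈ pairSet R ↔ ∃ u v, (u, v) ∈ R ∧ s(u, v) = e := by simp [pairSet]

theorem card_pairSet_product {A B : Finset (Fin n)} (h : Disjoint A B) :
    (pairSet (A ×ˢ B)).card = A.card * B.card := by
  rw [pairSet, Finset.card_image_of_injOn, Finset.card_product]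
  rintro ⟨a, b⟩ h1 ⟨c, d⟩ h2 h3
  simp only [coe_product, Set.mem_prod, mem_coe] at h1 h2
  simp only [Sym2.eq_iff] at h3
  rcases h3 with ⟨rfl, rfl⟩ | ⟨rfl, rfl⟩
  · rfl
  · exact absurd h2.2 (Finset.disjoint_left.1 h h1.1)

theorem pairCount_gr_disjoint {A B : Finset (Fin n)} (h : Disjoint A B)
    (S : Finset (Sym2 (Fin n))) :
    pairCount (gr S) A B = ((pairSet (A ×ˢ B) ∩ S).card : ℝ) := by
  rw [← sum_ind_mem, pairSet, Finset.sum_image, Finset.sum_product]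
  · exact Finset.sum_congr rfl fun a ha => Finset.sum_congr rfl fun b hb =>
      adj_gr (by rintro rfl; exact Finset.disjoint_left.1 h ha hb)
  · exact Finset.card_image_iff.1 ((card_pairSet_product h).trans (Finset.card_product _ _).symm)

theorem card_filter_le_two_mul (R : Finset (Fin n × Fin n)) (S : Finset (Sym2 (Fin n))) :
    ((R.filter fun x => s(x.1, x.2) ∈ S).card : ℝ) ≤ 2 * ((pairSet R ∩ S).card : ℝ) := by
  have h1 := Finset.card_le_mul_card_image (f := fun x : Fin n × Fin n => s(x.1, x.2))
    (R.filter fun x => s(x.1, x.2) ∈ S) 2 (by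
      intro e _
      induction e using Sym2.ind with
      | _ a b =>
        refine (Finset.card_le_card (t := {(a, b), (b, a)}) ?_).trans Finset.card_le_two
        rintro ⟨c, d⟩ h
        simp only [mem_filter, Sym2.eq_iff] at h
        simp only [mem_insert, mem_singleton, Prod.mk.injEq]
        exact h.2)
  have h2 : (R.filter fun x => s(x.1, x.2) ∈ S).image (fun x => s(x.1, x.2)) ⊆ pairSet R ∩ S := by
    intro e he
    obtain ⟨x, hx, rfl⟩ := Finset.mem_image.1 he
    exact Finset.mem_inter.2 ⟨Finset.mem_image_of_mem _ (Finset.mem_filter.1 hx).1,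
      (Finset.mem_filter.1 hx).2⟩
  have h3 := h1.trans (Nat.mul_le_mul_left 2 (Finset.card_le_card h2))
  exact_mod_cast h3

theorem card_pairSet_offDiag_le (A : Finset (Fin n)) :
    ((pairSet A.offDiag).card : ℝ) ≤ (A.card : ℝ) ^ 2 / 2 := by
  have h : (pairSet A.offDiag).card = A.card.choose 2 := Sym2.card_image_offDiag A
  rw [h, Nat.cast_choose_two]
  nlinarith [(Nat.cast_nonneg A.card : (0 : ℝ) ≤ A.card)]

theorem pairCount_gr_self_le (A : Finset (Fin n)) (S : Finset (Sym2 (Fin n))) :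
    pairCount (gr S) A A ≤ 2 * ((pairSet A.offDiag ∩ S).card : ℝ) := by
  refine le_trans (le_of_eq ?_) (card_filter_le_two_mul A.offDiag S)
  rw [Finset.card_filter, pairCount, ← Finset.sum_product', Nat.cast_sum,
    ← Finset.diag_union_offDiag, Finset.sum_union (Finset.disjoint_diag_offDiag A),
    Finset.sum_eq_zero (s := A.diag), zero_add]
  · refine Finset.sum_congr rfl fun x hx => ?_
    rw [adj_gr (Finset.mem_offDiag.1 hx).2.2, ind]; push_cast; split_ifs <;> rfl
  · intro x hx
    rw [(Finset.mem_diag.1 hx).2, adj_self]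

theorem sum_pow_card (x : ℝ) : ∑ A : Finset (Fin n), x ^ A.card = (1 + x) ^ n := by
  have := Fintype.sum_pow_mul_eq_add_pow (Fin n) x 1
  simpa [add_comm] using this

/-- The form in which union bounds over vertex sets A are evaluated, once each A costs x to the
power |A|. -/
theorem sum_pow_card_le {x : ℝ} (hx : 0 ≤ x) :
    ∑ A : Finset (Fin n), x ^ A.card ≤ Real.exp (n * x) := by
  rw [sum_pow_card, Real.exp_nat_mul]
  refine pow_le_pow_left₀ (by linarith) ?_ _
  linarith [Real.add_one_le_exp x]

/-- No set of at most `b` vertices spans more than `κ / 2` edges per vertex. -/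
theorem pr_exists_dense_le (h0 : 0 ≤ p) (h1 : p ≤ 1) {b κ t L : ℝ} (ht : 0 ≤ t)
    (hb : p * b * Real.exp t ≤ t * κ / 2) (hL : L ≤ t * κ / 4) :
    pr p (fun S : Finset (Sym2 (Fin n)) => ∃ A : Finset (Fin n), (A.card : ℝ) ≤ b ∧
      κ * A.card < pairCount (gr S) A A) ≤ Real.exp (n * Real.exp (-L)) - 1 := by
  let P : Finset (Fin n) → Finset (Sym2 (Fin n)) → Prop := fun A S =>
    (A.card : ℝ) ≤ b ∧ κ * A.card / 2 ≤ ((pairSet A.offDiag ∩ S).card : ℝ)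
  -- In the Chernoff exponent, `hb` bounds the mean term by tκ|A|/4, half of the gain tκ|A|/2. The
  -- remaining -tκ|A|/4 is at most -L|A|.
  have hA : ∀ A : Finset (Fin n), pr p (P A) ≤ Real.exp (-L) ^ A.card := by
    intro A
    by_cases hAb : (A.card : ℝ) ≤ b
    · refine (pr_mono h0 h1 (Q := fun S => κ * A.card / 2 ≤
        ((pairSet A.offDiag ∩ S).card : ℝ)) fun S hS => hS.2).trans ?_
      refine (pr_card_ge_le h0 h1 _ _ ht).trans ?_
      rw [← Real.exp_nat_mul]
      apply Real.exp_le_exp.2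
      have hc := card_pairSet_offDiag_le A
      have hs : (0 : ℝ) ≤ A.card := Nat.cast_nonneg _
      have e1 : p * (pairSet A.offDiag).card * (Real.exp t - 1) ≤
          p * ((A.card : ℝ) * b / 2) * Real.exp t := by
        have he : 0 ≤ Real.exp t - 1 := by linarith [Real.one_le_exp ht]
        have h2 : ((pairSet A.offDiag).card : ℝ) ≤ (A.card : ℝ) * b / 2 := by nlinarith
        calc _ ≤ p * ((A.card : ℝ) * b / 2) * (Real.exp t - 1) := by gcongr
          _ ≤ _ := by
            refine mul_le_mul_of_nonneg_left (by linarith) ?_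
            have : 0 ≤ b := hs.trans hAb
            positivity
      have e2 : p * ((A.card : ℝ) * b / 2) * Real.exp t ≤ A.card * (t * κ / 4) := by
        nlinarith
      nlinarith
    · have : pr p (P A) ≤ 0 := by
        refine (pr_mono h0 h1 (Q := fun _ => False) fun S hS => hAb hS.1).trans ?_
        simp [pr, ind]
      exact this.trans (by positivity)
  -- The empty set never satisfies the strict inequality; leaving it out removes the term 1 from the
  -- sum, without which the bound would not tend to 0.
  calc _ ≤ pr p (fun S => ∃ A ∈ univ.erase (∅ : Finset (Fin n)), P A S) := by
        refine pr_mono h0 h1 ?_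
        rintro S ⟨A, hAb, hlt⟩
        refine ⟨A, ?_, hAb, ?_⟩
        · rw [mem_erase]; refine ⟨?_, mem_univ _⟩
          rintro rfl; simp [pairCount] at hlt
        · have := pairCount_gr_self_le A S; linarith
    _ ≤ ∑ A ∈ univ.erase (∅ : Finset (Fin n)), pr p (P A) := pr_exists_le h0 h1 _ _
    _ ≤ ∑ A ∈ univ.erase (∅ : Finset (Fin n)), Real.exp (-L) ^ A.card :=
        Finset.sum_le_sum fun A _ => hA A
    _ = (∑ A : Finset (Fin n), Real.exp (-L) ^ A.card) - 1 := by
        rw [← Finset.add_sum_erase _ _ (mem_univ (∅ : Finset (Fin n)))]; simp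
    _ ≤ _ := by
        have := sum_pow_card_le (n := n) (Real.exp_pos (-L)).le
        linarith

/-- Functions of the edges between `P` and distinct vertices outside `P` are independent. -/
theorem ex_prod_star (P W : Finset (Fin n)) (hPW : Disjoint P W)
    (h : Fin n → Finset (Sym2 (Fin n)) → ℝ)
    (hdep : ∀ w ∈ W, DependsOn (h w) (P.image fun a => s(w, a))) :
    ex p (fun S => ∏ w ∈ W, h w S) = ∏ w ∈ W, ex p (h w) := by
  refine ex_prod_of_disjoint W h (fun w => P.image fun a => s(w, a)) hdep ?_
  intro w hw w' hw' hne
  rw [Finset.disjoint_left]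
  intro e he he'
  obtain ⟨a, ha, rfl⟩ := Finset.mem_image.1 he
  obtain ⟨a', ha', h3⟩ := Finset.mem_image.1 he'
  rcases Sym2.eq_iff.1 h3 with ⟨h4, _⟩ | ⟨h4, _⟩
  · exact hne h4.symm
  · exact Finset.disjoint_left.1 hPW ha (h4 ▸ hw')

theorem dependsOn_ind_mem {ι : Type*} [DecidableEq ι] {A : Finset ι} {e : ι} (h : e ∈ A) :
    DependsOn (fun S => ind (e ∈ S)) A := by
  refine dependsOn_comp fun S => ?_
  simp [h]

theorem DependsOn.comp₂ {ι : Type*} [DecidableEq ι] {g h : Finset ι → ℝ} {A : Finset ι}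
    (F : ℝ → ℝ → ℝ) (hg : DependsOn g A) (hh : DependsOn h A) :
    DependsOn (fun S => F (g S) (h S)) A := fun S T hST => by simp only [hg S T hST, hh S T hST]

theorem codeg_gr (S : Finset (Sym2 (Fin n))) (u v : Fin n) :
    codeg (gr S) u v = ∑ w ∈ ({u, v} : Finset (Fin n))ᶜ, ind (s(w, u) ∈ S) * ind (s(w, v) ∈ S) := by
  rw [codeg, ← Finset.sum_add_sum_compl ({u, v} : Finset (Fin n)), Finset.sum_eq_zero, zero_add]
  · refine Finset.sum_congr rfl fun w hw => ?_
    simp only [mem_compl, mem_insert, mem_singleton, not_or] at hw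
    rw [adj_comm, adj_gr hw.1, adj_comm, adj_gr hw.2]
  · intro w hw
    simp only [mem_insert, mem_singleton] at hw
    rcases hw with rfl | rfl <;> simp [adj_self]

theorem ind_eq_zero_or_one (P : Prop) : ind P = 0 ∨ ind P = 1 := by
  by_cases h : P <;> simp [ind, h]

theorem exp_mul_ind_mul_ind (t : ℝ) (P Q : Prop) :
    Real.exp (t * (ind P * ind Q)) = 1 + (Real.exp t - 1) * (ind P * ind Q) := by
  rcases ind_eq_zero_or_one P with h | h <;> rcases ind_eq_zero_or_one Q with h' | h' <;>
    simp [h, h']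

theorem ex_ind_mul_ind {ι : Type*} [Fintype ι] [DecidableEq ι] {e e' : ι} (h : e ≠ e') :
    ex p (fun S : Finset ι => ind (e ∈ S) * ind (e' ∈ S)) = p ^ 2 := by
  have := ex_prod_mem (p := p) ({e, e'} : Finset ι)
  rw [Finset.card_pair h] at this
  rw [← this]
  congr 1; funext S; rw [Finset.prod_pair h]

theorem ex_ind_mul_ind_mul_ind {ι : Type*} [Fintype ι] [DecidableEq ι] {a b c : ι} (h : a ≠ b)
    (h' : a ≠ c) (h'' : b ≠ c) :
    ex p (fun S : Finset ι => ind (a ∈ S) * ind (b ∈ S) * ind (c ∈ S)) = p ^ 3 := by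
  have := ex_prod_mem (p := p) ({a, b, c} : Finset ι)
  rw [Finset.card_eq_three.2 ⟨a, b, c, h, h', h'', rfl⟩] at this
  rw [← this]
  congr 1; funext S
  rw [Finset.prod_insert (by simp [h, h']), Finset.prod_pair h'', mul_assoc]

/-- Paths of length two from u to v through different w use disjoint pairs of edges, so their
factors are independent. The upper tail of the codegree uses c = e - 1; the event that no w in W is
adjacent to both uses c = -1. -/
theorem ex_prod_one_add_codeg {u v : Fin n} (huv : u ≠ v) (c : ℝ) (W : Finset (Fin n))
    (hW : Disjoint {u, v} W) :
    ex p (fun S : Finset (Sym2 (Fin n)) =>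
      ∏ w ∈ W, (1 + c * (ind (s(w, u) ∈ S) * ind (s(w, v) ∈ S)))) = (1 + c * p ^ 2) ^ W.card := by
  rw [ex_prod_star {u, v} W hW, Finset.prod_congr rfl, Finset.prod_const]
  · intro w _
    rw [ex_add, ex_const, ex_const_mul, ex_ind_mul_ind]
    intro h; rcases Sym2.eq_iff.1 h with ⟨_, h⟩ | ⟨h1, h2⟩
    · exact huv h
    · exact huv (h2.trans h1)
  · intro w _
    refine DependsOn.comp₂ (fun x y => 1 + c * (x * y)) (dependsOn_ind_mem ?_)
      (dependsOn_ind_mem ?_) <;> simp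

/-- Since e - 1 ≤ 2, the exponential moment with parameter 1 is at most exp(2np²), leaving
exp(-4np²) at the threshold 6np². This outweighs the n² choices of the pair. -/
theorem pr_codeg_ge_le (h0 : 0 ≤ p) (h1 : p ≤ 1) {u v : Fin n} (huv : u ≠ v) :
    pr p (fun S : Finset (Sym2 (Fin n)) => 6 * (n * p ^ 2) ≤ codeg (gr S) u v) ≤
      Real.exp (-(4 * (n * p ^ 2))) := by
  have hmgf : ex p (fun S : Finset (Sym2 (Fin n)) => Real.exp (1 * codeg (gr S) u v)) ≤
      Real.exp (2 * (n * p ^ 2)) := by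
    have : ∀ S : Finset (Sym2 (Fin n)), Real.exp (1 * codeg (gr S) u v) =
        ∏ w ∈ ({u, v} : Finset (Fin n))ᶜ,
          (1 + (Real.exp 1 - 1) * (ind (s(w, u) ∈ S) * ind (s(w, v) ∈ S))) := by
      intro S
      rw [codeg_gr, Finset.mul_sum, Real.exp_sum]
      exact Finset.prod_congr rfl fun w _ => exp_mul_ind_mul_ind _ _ _
    simp only [this]
    rw [ex_prod_one_add_codeg huv _ _ disjoint_compl_right]
    have he := Real.exp_one_lt_d9
    have he' := Real.one_le_exp (zero_le_one (α := ℝ))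
    have hp2 : 0 ≤ p ^ 2 := by positivity
    calc (1 + (Real.exp 1 - 1) * p ^ 2) ^ (({u, v} : Finset (Fin n))ᶜ).card
        ≤ (Real.exp (2 * p ^ 2)) ^ (({u, v} : Finset (Fin n))ᶜ).card := by
          refine pow_le_pow_left₀ (by nlinarith) ?_ _
          have := Real.add_one_le_exp (2 * p ^ 2)
          nlinarith
      _ ≤ (Real.exp (2 * p ^ 2)) ^ n := by
          refine pow_le_pow_right₀ (Real.one_le_exp (by positivity)) ?_
          simpa using Finset.card_le_univ (({u, v} : Finset (Fin n))ᶜ)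
      _ = _ := by rw [← Real.exp_nat_mul]; ring_nf
  calc _ ≤ ex p (fun S : Finset (Sym2 (Fin n)) => Real.exp (1 * codeg (gr S) u v) *
        Real.exp (-(6 * (n * p ^ 2)))) := by
        refine pr_le_ex h0 h1 (fun S => by positivity) fun S hS => ?_
        rw [← Real.exp_add]; apply Real.one_le_exp; linarith
    _ ≤ _ := by
        rw [ex_mul_const]
        refine (mul_le_mul_of_nonneg_right hmgf (by positivity)).trans_eq ?_
        rw [← Real.exp_add]; ring_nf

theorem pr_exists_codeg_ge_le (h0 : 0 ≤ p) (h1 : p ≤ 1) :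
    pr p (fun S : Finset (Sym2 (Fin n)) => ∃ u v, u ≠ v ∧ 6 * (n * p ^ 2) ≤ codeg (gr S) u v) ≤
      (n : ℝ) ^ 2 * Real.exp (-(4 * (n * p ^ 2))) := by
  calc _ ≤ pr p (fun S : Finset (Sym2 (Fin n)) => ∃ x ∈ (univ : Finset (Fin n)).offDiag,
          6 * (n * p ^ 2) ≤ codeg (gr S) x.1 x.2) := by
        refine pr_mono h0 h1 ?_
        rintro S ⟨u, v, huv, h⟩
        exact ⟨(u, v), by simpa using huv, h⟩
    _ ≤ ∑ x ∈ (univ : Finset (Fin n)).offDiag, Real.exp (-(4 * (n * p ^ 2))) :=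
        (pr_exists_le h0 h1 _ _).trans <| Finset.sum_le_sum fun x hx =>
          pr_codeg_ge_le h0 h1 (Finset.mem_offDiag.1 hx).2.2
    _ ≤ _ := by
        rw [Finset.sum_const, nsmul_eq_mul]
        refine mul_le_mul_of_nonneg_right ?_ (by positivity)
        have : ((univ : Finset (Fin n)).offDiag.card) ≤ n ^ 2 := by
          rw [Finset.offDiag_card]; simp; nlinarith [Nat.sub_le (n * n) n]
        exact_mod_cast this

/-- The contribution of a vertex `w` to the two codegrees of the pairs `vu` and `vx`. -/
theorem ex_cherry {a b d : Sym2 (Fin n)} (hab : a ≠ b) (had : a ≠ d) (hbd : b ≠ d) (c : ℝ) :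
    ex p (fun S : Finset (Sym2 (Fin n)) => (1 - c * (ind (b ∈ S) * ind (a ∈ S))) *
      (1 - c * (ind (d ∈ S) * ind (a ∈ S)))) = 1 - 2 * c * p ^ 2 + c ^ 2 * p ^ 3 := by
  have : ∀ S : Finset (Sym2 (Fin n)), (1 - c * (ind (b ∈ S) * ind (a ∈ S))) *
      (1 - c * (ind (d ∈ S) * ind (a ∈ S))) = 1 - c * (ind (b ∈ S) * ind (a ∈ S)) -
      c * (ind (d ∈ S) * ind (a ∈ S)) + c ^ 2 * (ind (a ∈ S) * ind (b ∈ S) * ind (d ∈ S)) := by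
    intro S
    rcases ind_eq_zero_or_one (a ∈ S) with h | h <;> rw [h] <;> ring
  simp only [this]
  rw [ex_add, ex_sub, ex_sub, ex_const, ex_const_mul, ex_const_mul, ex_const_mul,
    ex_ind_mul_ind hab.symm, ex_ind_mul_ind had.symm, ex_ind_mul_ind_mul_ind hab had hbd]
  ring

/-- The edges vu and vx are independent of the edges leaving {u, v, x}, and different w are
independent of each other. The two factors of a single w share the edge wv; `ex_cherry` accounts for
this, whence the term in p³. The Chernoff bound uses c = 1 - exp(-t), the second moment c = 1. -/
theorem ex_two_edges_cherries {u v x : Fin n} (huv : u ≠ v) (hxv : x ≠ v) (hux : u ≠ x) (c : ℝ) :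
    ex p (fun S : Finset (Sym2 (Fin n)) => (ind (s(v, u) ∈ S) * ind (s(v, x) ∈ S)) *
      ∏ w ∈ ({u, v, x} : Finset (Fin n))ᶜ, ((1 - c * (ind (s(w, u) ∈ S) * ind (s(w, v) ∈ S))) *
      (1 - c * (ind (s(w, x) ∈ S) * ind (s(w, v) ∈ S))))) =
      p ^ 2 * (1 - 2 * c * p ^ 2 + c ^ 2 * p ^ 3) ^ (n - 3) := by
  have hcard : (({u, v, x} : Finset (Fin n))ᶜ).card = n - 3 := by
    rw [Finset.card_compl, Fintype.card_fin, Finset.card_eq_three.2 ⟨u, v, x, huv, hux, hxv.symm, rfl⟩]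
  have inj : ∀ {w a b : Fin n}, a ≠ b → s(w, a) ≠ s(w, b) := by
    intro w a b hab h
    exact hab (Sym2.congr_right.1 h)
  let P : Finset (Fin n) := {u, v, x}
  have hdep : ∀ w, DependsOn (fun S : Finset (Sym2 (Fin n)) =>
      (1 - c * (ind (s(w, u) ∈ S) * ind (s(w, v) ∈ S))) *
      (1 - c * (ind (s(w, x) ∈ S) * ind (s(w, v) ∈ S)))) (P.image fun a => s(w, a)) := by
    intro w
    have h1 : DependsOn (fun S : Finset (Sym2 (Fin n)) => ind (s(w, u) ∈ S))
      (P.image fun a => s(w, a)) := dependsOn_ind_mem (by simp [P])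
    have h2 : DependsOn (fun S : Finset (Sym2 (Fin n)) => ind (s(w, v) ∈ S))
      (P.image fun a => s(w, a)) := dependsOn_ind_mem (by simp [P])
    have h3 : DependsOn (fun S : Finset (Sym2 (Fin n)) => ind (s(w, x) ∈ S))
      (P.image fun a => s(w, a)) := dependsOn_ind_mem (by simp [P])
    exact (h1.comp₂ (fun a b => 1 - c * (a * b)) h2).mul (h3.comp₂ (fun a b => 1 - c * (a * b)) h2)
  rw [ex_mul_of_disjoint (A := {s(v, u), s(v, x)}) (B := Pᶜ.biUnion fun w => P.image fun a => s(w, a)),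
    ex_ind_mul_ind (inj hux), ex_prod_star P Pᶜ disjoint_compl_right _ fun w _ => hdep w,
    Finset.prod_congr rfl, Finset.prod_const, hcard]
  · intro w _
    exact ex_cherry (inj huv.symm) (inj hxv.symm) (inj hux) c
  · exact (dependsOn_ind_mem (by simp)).mul (dependsOn_ind_mem (by simp))
  · exact DependsOn.prod fun w hw => (hdep w).mono
      (Finset.subset_biUnion_of_mem (fun w => P.image fun a => s(w, a)) hw)
  · rw [Finset.disjoint_left]
    intro e he he'
    obtain ⟨w, hw, he'⟩ := Finset.mem_biUnion.1 he'
    obtain ⟨a, ha, rfl⟩ := Finset.mem_image.1 he'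
    have hwP := Finset.mem_compl.1 hw
    simp only [P, mem_insert, mem_singleton, not_or] at hwP he
    rcases he with he | he <;> rcases Sym2.eq_iff.1 he with ⟨h, _⟩ | ⟨h, _⟩ <;> tauto

end RandomGraph

/-! ### Light edges, degrees and cuts in neighbourhoods. -/

section LocalEvents

open Finset

variable {n : ℕ} {p : ℝ}

/-- A joint lower-tail Chernoff bound: with c = 1 - exp(-t), the factor 1 - c·1 of a common
neighbour equals exp(-t). Omitting w = u, x only decreases the two codegrees. -/
theorem pr_two_light_le (h0 : 0 ≤ p) (h1 : p ≤ 1) {u v x : Fin n} (huv : u ≠ v) (hxv : x ≠ v)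
    (hux : u ≠ x) {t m : ℝ} (ht : 0 ≤ t) :
    pr p (fun S : Finset (Sym2 (Fin n)) => s(v, u) ∈ S ∧ s(v, x) ∈ S ∧
      codeg (gr S) u v ≤ m ∧ codeg (gr S) x v ≤ m) ≤
      p ^ 2 * (1 - 2 * (1 - Real.exp (-t)) * p ^ 2 + (1 - Real.exp (-t)) ^ 2 * p ^ 3) ^ (n - 3) *
        Real.exp (2 * t * m) := by
  set c := 1 - Real.exp (-t) with hc
  have hc1 : c ≤ 1 := by have := Real.exp_pos (-t); linarith
  have hc0 : 0 ≤ c := by have := Real.exp_le_one_iff.2 (neg_nonpos.2 ht); linarith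
  have hfac : ∀ a b : Prop, 0 ≤ 1 - c * (ind a * ind b) := fun a b => by
    rcases ind_eq_zero_or_one a with h | h <;> rcases ind_eq_zero_or_one b with h' | h' <;>
      simp [h, h', hc1]
  have hprod : ∀ (S : Finset (Sym2 (Fin n))) (a b : Fin n) (W : Finset (Fin n)),
      codeg (gr S) a v ≤ m → W ⊆ ({a, v} : Finset (Fin n))ᶜ →
      Real.exp (-(t * m)) ≤ ∏ w ∈ W, (1 - c * (ind (s(w, a) ∈ S) * ind (s(w, v) ∈ S))) := by
    intro S a b W hm hW
    have h2 : ∏ w ∈ W, (1 - c * (ind (s(w, a) ∈ S) * ind (s(w, v) ∈ S))) =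
        Real.exp (-t * ∑ w ∈ W, ind (s(w, a) ∈ S) * ind (s(w, v) ∈ S)) := by
      rw [Finset.mul_sum, Real.exp_sum]
      refine Finset.prod_congr rfl fun w _ => ?_
      rw [exp_mul_ind_mul_ind, hc]; ring
    rw [h2]
    apply Real.exp_le_exp.2
    have h3 : ∑ w ∈ W, ind (s(w, a) ∈ S) * ind (s(w, v) ∈ S) ≤ codeg (gr S) a v := by
      rw [codeg_gr]
      exact Finset.sum_le_sum_of_subset_of_nonneg hW fun _ _ _ =>
        mul_nonneg (ind_nonneg _) (ind_nonneg _)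
    nlinarith
  calc _ ≤ ex p (fun S : Finset (Sym2 (Fin n)) => (ind (s(v, u) ∈ S) * ind (s(v, x) ∈ S)) *
      (∏ w ∈ ({u, v, x} : Finset (Fin n))ᶜ, ((1 - c * (ind (s(w, u) ∈ S) * ind (s(w, v) ∈ S))) *
      (1 - c * (ind (s(w, x) ∈ S) * ind (s(w, v) ∈ S))))) * Real.exp (2 * t * m)) := by
        refine pr_le_ex h0 h1 (fun S => ?_) ?_
        · refine mul_nonneg (mul_nonneg (mul_nonneg (ind_nonneg _) (ind_nonneg _)) ?_)
            (Real.exp_pos _).le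
          exact Finset.prod_nonneg fun w _ => mul_nonneg (hfac _ _) (hfac _ _)
        · rintro S ⟨hu, hx, hmu, hmx⟩
          rw [ind_true hu, ind_true hx, Finset.prod_mul_distrib]
          have e1 := hprod S u u ({u, v, x} : Finset (Fin n))ᶜ hmu
            (Finset.compl_subset_compl.2 (by intro y; simp; tauto))
          have e2 := hprod S x u ({u, v, x} : Finset (Fin n))ᶜ hmx
            (Finset.compl_subset_compl.2 (by intro y; simp; tauto))
          have e3 := mul_le_mul e1 e2 (Real.exp_pos _).le ((Real.exp_pos _).le.trans e1)
          have e4 := mul_le_mul_of_nonneg_right e3 (Real.exp_pos (2 * t * m)).le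
          rw [← Real.exp_add, ← Real.exp_add] at e4
          rw [one_mul, one_mul]
          refine le_trans (le_of_eq ?_) e4
          rw [← Real.exp_zero]; congr 1; ring
    _ = _ := by rw [ex_mul_const, ex_two_edges_cherries huv hxv hux c]

theorem card_nbr_gr (S : Finset (Sym2 (Fin n))) (v : Fin n) :
    ((nbr (gr S) v).card : ℝ) = ((pairSet ({v} ×ˢ ({v} : Finset (Fin n))ᶜ) ∩ S).card : ℝ) := by
  rw [← pairCount_gr_disjoint disjoint_compl_right, pairCount, Finset.sum_singleton]
  have h1 : ((nbr (gr S) v).card : ℝ) = ∑ y, adj (gr S) v y := by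
    simpa using sum_nbr (G := gr S) v fun _ => 1
  rw [h1, ← Finset.sum_add_sum_compl ({v} : Finset (Fin n)), Finset.sum_singleton, adj_self,
    zero_add]

theorem card_star (v : Fin n) :
    ((pairSet ({v} ×ˢ ({v} : Finset (Fin n))ᶜ)).card : ℝ) = n - 1 := by
  rw [card_pairSet_product disjoint_compl_right, Finset.card_compl, Finset.card_singleton,
    Fintype.card_fin, one_mul, Nat.cast_sub (by have := v.2; omega)]
  simp

theorem exp_sub_one_le {x : ℝ} (hx : |x| ≤ 1) : Real.exp x - 1 ≤ x + x ^ 2 := by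
  have := (abs_le.1 (Real.abs_exp_sub_one_sub_id_le hx)).2
  linarith

/-- Upper tail of a count, for relative deviation `1 / 20`. -/
theorem pr_card_ge_mul_le (h0 : 0 ≤ p) (h1 : p ≤ 1) {ι : Type*} [Fintype ι] [DecidableEq ι]
    (A : Finset ι) {M : ℝ} (hA : (A.card : ℝ) ≤ M) :
    pr p (fun S => 21 / 20 * (p * M) ≤ ((A ∩ S).card : ℝ)) ≤ Real.exp (-(p * M / 1600)) := by
  -- With t = 1/40 and exp(t) - 1 ≤ t + t², the exponent is pM(t + t² - 21t/20) = -pMt², that is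
  -- -pM/1600.
  refine (pr_card_ge_le h0 h1 A _ (t := 1 / 40) (by norm_num)).trans (Real.exp_le_exp.2 ?_)
  have h2 := exp_sub_one_le (x := 1 / 40) (by rw [abs_of_pos] <;> norm_num)
  have h3 : (0 : ℝ) ≤ A.card := Nat.cast_nonneg _
  have h4 : p * A.card * (Real.exp (1 / 40) - 1) ≤ p * M * (1 / 40 + (1 / 40) ^ 2) := by
    have : 0 ≤ Real.exp (1 / 40) - 1 := by
      have := Real.one_le_exp (show (0 : ℝ) ≤ 1 / 40 by norm_num); linarith
    have hM : 0 ≤ M := h3.trans hA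
    gcongr
  linarith

/-- Lower tail of a count, for relative deviation `1 / 20`. -/
theorem pr_card_le_mul_le (h0 : 0 ≤ p) (h1 : p ≤ 1) {ι : Type*} [Fintype ι] [DecidableEq ι]
    (A : Finset ι) {M : ℝ} (hA : M ≤ A.card) :
    pr p (fun S => ((A ∩ S).card : ℝ) ≤ 19 / 20 * (p * M)) ≤ Real.exp (-(p * M / 1600)) := by
  refine (pr_card_le_le h0 h1 A _ (t := 1 / 40) (by norm_num)).trans (Real.exp_le_exp.2 ?_)
  have h2 := exp_sub_one_le (x := -(1 / 40)) (by rw [abs_neg, abs_of_pos] <;> norm_num)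
  have h4 : p * A.card * (Real.exp (-(1 / 40)) - 1) ≤
      p * M * (-(1 / 40) + (-(1 / 40)) ^ 2) := by
    have h5 := mul_le_mul_of_nonneg_left h2 (show 0 ≤ p * (A.card : ℝ) by positivity)
    have h6 := mul_le_mul_of_nonneg_left hA h0
    refine h5.trans ?_
    norm_num
    linarith
  linarith

theorem pr_degree_le (h0 : 0 ≤ p) (h1 : p ≤ 1) (v : Fin n) :
    pr p (fun S : Finset (Sym2 (Fin n)) =>
      ((nbr (gr S) v).card : ℝ) ≤ 19 / 20 * (p * (n - 1))) ≤
      Real.exp (-(p * (n - 1) / 1600)) := by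
  refine le_trans (pr_mono h0 h1 fun S h => ?_)
    (pr_card_le_mul_le h0 h1 (pairSet ({v} ×ˢ ({v} : Finset (Fin n))ᶜ)) (M := (n : ℝ) - 1)
      (card_star v).ge)
  rwa [card_nbr_gr] at h

theorem pr_le_degree (h0 : 0 ≤ p) (h1 : p ≤ 1) (v : Fin n) :
    pr p (fun S : Finset (Sym2 (Fin n)) =>
      21 / 20 * (p * n) ≤ ((nbr (gr S) v).card : ℝ)) ≤
      Real.exp (-(p * (n - 1) / 1600)) := by
  obtain ⟨A, hA⟩ : ∃ A, A = pairSet ({v} ×ˢ ({v} : Finset (Fin n))ᶜ) := ⟨_, rfl⟩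
  have h2 : (A.card : ℝ) ≤ n := by
    rw [hA]; exact (card_star v).trans_le (sub_le_self _ zero_le_one)
  refine (le_trans (pr_mono h0 h1 fun S h => ?_) (pr_card_ge_mul_le h0 h1 A h2)).trans ?_
  · rwa [card_nbr_gr, ← hA] at h
  · apply Real.exp_le_exp.2; linarith

theorem pr_exists_degree_le (h0 : 0 ≤ p) (h1 : p ≤ 1) :
    pr p (fun S : Finset (Sym2 (Fin n)) => ∃ v,
      ¬ (19 / 20 * (p * (n - 1)) < (nbr (gr S) v).card ∧
        ((nbr (gr S) v).card : ℝ) < 21 / 20 * (p * n))) ≤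
      n * (2 * Real.exp (-(p * (n - 1) / 1600))) := by
  calc _ ≤ pr p (fun S : Finset (Sym2 (Fin n)) => ∃ v ∈ (univ : Finset (Fin n)),
        ((nbr (gr S) v).card : ℝ) ≤ 19 / 20 * (p * (n - 1)) ∨
          21 / 20 * (p * n) ≤ ((nbr (gr S) v).card : ℝ)) := by
        refine pr_mono h0 h1 ?_
        rintro S ⟨v, hv⟩
        refine ⟨v, mem_univ _, ?_⟩
        rw [not_and_or, not_lt, not_lt] at hv; exact hv
    _ ≤ ∑ v : Fin n, 2 * Real.exp (-(p * (n - 1) / 1600)) := by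
        refine (pr_exists_le h0 h1 _ _).trans <| Finset.sum_le_sum fun v _ => ?_
        refine (pr_or_le h0 h1 _ _).trans ?_
        exact (add_le_add (pr_degree_le h0 h1 v) (pr_le_degree h0 h1 v)).trans_eq (two_mul _).symm
    _ = _ := by rw [Finset.sum_const, Finset.card_univ, Fintype.card_fin, nsmul_eq_mul]

/-- Cuts and induced subgraphs in neighbourhoods. -/
theorem pr_exists_bad_cut_le (h0 : 0 ≤ p) (h1 : p ≤ 1) {κ r : ℝ} (hκ : 0 ≤ κ) (hκ1 : κ ≤ 1)
    (hr : 0 ≤ r) (hbig : 6400 * 4 ≤ κ ^ 2 * (p * r)) :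
    pr p (fun S : Finset (Sym2 (Fin n)) => ∃ v, ∃ T : Finset (Fin n), nbr (gr S) v = T ∧
      9 / 10 * r ≤ T.card ∧ (T.card : ℝ) ≤ 2 * r ∧ ∃ A ⊆ T, κ * r ≤ A.card ∧
      2 * (A.card : ℝ) ≤ T.card ∧
      (pairCount (gr S) A (T \ A) ≤ 19 / 20 * (p * (A.card * (T \ A).card)) ∨
        21 / 20 * (p * A.card ^ 2) ≤ pairCount (gr S) A A)) ≤
      n * (2 * Real.exp (n * (p / 2) - 18 / 10 * r)) := by
  -- The neighbourhood is itself random, so the union bound runs over v, T and A. That v is joined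
  -- to all of T depends on edges at v, while the bad cut depends on edges inside T. Hence the two
  -- are independent, and the first supplies p^|T|, which makes the sum over T affordable.
  let E : Fin n → Finset (Fin n) → Finset (Fin n) → Finset (Sym2 (Fin n)) → Prop := fun v T A S =>
    (∀ e ∈ pairSet ({v} ×ˢ T), e ∈ S) ∧
      (((pairSet (A ×ˢ (T \ A)) ∩ S).card : ℝ) ≤ 19 / 20 * (p * (A.card * (T \ A).card)) ∨
        21 / 20 * (p * (A.card ^ 2 / 2)) ≤ ((pairSet A.offDiag ∩ S).card : ℝ))
  let good : Fin n → Finset (Fin n) → Prop := fun v T => v ∉ T ∧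
      9 / 10 * r ≤ T.card ∧ (T.card : ℝ) ≤ 2 * r
  let good' : Finset (Fin n) → Finset (Fin n) → Prop := fun T A => κ * r ≤ A.card ∧
      2 * (A.card : ℝ) ≤ T.card
  have hE : ∀ v T, good v T → ∀ A ⊆ T, good' T A → pr p (E v T A) ≤
      p ^ T.card * (2 * Real.exp (-(4 * T.card))) := by
    rintro v T ⟨hvT, hT1, hT2⟩ A hAT ⟨hA1, hA2⟩
    have hcard : (pairSet ({v} ×ˢ T)).card = T.card := by
      rw [card_pairSet_product (by simpa using hvT)]; simp
    have hind : ∀ B : Finset (Fin n × Fin n), (∀ x ∈ B, x.1 ∈ T ∧ x.2 ∈ T) →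
        Disjoint (pairSet ({v} ×ˢ T)) (pairSet B) := by
      intro B hB
      rw [Finset.disjoint_left]
      rintro e he he'
      obtain ⟨a, b, hab, rfl⟩ := mem_pairSet.1 he
      obtain ⟨a', b', hab', h⟩ := mem_pairSet.1 he'
      simp only [mem_product, mem_singleton] at hab
      obtain ⟨h3, h4⟩ := hB _ hab'
      rcases Sym2.eq_iff.1 h with ⟨h5, _⟩ | ⟨_, h5⟩
      · exact hvT (by rw [← hab.1, ← h5]; exact h3)
      · exact hvT (by rw [← hab.1, ← h5]; exact h4)
    have hdisj : Disjoint (pairSet ({v} ×ˢ T)) (pairSet (A ×ˢ (T \ A)) ∪ pairSet A.offDiag) := by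
      rw [Finset.disjoint_union_right]
      constructor
      · refine hind _ fun x hx => ?_
        have := Finset.mem_product.1 hx
        exact ⟨hAT this.1, (Finset.mem_sdiff.1 this.2).1⟩
      · refine hind _ fun x hx => ?_
        have := Finset.mem_offDiag.1 hx
        exact ⟨hAT this.1, hAT this.2.1⟩
    have hmul : pr p (E v T A) = p ^ T.card * pr p (fun S =>
        ((pairSet (A ×ˢ (T \ A)) ∩ S).card : ℝ) ≤ 19 / 20 * (p * (A.card * (T \ A).card)) ∨
        21 / 20 * (p * (A.card ^ 2 / 2)) ≤ ((pairSet A.offDiag ∩ S).card : ℝ)) := by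
      rw [← hcard, ← ex_prod_mem]
      simp only [pr, E, ind_and, ind_forall]
      refine ex_mul_of_disjoint (DependsOn.prod fun e he => dependsOn_ind_mem he)
        (dependsOn_comp fun S => ?_) hdisj
      have i1 : ∀ X Y : Finset (Sym2 (Fin n)), X ∩ (S ∩ (X ∪ Y)) = X ∩ S := by
        intro X Y; ext e; simp only [mem_inter, mem_union]; tauto
      have i2 : ∀ X Y : Finset (Sym2 (Fin n)), X ∩ (S ∩ (Y ∪ X)) = X ∩ S := by
        intro X Y; ext e; simp only [mem_inter, mem_union]; tauto
      rw [i1, i2]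
    rw [hmul]
    refine mul_le_mul_of_nonneg_left ?_ (by positivity)
    refine (pr_or_le h0 h1 _ _).trans ?_
    have hAc : (A.card : ℝ) + (T \ A).card = T.card := by
      exact_mod_cast by rw [add_comm]; exact Finset.card_sdiff_add_card_eq_card hAT
    have hκr : 0 ≤ κ * r := mul_nonneg hκ hr
    have hpr : 0 ≤ p * r := mul_nonneg h0 hr
    have hκ2 : κ ^ 2 ≤ κ := by nlinarith
    have hT0 : (0 : ℝ) ≤ T.card := Nat.cast_nonneg _
    have e1 : pr p (fun S => ((pairSet (A ×ˢ (T \ A)) ∩ S).card : ℝ) ≤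
        19 / 20 * (p * (A.card * (T \ A).card))) ≤ Real.exp (-(4 * T.card)) := by
      refine (pr_card_le_mul_le h0 h1 (pairSet (A ×ˢ (T \ A))) (M := A.card * (T \ A).card)
        ?_).trans (Real.exp_le_exp.2 ?_)
      · rw [card_pairSet_product Finset.disjoint_sdiff]; push_cast; rfl
      · have h2 : κ * r * (T.card / 2) ≤ A.card * (T \ A).card := by
          apply mul_le_mul hA1 (by linarith) (by positivity) (by positivity)
        have h3 := mul_le_mul_of_nonneg_left h2 h0
        have h4 : κ ^ 2 * (p * r) * T.card ≤ κ * (p * r) * T.card := by gcongr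
        nlinarith
    -- This case determines the constant 6400·4: |A| ≥ κr and r ≥ |T|/2 give the exponent
    -- κ²(pr)|T|/6400 ≥ 4|T|.
    have e2 : pr p (fun S => 21 / 20 * (p * (A.card ^ 2 / 2)) ≤
        ((pairSet A.offDiag ∩ S).card : ℝ)) ≤ Real.exp (-(4 * T.card)) := by
      refine (pr_card_ge_mul_le h0 h1 _ (card_pairSet_offDiag_le A)).trans (Real.exp_le_exp.2 ?_)
      have h2 : (κ * r) ^ 2 ≤ (A.card : ℝ) ^ 2 := by gcongr
      have h3 := mul_le_mul_of_nonneg_left h2 h0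
      have h4 : κ ^ 2 * (p * r) * T.card ≤ κ ^ 2 * (p * r) * (2 * r) := by gcongr
      nlinarith
    linarith
  calc _ ≤ ex p (fun S => ∑ v, ∑ T : Finset (Fin n), ind (good v T) * ∑ A ∈ T.powerset,
        ind (good' T A) * ind (E v T A S)) := by
        refine pr_le_ex h0 h1 (fun S => Finset.sum_nonneg fun v _ => Finset.sum_nonneg fun T _ =>
          mul_nonneg (ind_nonneg _) <| Finset.sum_nonneg fun A _ =>
            mul_nonneg (ind_nonneg _) (ind_nonneg _)) ?_
        rintro S ⟨v, T, rfl, hT1, hT2, A, hAT, hA1, hA2, hbad⟩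
        set T := nbr (gr S) v
        have hvT : v ∉ T := by simp [T, mem_nbr]
        have hEv : E v T A S := by
          refine ⟨fun e he => ?_, ?_⟩
          · obtain ⟨a, b, hab, rfl⟩ := mem_pairSet.1 he
            simp only [mem_product, mem_singleton] at hab
            have := mem_nbr.1 hab.2
            rw [hab.1]; exact (gr_adj.1 this).1
          · refine hbad.imp (fun h => ?_) fun h => ?_
            · rwa [pairCount_gr_disjoint Finset.disjoint_sdiff] at h
            · have := pairCount_gr_self_le A S; linarith
        have nn : ∀ v T, 0 ≤ ind (good v T) * ∑ A ∈ T.powerset, ind (good' T A) * ind (E v T A S) :=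
          fun v T => mul_nonneg (ind_nonneg _) <| Finset.sum_nonneg fun A _ =>
            mul_nonneg (ind_nonneg _) (ind_nonneg _)
        calc (1 : ℝ) = ind (good v T) * (ind (good' T A) * ind (E v T A S)) := by
              rw [ind_true ⟨hvT, hT1, hT2⟩, ind_true ⟨hA1, hA2⟩, ind_true hEv]; norm_num
          _ ≤ ind (good v T) * ∑ A ∈ T.powerset, ind (good' T A) * ind (E v T A S) := by
              refine mul_le_mul_of_nonneg_left ?_ (ind_nonneg _)
              exact Finset.single_le_sum (f := fun A => ind (good' T A) * ind (E v T A S))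
                (fun A _ => mul_nonneg (ind_nonneg _) (ind_nonneg _)) (Finset.mem_powerset.2 hAT)
          _ ≤ ∑ T : Finset (Fin n), ind (good v T) * ∑ A ∈ T.powerset,
                ind (good' T A) * ind (E v T A S) :=
              Finset.single_le_sum (f := fun T => ind (good v T) * ∑ A ∈ T.powerset,
                ind (good' T A) * ind (E v T A S)) (fun T _ => nn v T) (mem_univ T)
          _ ≤ _ := Finset.single_le_sum (f := fun v => ∑ T : Finset (Fin n), ind (good v T) *
                ∑ A ∈ T.powerset, ind (good' T A) * ind (E v T A S))
                (fun v _ => Finset.sum_nonneg fun T _ => nn v T) (mem_univ v)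
    _ = ∑ v, ∑ T : Finset (Fin n), ind (good v T) * ∑ A ∈ T.powerset,
        ind (good' T A) * pr p (E v T A) := by
        simp only [ex_sum, ex_const_mul, pr]
    -- There are 2^|T| sets A. Half of exp(-4|T|) gives exp(-1.8r) because |T| ≥ 0.9r, and the other
    -- half is at most 4^(-|T|), which turns (2p)^|T| into (p/2)^|T|.
    _ ≤ ∑ v : Fin n, ∑ T : Finset (Fin n), 2 * Real.exp (-(18 / 10 * r)) * (p / 2) ^ T.card := by
        refine Finset.sum_le_sum fun v _ => Finset.sum_le_sum fun T _ => ?_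
        by_cases hg : good v T
        · rw [ind_true hg, one_mul]
          calc _ ≤ ∑ A ∈ T.powerset, p ^ T.card * (2 * Real.exp (-(4 * T.card))) := by
                refine Finset.sum_le_sum fun A hA => ?_
                by_cases hg' : good' T A
                · rw [ind_true hg', one_mul]
                  exact hE v T hg A (Finset.mem_powerset.1 hA) hg'
                · rw [ind_false hg', zero_mul]; positivity
            _ = 2 * (2 * p) ^ T.card * Real.exp (-(4 * T.card)) := by
                rw [Finset.sum_const, Finset.card_powerset, nsmul_eq_mul, mul_pow]; push_cast; ring
            _ ≤ 2 * (2 * p) ^ T.card * (Real.exp (-(18 / 10 * r)) * (1 / 4) ^ T.card) := by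
                refine mul_le_mul_of_nonneg_left ?_ (by positivity)
                have h5 : Real.exp (-(4 * (T.card : ℝ))) =
                    Real.exp (-(2 * T.card)) * Real.exp (-2) ^ T.card := by
                  rw [← Real.exp_nat_mul, ← Real.exp_add]; congr 1; ring
                rw [h5]
                refine mul_le_mul (Real.exp_le_exp.2 (by linarith [hg.2.1])) ?_ (by positivity)
                  (by positivity)
                refine pow_le_pow_left₀ (by positivity) ?_ _
                rw [Real.exp_neg, show (1 / 4 : ℝ) = 4⁻¹ by norm_num]
                apply inv_anti₀ (by norm_num)
                have := Real.quadratic_le_exp_of_nonneg (show (0 : ℝ) ≤ 2 by norm_num)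
                linarith
            _ = _ := by
                rw [show (2 * p : ℝ) = 4 * (p / 2) by ring, mul_pow, one_div, inv_pow]
                field_simp
        · rw [ind_false hg, zero_mul]; positivity
    _ ≤ _ := by
        rw [Finset.sum_const, Finset.card_univ, Fintype.card_fin, nsmul_eq_mul, ← Finset.mul_sum]
        refine mul_le_mul_of_nonneg_left ?_ (Nat.cast_nonneg _)
        rw [mul_assoc]
        refine mul_le_mul_of_nonneg_left ?_ (by norm_num)
        refine (mul_le_mul_of_nonneg_left (sum_pow_card_le (by linarith)) (by positivity)).trans ?_
        rw [← Real.exp_add]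
        exact Real.exp_le_exp.2 (by linarith)

end LocalEvents

/-! ### The local pseudorandomness conditions hold with high probability in the dense range. -/

section Asymptotics

open Finset

/-- The property `P` fails with high probability, uniformly in `p` with `n p² ≥ (5/4) log n`. -/
def Negligible (P : ∀ n : ℕ, ℝ → Finset (Sym2 (Fin n)) → Prop) : Prop :=
  ∀ ε > 0, ∀ᶠ n : ℕ in atTop, ∀ p : ℝ, 0 ≤ p → p ≤ 1 → 5 / 4 * Real.log n ≤ n * p ^ 2 →
    pr p (P n p) ≤ ε

variable {P Q : ∀ n : ℕ, ℝ → Finset (Sym2 (Fin n)) → Prop}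

theorem Negligible.mono (hP : Negligible P) (h : ∀ᶠ n : ℕ in atTop, ∀ p : ℝ, 0 ≤ p → p ≤ 1 →
    5 / 4 * Real.log n ≤ n * p ^ 2 → ∀ S, Q n p S → P n p S) : Negligible Q := by
  intro ε hε
  filter_upwards [hP ε hε, h] with n h1 h2 p h0 h1' hD
  exact (pr_mono h0 h1' (h2 p h0 h1' hD)).trans (h1 p h0 h1' hD)

theorem Negligible.or (hP : Negligible P) (hQ : Negligible Q) :
    Negligible fun n p S => P n p S ∨ Q n p S := by
  intro ε hε
  filter_upwards [hP (ε / 2) (by linarith), hQ (ε / 2) (by linarith)] with n h1 h2 p h0 h1' hD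
  exact (pr_or_le h0 h1' _ _).trans (by linarith [h1 p h0 h1' hD, h2 p h0 h1' hD])

theorem negligible_of_le {b : ℕ → ℝ} (hb : Tendsto b atTop (𝓝 0))
    (h : ∀ᶠ n : ℕ in atTop, ∀ p : ℝ, 0 ≤ p → p ≤ 1 → 5 / 4 * Real.log n ≤ n * p ^ 2 →
      pr p (P n p) ≤ b n) : Negligible P := by
  intro ε hε
  filter_upwards [h, hb.eventually (ge_mem_nhds hε)] with n h1 h2 p h0 h1' hD
  exact (h1 p h0 h1' hD).trans h2

theorem tendsto_log_natCast : Tendsto (fun n : ℕ => Real.log n) atTop atTop :=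
  Real.tendsto_log_atTop.comp tendsto_natCast_atTop_atTop

theorem tendsto_sqrt_natCast : Tendsto (fun n : ℕ => √(n : ℝ)) atTop atTop :=
  Real.tendsto_sqrt_atTop.comp tendsto_natCast_atTop_atTop

theorem tendsto_mul_exp_neg_sqrt {c : ℝ} (hc : 0 < c) :
    Tendsto (fun n : ℕ => (n : ℝ) * Real.exp (-(c * √(n : ℝ)))) atTop (𝓝 0) := by
  have h1 := (Real.tendsto_pow_mul_exp_neg_atTop_nhds_zero 2).comp
    (tendsto_sqrt_natCast.const_mul_atTop hc)
  have h2 := h1.const_mul (1 / c ^ 2)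
  rw [mul_zero] at h2
  refine h2.congr fun n => ?_
  simp only [Function.comp]
  rw [mul_pow, Real.sq_sqrt (Nat.cast_nonneg n)]
  field_simp

theorem tendsto_exp_neg_log {c : ℝ} (hc : 0 < c) :
    Tendsto (fun n : ℕ => Real.exp (-(c * Real.log n))) atTop (𝓝 0) :=
  Real.tendsto_exp_neg_atTop_nhds_zero.comp (tendsto_log_natCast.const_mul_atTop hc)

/-- In the range considered, the average degree is at least `√n`. -/
theorem eventually_sqrt_le : ∀ᶠ n : ℕ in atTop, ∀ p : ℝ, 0 ≤ p →
    5 / 4 * Real.log n ≤ n * p ^ 2 → √(n : ℝ) ≤ n * p := by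
  filter_upwards [tendsto_log_natCast.eventually_ge_atTop 1] with n hn p h0 hD
  rw [Real.sqrt_le_left (by positivity)]
  have : (1 : ℝ) ≤ n * p ^ 2 := by linarith
  have h2 : (0 : ℝ) ≤ n := Nat.cast_nonneg n
  nlinarith

theorem eventually_log_le_sqrt {c : ℝ} (hc : 0 < c) :
    ∀ᶠ n : ℕ in atTop, Real.log n ≤ c * √(n : ℝ) := by
  have h := (isLittleO_log_rpow_atTop (r := 1 / 2) (by norm_num)).comp_tendsto
    tendsto_natCast_atTop_atTop
  filter_upwards [h.def hc] with n hn
  simp only [Function.comp] at hn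
  rw [← Real.sqrt_eq_rpow, Real.norm_eq_abs, Real.norm_eq_abs,
    abs_of_nonneg (Real.sqrt_nonneg _)] at hn
  exact (le_abs_self _).trans hn

theorem negligible_degree : Negligible fun n p S => ∃ v,
    ¬ (19 / 20 * (p * (n - 1)) < (nbr (gr S) v).card ∧
      ((nbr (gr S) v).card : ℝ) < 21 / 20 * (p * n)) := by
  have hb := (tendsto_mul_exp_neg_sqrt (c := 1 / 1600) (by norm_num)).const_mul
    (2 * Real.exp 1)
  rw [mul_zero] at hb
  refine negligible_of_le hb ?_
  filter_upwards [eventually_sqrt_le] with n hn p h0 h1 hD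
  refine (pr_exists_degree_le h0 h1).trans ?_
  have h2 := hn p h0 hD
  have h3 : Real.exp (-(p * (n - 1) / 1600)) ≤ Real.exp 1 * Real.exp (-(1 / 1600 * √(n : ℝ))) := by
    rw [← Real.exp_add]; apply Real.exp_le_exp.2; linarith
  have h4 := mul_le_mul_of_nonneg_left h3 (show (0 : ℝ) ≤ n * 2 by positivity)
  linarith

/-- The exchange rate for union bounds: D ≥ (5/4) log n lets exp(kD) absorb n^(5k/4). -/
theorem exp_natCast_log {n : ℕ} (hn : 0 < n) (k : ℝ) (hk : 0 ≤ k) (m : ℕ) {D : ℝ}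
    (hD : 5 / 4 * Real.log n ≤ D) (hm : (m : ℝ) ≤ 5 / 4 * k) :
    (n : ℝ) ^ m ≤ Real.exp (k * D) := by
  rw [← Real.exp_log (show (0 : ℝ) < n by exact_mod_cast hn), ← Real.exp_nat_mul]
  apply Real.exp_le_exp.2
  have h1 : 0 ≤ Real.log n := Real.log_natCast_nonneg n
  have h2 := mul_le_mul_of_nonneg_left hD hk
  have h3 := mul_le_mul_of_nonneg_right hm h1
  linarith

theorem negligible_codeg : Negligible fun n p S =>
    ∃ u v, u ≠ v ∧ 6 * (n * p ^ 2) ≤ codeg (gr S) u v := by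
  refine negligible_of_le (tendsto_exp_neg_log (c := 1) one_pos) ?_
  filter_upwards [eventually_gt_atTop 0] with n hn p h0 h1 hD
  refine (pr_exists_codeg_ge_le h0 h1).trans ?_
  have h2 := exp_natCast_log hn 2 (by norm_num) 2 hD (by norm_num)
  refine (mul_le_mul_of_nonneg_right h2 (Real.exp_pos _).le).trans ?_
  rw [← Real.exp_add]
  apply Real.exp_le_exp.2
  have h1 : 0 ≤ Real.log n := Real.log_natCast_nonneg n
  linarith

theorem exp_neg_three_le : Real.exp (-3) ≤ 1 / 20 := by
  have h := Real.exp_one_gt_d9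
  have h2 : Real.exp 3 = Real.exp 1 ^ 3 := by rw [← Real.exp_nat_mul]; norm_num
  have h3 : (20 : ℝ) ≤ Real.exp 3 := by
    rw [h2]
    calc (20 : ℝ) ≤ 2.718 ^ 3 := by norm_num
      _ ≤ _ := by gcongr; linarith
  rw [Real.exp_neg, ← one_div]
  exact one_div_le_one_div_of_le (by norm_num) h3

/-- The base equals (1 - p) + p(1 - cp)², hence is nonnegative, and 1 - x ≤ exp(-x) applies. As s·p²
≤ 2, replacing n - 3 by n costs at most the 6 in the exponent. -/
theorem cherry_pow_le {n : ℕ} (hn : 3 ≤ n) {p c s : ℝ} (h0 : 0 ≤ p) (h1 : p ≤ 1)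
    (hs : s ≤ c * (2 - c * p)) :
    (1 - 2 * c * p ^ 2 + c ^ 2 * p ^ 3) ^ (n - 3) ≤ Real.exp (6 - s * (n * p ^ 2)) := by
  have hnn : 0 ≤ 1 - 2 * c * p ^ 2 + c ^ 2 * p ^ 3 := by
    have : 1 - 2 * c * p ^ 2 + c ^ 2 * p ^ 3 = (1 - p) + p * (1 - c * p) ^ 2 := by ring
    rw [this]
    have := mul_nonneg h0 (sq_nonneg (1 - c * p))
    linarith
  have h2 : 1 - 2 * c * p ^ 2 + c ^ 2 * p ^ 3 ≤ Real.exp (-(s * p ^ 2)) := by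
    have h3 := Real.add_one_le_exp (-(s * p ^ 2))
    have h4 := mul_le_mul_of_nonneg_right hs (sq_nonneg p)
    linarith
  refine (pow_le_pow_left₀ hnn h2 _).trans ?_
  rw [← Real.exp_nat_mul, Nat.cast_sub hn]
  apply Real.exp_le_exp.2
  have h5 : s * p ^ 2 ≤ 2 := by
    have h6 := mul_le_mul_of_nonneg_right hs (sq_nonneg p)
    have h7 := mul_nonneg h0 (sq_nonneg (1 - c * p))
    linarith
  push_cast
  linarith

/-- For small p the expected number is about n³p²·exp(-(2 - o)D) = n²D·exp(-(2 - o)D), with a small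
loss o; it vanishes because D exceeds log n by a constant factor. A single light edge could not be
excluded at D = (5/4) log n. -/
theorem negligible_two_light : Negligible fun n p S => ∃ v u x, (gr S).Adj v u ∧ (gr S).Adj v x ∧
    u ≠ x ∧ codeg (gr S) u v ≤ 1 / 100 * (n * p ^ 2) ∧
    codeg (gr S) x v ≤ 1 / 100 * (n * p ^ 2) := by
  have hb := (tendsto_exp_neg_log (c := 7 / 80) (by norm_num)).const_mul (15 * Real.exp 6)
  rw [mul_zero] at hb
  refine negligible_of_le hb ?_
  filter_upwards [eventually_ge_atTop 3, eventually_log_le_sqrt (c := 1 / 400) (by norm_num)]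
    with n hn hlog p h0 h1 hD
  set D := (n : ℝ) * p ^ 2 with hDdef
  set c := 1 - Real.exp (-3) with hc
  have hc1 : c ≤ 1 := by have := Real.exp_pos (-3); linarith
  have hc0 : 19 / 20 ≤ c := by have := exp_neg_three_le; linarith
  have hn0 : (0 : ℝ) < n := by exact_mod_cast (by omega : 0 < n)
  have hlog0 : 0 ≤ Real.log n := Real.log_natCast_nonneg n
  have hD0 : 0 ≤ D := by positivity
  have step : (n : ℝ) ^ 3 * (p ^ 2 * (1 - 2 * c * p ^ 2 + c ^ 2 * p ^ 3) ^ (n - 3) *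
      Real.exp (2 * 3 * (1 / 100 * D))) ≤ D * Real.exp (6 - 14 / 100 * D) := by
    have e0 : (n : ℝ) ^ 3 * (p ^ 2 * (1 - 2 * c * p ^ 2 + c ^ 2 * p ^ 3) ^ (n - 3) *
      Real.exp (2 * 3 * (1 / 100 * D))) = D * ((n : ℝ) ^ 2 *
        (1 - 2 * c * p ^ 2 + c ^ 2 * p ^ 3) ^ (n - 3) * Real.exp (2 * 3 * (1 / 100 * D))) := by
      rw [hDdef]; ring
    rw [e0]
    refine mul_le_mul_of_nonneg_left ?_ hD0
    -- The p³ term weakens the exponent when p is large. For p ≤ 1/10 it is still 1.8D, against n² ≤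
    -- exp(1.6D). For larger p only 0.95D remains, but then D ≥ n/100 and n² ≤ exp(D/2). Both leave
    -- 0.14D after paying 0.06D for the threshold D/100.
    rcases le_total p (1 / 10) with hp | hp
    · have h2 := cherry_pow_le hn (c := c) (s := 18 / 10) h0 h1 (by nlinarith)
      have h3 := exp_natCast_log (by omega : 0 < n) (16 / 10) (by norm_num) 2 hD (by norm_num)
      refine (mul_le_mul_of_nonneg_right (mul_le_mul h3 h2 ?_ (Real.exp_pos _).le)
        (Real.exp_pos _).le).trans ?_
      · have : 1 - 2 * c * p ^ 2 + c ^ 2 * p ^ 3 = (1 - p) + p * (1 - c * p) ^ 2 := by ring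
        rw [this]
        have := mul_nonneg h0 (sq_nonneg (1 - c * p))
        exact pow_nonneg (by linarith) _
      · rw [← Real.exp_add, ← Real.exp_add]
        apply Real.exp_le_exp.2
        linarith
    · have h2 := cherry_pow_le hn (c := c) (s := 95 / 100) h0 h1 (by nlinarith)
      have hDn : (n : ℝ) / 100 ≤ D := by 
        have : (1 / 10 : ℝ) ^ 2 ≤ p ^ 2 := by gcongr
        have := mul_le_mul_of_nonneg_left this hn0.le
        rw [hDdef]; linarith
      have hsq : √(n : ℝ) ≤ n := by
        rw [Real.sqrt_le_left hn0.le]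
        have : (1 : ℝ) ≤ n := by exact_mod_cast (by omega : 1 ≤ n)
        nlinarith
      have h3 : (n : ℝ) ^ 2 ≤ Real.exp (1 / 2 * D) := by
        rw [← Real.exp_log hn0, ← Real.exp_nat_mul]
        apply Real.exp_le_exp.2
        push_cast
        linarith
      refine (mul_le_mul_of_nonneg_right (mul_le_mul h3 h2 ?_ (Real.exp_pos _).le)
        (Real.exp_pos _).le).trans ?_
      · have : 1 - 2 * c * p ^ 2 + c ^ 2 * p ^ 3 = (1 - p) + p * (1 - c * p) ^ 2 := by ring
        rw [this]
        have := mul_nonneg h0 (sq_nonneg (1 - c * p))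
        exact pow_nonneg (by linarith) _
      · rw [← Real.exp_add, ← Real.exp_add]
        apply Real.exp_le_exp.2
        linarith
  calc _ ≤ pr p (fun S : Finset (Sym2 (Fin n)) => ∃ y ∈ (univ : Finset (Fin n × Fin n × Fin n)),
        (y.2.1 ≠ y.1 ∧ y.2.2 ≠ y.1 ∧ y.2.1 ≠ y.2.2) ∧ (s(y.1, y.2.1) ∈ S ∧ s(y.1, y.2.2) ∈ S ∧
        codeg (gr S) y.2.1 y.1 ≤ 1 / 100 * D ∧ codeg (gr S) y.2.2 y.1 ≤ 1 / 100 * D)) := by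
        refine pr_mono h0 h1 ?_
        rintro S ⟨v, u, x, hu, hx, hux, hmu, hmx⟩
        exact ⟨(v, u, x), mem_univ _, ⟨hu.ne', hx.ne', hux⟩, (gr_adj.1 hu).1, (gr_adj.1 hx).1,
          hmu, hmx⟩
    _ ≤ ∑ y : Fin n × Fin n × Fin n, p ^ 2 * (1 - 2 * c * p ^ 2 + c ^ 2 * p ^ 3) ^ (n - 3) *
        Real.exp (2 * 3 * (1 / 100 * D)) := by
        refine (pr_exists_le h0 h1 _ _).trans <| Finset.sum_le_sum ?_
        rintro ⟨v, u, x⟩ _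
        have hnn : 0 ≤ (1 - 2 * c * p ^ 2 + c ^ 2 * p ^ 3) ^ (n - 3) := by
          have : 1 - 2 * c * p ^ 2 + c ^ 2 * p ^ 3 = (1 - p) + p * (1 - c * p) ^ 2 := by ring
          rw [this]
          have := mul_nonneg h0 (sq_nonneg (1 - c * p))
          exact pow_nonneg (by linarith) _
        by_cases hne : u ≠ v ∧ x ≠ v ∧ u ≠ x
        · exact (pr_mono h0 h1 fun S hS => hS.2).trans
            (pr_two_light_le h0 h1 hne.1 hne.2.1 hne.2.2 (by norm_num))
        · refine (pr_mono h0 h1 (Q := fun _ => False) fun S hS => hne hS.1).trans ?_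
          have : pr p (fun _ : Finset (Sym2 (Fin n)) => False) = 0 := by simp [pr, ind]
          rw [this]
          positivity
    _ ≤ D * Real.exp (6 - 14 / 100 * D) := by
        rw [Finset.sum_const, Finset.card_univ, nsmul_eq_mul]
        simp only [Fintype.card_prod, Fintype.card_fin]
        push_cast
        refine le_trans (le_of_eq ?_) step
        ring
    _ ≤ 15 * Real.exp 6 * Real.exp (-(7 / 100 * D)) := by
        have h2 := Real.add_one_le_exp (7 / 100 * D)
        have h3 : Real.exp (6 - 14 / 100 * D) =
            Real.exp 6 * Real.exp (-(7 / 100 * D)) * Real.exp (-(7 / 100 * D)) := by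
          rw [← Real.exp_add, ← Real.exp_add]; congr 1; ring
        have h4 : Real.exp (7 / 100 * D) * Real.exp (-(7 / 100 * D)) = 1 := by
          rw [← Real.exp_add]; simp
        have h5 : D * Real.exp (-(7 / 100 * D)) ≤ 15 := by
          have h6 : D ≤ 15 * Real.exp (7 / 100 * D) := by linarith
          have h7 := mul_le_mul_of_nonneg_right h6 (Real.exp_pos (-(7 / 100 * D))).le
          rwa [mul_assoc 15, h4, mul_one] at h7
        rw [h3]
        have h8 : 0 ≤ Real.exp 6 * Real.exp (-(7 / 100 * D)) := by positivity
        nlinarith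
    _ ≤ _ := by
        refine mul_le_mul_of_nonneg_left (Real.exp_le_exp.2 ?_) (by positivity)
        linarith

theorem tendsto_exp_inv_sub_one :
    Tendsto (fun n : ℕ => Real.exp (1 / (n : ℝ)) - 1) atTop (𝓝 0) := by
  have h := (Real.continuous_exp.tendsto 0).comp tendsto_one_div_atTop_nhds_zero_nat
  have h2 := h.sub_const 1
  rw [Real.exp_zero, sub_self] at h2
  exact h2

theorem mul_exp_neg_two_log {n : ℕ} (hn : 0 < n) :
    (n : ℝ) * Real.exp (-(2 * Real.log n)) = 1 / n := by
  have hn0 : (0 : ℝ) < n := by exact_mod_cast hn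
  have : Real.exp (2 * Real.log n) = (n : ℝ) ^ 2 := by
    rw [mul_comm, Real.exp_mul, Real.exp_log hn0]; norm_cast
  rw [Real.exp_neg, this]
  field_simp

/-- This fixes the scale of κ. The density 1/800 is θ/8 with θ = 1/100; t = 6400 gives 2D, more than
the required 2 log n, and the mean is multiplied by exp(6400), which κ cancels. -/
theorem negligible_dense {κ : ℝ} (hκ : κ ≤ Real.exp (-6400)) : Negligible fun n p S =>
    ∃ A : Finset (Fin n), (A.card : ℝ) ≤ κ * (n * p) ∧
      1 / 800 * (n * p ^ 2) * A.card < pairCount (gr S) A A := by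
  refine negligible_of_le tendsto_exp_inv_sub_one ?_
  filter_upwards [eventually_gt_atTop 0] with n hn p h0 h1 hD
  have hlog0 : 0 ≤ Real.log n := Real.log_natCast_nonneg n
  have hD0 : 0 ≤ n * p ^ 2 := by positivity
  rw [← mul_exp_neg_two_log hn]
  refine pr_exists_dense_le h0 h1 (t := 6400) (by norm_num) ?_ (by linarith)
  have h2 : κ * Real.exp 6400 ≤ 1 := by
    have := mul_le_mul_of_nonneg_right hκ (Real.exp_pos 6400).le
    rwa [← Real.exp_add, neg_add_cancel, Real.exp_zero] at this
  have h3 := mul_le_mul_of_nonneg_right h2 hD0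
  calc p * (κ * (n * p)) * Real.exp 6400 = κ * Real.exp 6400 * (n * p ^ 2) := by ring
    _ ≤ _ := by linarith

/-- Here t = 1 suffices: the allowed number of edges per vertex is of order np ≥ √n, far above log
n. The size κn/360 satisfies the mean condition because e ≤ 3. -/
theorem negligible_sparse {κ : ℝ} (hκ : 0 < κ) : Negligible fun n p S =>
    ∃ A : Finset (Fin n), (A.card : ℝ) ≤ κ / 360 * n ∧
      κ / 60 * (n * p) * A.card < pairCount (gr S) A A := by
  refine negligible_of_le tendsto_exp_inv_sub_one ?_
  filter_upwards [eventually_gt_atTop 0, eventually_sqrt_le,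
    eventually_log_le_sqrt (c := κ / 480) (by positivity)] with n hn hsq hlog p h0 h1 hD
  rw [← mul_exp_neg_two_log hn]
  have h2 := mul_le_mul_of_nonneg_left (hsq p h0 hD) hκ.le
  refine pr_exists_dense_le h0 h1 (t := 1) (by norm_num) ?_ (by linarith)
  have h3 := Real.exp_one_lt_d9
  have h4 : 0 ≤ κ / 360 * (n * p) := by positivity
  calc p * (κ / 360 * n) * Real.exp 1 = κ / 360 * (n * p) * Real.exp 1 := by ring
    _ ≤ κ / 360 * (n * p) * 3 := by gcongr; linarith
    _ = _ := by ring

/-- With r = np the exponent np/2 - 1.8np is at most -√n, and the size condition on κ²pr holds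
eventually because np² tends to infinity. -/
theorem negligible_bad_cut {κ : ℝ} (hκ : 0 < κ) (hκ1 : κ ≤ 1) : Negligible fun n p S =>
    ∃ v, ∃ T : Finset (Fin n), nbr (gr S) v = T ∧
      9 / 10 * (n * p) ≤ T.card ∧ (T.card : ℝ) ≤ 2 * (n * p) ∧ ∃ A ⊆ T, κ * (n * p) ≤ A.card ∧
      2 * (A.card : ℝ) ≤ T.card ∧
      (pairCount (gr S) A (T \ A) ≤ 19 / 20 * (p * (A.card * (T \ A).card)) ∨
        21 / 20 * (p * A.card ^ 2) ≤ pairCount (gr S) A A) := by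
  have hb := (tendsto_mul_exp_neg_sqrt (c := 1) one_pos).const_mul 2
  rw [mul_zero] at hb
  refine negligible_of_le hb ?_
  filter_upwards [eventually_sqrt_le,
    tendsto_log_natCast.eventually_ge_atTop (6400 * 4 / κ ^ 2)] with n hsq hlog p h0 h1 hD
  have h2 := hsq p h0 hD
  have hlog0 : 0 ≤ Real.log n := Real.log_natCast_nonneg n
  refine (pr_exists_bad_cut_le h0 h1 hκ.le hκ1 (by positivity) ?_).trans ?_
  · rw [div_le_iff₀ (by positivity)] at hlog
    have h3 : Real.log n ≤ p * (n * p) := by nlinarith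
    have h4 := mul_le_mul_of_nonneg_right h3 (sq_nonneg κ)
    linarith
  · have h3 : Real.exp (n * (p / 2) - 18 / 10 * (n * p)) ≤ Real.exp (-(1 * √(n : ℝ))) := by
      apply Real.exp_le_exp.2
      have : 0 ≤ n * p := by positivity
      linarith
    have h4 := mul_le_mul_of_nonneg_left h3 (show (0 : ℝ) ≤ n * 2 by positivity)
    linarith

end Asymptotics

/-! ### Exposing edges in stages; dense families of triples contain triangles. -/

section Exposure

open Finset

variable {n : ℕ} {p : ℝ}

/-- A bound for all conditional probabilities is a bound for the probability. -/
theorem pr_le_of_resample {ι : Type*} [Fintype ι] [DecidableEq ι] (h0 : 0 ≤ p) (h1 : p ≤ 1)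
    (A : Finset ι) {P : Finset ι → Prop} {δ : ℝ}
    (h : ∀ S, pr p (fun T => P ((S ∩ A) ∪ (T \ A))) ≤ δ) : pr p P ≤ δ := by
  rw [pr, ex_resample A]
  exact (ex_mono h0 h1 h).trans_eq (ex_const δ)

/-- Union bound over all subsets of the random subset of `A`. -/
theorem pr_exists_subset_le {ι : Type*} [Fintype ι] [DecidableEq ι] (h0 : 0 ≤ p) (h1 : p ≤ 1)
    (A : Finset ι) {R : Finset ι → Finset ι → Finset ι → Prop} {δ : ℝ} (hδ : 0 ≤ δ)
    (hR : ∀ H E S T, S \ A = T \ A → (R H E S ↔ R H E T))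
    (h : ∀ H E, pr p (R H E) ≤ δ) :
    pr p (fun S => ∃ E ⊆ S ∩ A, R (S ∩ A) E S) ≤ Real.exp (p * A.card) * δ := by
  rw [pr, ex_resample A]
  have h2 : ∀ S : Finset ι, ex p (fun T => ind (∃ E ⊆ ((S ∩ A) ∪ (T \ A)) ∩ A,
      R (((S ∩ A) ∪ (T \ A)) ∩ A) E ((S ∩ A) ∪ (T \ A)))) ≤
      Real.exp (∑ e ∈ A, Real.log 2 * ind (e ∈ S)) * δ := by
    intro S
    have e1 : ∀ T : Finset ι, ((S ∩ A) ∪ (T \ A)) ∩ A = S ∩ A := by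
      intro T; ext e; simp only [mem_union, mem_inter, Finset.mem_sdiff]; tauto
    have e2 : ∀ T : Finset ι, ((S ∩ A) ∪ (T \ A)) \ A = T \ A := by
      intro T; ext e; simp only [mem_union, mem_inter, Finset.mem_sdiff]; tauto
    simp only [e1]
    calc _ ≤ pr p (fun T => ∃ E ∈ (S ∩ A).powerset, R (S ∩ A) E T) := by
          refine ex_mono h0 h1 fun T => ind_mono ?_
          rintro ⟨E, hE, hRE⟩
          exact ⟨E, Finset.mem_powerset.2 hE, (hR _ _ _ _ (e2 T)).1 hRE⟩
      _ ≤ ∑ E ∈ (S ∩ A).powerset, δ :=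
          (pr_exists_le h0 h1 _ _).trans <| Finset.sum_le_sum fun E _ => h _ _
      _ = _ := by
          rw [Finset.sum_const, Finset.card_powerset, nsmul_eq_mul, ← Finset.mul_sum, sum_ind_mem,
            mul_comm (Real.log 2), Real.exp_nat_mul, Real.exp_log two_pos, Finset.inter_comm]
          push_cast; rfl
  refine (ex_mono h0 h1 h2).trans ?_
  rw [ex_mul_const]
  -- The expected number of subsets of the revealed set is E 2^|S ∩ A| ≤ exp(p|A|), the exponential
  -- moment at log 2.
  refine mul_le_mul_of_nonneg_right ((ex_exp_sum_le h0 h1 A fun _ => Real.log 2).trans_eq ?_) hδ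
  rw [Finset.sum_const, Real.exp_log two_pos, nsmul_eq_mul]
  norm_num

/-- Lower tail of a weighted count of the edges between two disjoint sets. -/
theorem pr_weighted_pairs_le (h0 : 0 ≤ p) (h1 : p ≤ 1) {A B : Finset (Fin n)} (hAB : Disjoint A B)
    (a : Fin n → Fin n → ℝ) {m : ℝ} (hm : 0 < m)
    (ha : ∀ u ∈ A, ∀ w ∈ B, 0 ≤ a u w ∧ a u w ≤ m) :
    pr p (fun S => ∑ u ∈ A, ∑ w ∈ B, a u w * ind (s(u, w) ∈ S) ≤
      p / 4 * ∑ u ∈ A, ∑ w ∈ B, a u w) ≤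
      Real.exp (-(p / (4 * m) * ∑ u ∈ A, ∑ w ∈ B, a u w)) := by
  let g : Fin n × Fin n → Sym2 (Fin n) := fun x => s(x.1, x.2)
  have hinj : Set.InjOn g (A ×ˢ B : Finset _) :=
    Finset.card_image_iff.1 ((card_pairSet_product hAB).trans (Finset.card_product _ _).symm)
  rcases isEmpty_or_nonempty (Fin n × Fin n) with hE | hE
  · have hA : A = ∅ := by
      ext u; exact (hE.false (u, u)).elim
    subst hA
    simpa using pr_le_one h0 h1 _
  -- Since A and B are disjoint, an unordered pair has a unique orientation from A to B, so the
  -- weights descend to `Sym2`.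
  let b : Sym2 (Fin n) → ℝ := fun e => a (Function.invFunOn g (A ×ˢ B : Finset _) e).1
    (Function.invFunOn g (A ×ˢ B : Finset _) e).2
  have hb : ∀ x ∈ A ×ˢ B, b (g x) = a x.1 x.2 := by
    intro x hx
    simp only [b]
    rw [hinj.leftInvOn_invFunOn hx]
  have s1 : ∑ e ∈ pairSet (A ×ˢ B), b e = ∑ u ∈ A, ∑ w ∈ B, a u w := by
    rw [pairSet, Finset.sum_image hinj, ← Finset.sum_product']
    exact Finset.sum_congr rfl hb
  have s2 : ∀ S : Finset (Sym2 (Fin n)), ∑ e ∈ pairSet (A ×ˢ B), b e * ind (e ∈ S) =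
      ∑ u ∈ A, ∑ w ∈ B, a u w * ind (s(u, w) ∈ S) := by
    intro S
    rw [pairSet, Finset.sum_image hinj, ← Finset.sum_product']
    exact Finset.sum_congr rfl fun x hx => by rw [← hb x hx]
  have key := pr_weighted_le h0 h1 (pairSet (A ×ˢ B)) b hm (by
    intro e he
    obtain ⟨x, hx, rfl⟩ := Finset.mem_image.1 he
    have := Finset.mem_product.1 hx
    have h3 := hb x hx
    simp only [g] at h3
    rw [h3]; exact ha _ this.1 _ this.2)
  rw [s1] at key
  simpa only [s2] using key

theorem notMem_pairSet_product {A B : Finset (Fin n)} {u w : Fin n} (hA : u ∉ A) (hB : u ∉ B) :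
    s(u, w) ∉ pairSet (A ×ˢ B) := by
  rw [mem_pairSet]
  rintro ⟨a, b, hab, h⟩
  have := Finset.mem_product.1 hab
  rcases Sym2.eq_iff.1 h with ⟨rfl, _⟩ | ⟨_, rfl⟩
  · exact hA this.1
  · exact hB this.2

theorem mem_pairSet_product {A B : Finset (Fin n)} {u w : Fin n} (hA : u ∈ A) (hB : w ∈ B) :
    s(u, w) ∈ pairSet (A ×ˢ B) := mem_pairSet.2 ⟨u, w, Finset.mem_product.2 ⟨hA, hB⟩, rfl⟩

/-- A dense family of triples very likely contains a triangle. -/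
theorem pr_no_triangle_le (h0 : 0 < p) (h1 : p ≤ 1) {Z X Y : Finset (Fin n)} (hZX : Disjoint Z X)
    (hZY : Disjoint Z Y) (hXY : Disjoint X Y) (o : Fin n → Fin n → Fin n → Prop) {ε : ℝ}
    (hε : 0 < ε) (hn : 0 < n)
    (ho : ε * (n : ℝ) ^ 3 ≤ ∑ z ∈ Z, ∑ x ∈ X, ∑ y ∈ Y, ind (o z x y)) :
    pr p (fun S : Finset (Sym2 (Fin n)) =>
      (∀ z ∈ Z, ∑ x ∈ X, ind (s(z, x) ∈ S) ≤ 2 * (n * p)) ∧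
      (∀ x ∈ X, ∀ y ∈ Y, ∑ z ∈ Z, ind (s(z, x) ∈ S) * ind (s(z, y) ∈ S) ≤ 6 * (n * p ^ 2)) ∧
      ∀ z ∈ Z, ∀ x ∈ X, ∀ y ∈ Y, o z x y → ¬ (s(z, x) ∈ S ∧ s(z, y) ∈ S ∧ s(x, y) ∈ S)) ≤
      3 * Real.exp (-(ε * n ^ 2 * p / 100)) := by
  have hn0 : (0 : ℝ) < n := by exact_mod_cast hn
  set tot := ∑ z ∈ Z, ∑ x ∈ X, ∑ y ∈ Y, ind (o z x y) with htot
  have htn : ε * n ^ 2 ≤ tot / n := by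
    rw [le_div_iff₀ hn0]; linarith
  have htot0 : 0 ≤ tot := by
    have : 0 ≤ ε * (n : ℝ) ^ 3 := by positivity
    linarith
  have hp0 := h0.le
  -- Edges are exposed in the order ZX, ZY, XY. The weight of zy counts the triples zxy whose edge
  -- zx is already present. The three stages give exponents p·tot/(cn) with c = 4, 32, 96, whence
  -- the 100.
  let q : Finset (Sym2 (Fin n)) → Fin n → Fin n → ℝ := fun S z y =>
    ∑ x ∈ X, ind (o z x y) * ind (s(z, x) ∈ S)
  have hq0 : ∀ S z y, 0 ≤ q S z y := fun S z y =>
    Finset.sum_nonneg fun x _ => mul_nonneg (ind_nonneg _) (ind_nonneg _)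
  let Q₁ : Finset (Sym2 (Fin n)) → ℝ := fun S => ∑ z ∈ Z, ∑ y ∈ Y, q S z y
  let Q₂ : Finset (Sym2 (Fin n)) → ℝ := fun S => ∑ z ∈ Z, ∑ y ∈ Y, q S z y * ind (s(z, y) ∈ S)
  have hle : ∀ c : ℝ, 0 < c → c ≤ 100 → Real.exp (-(p / c * (tot / n))) ≤
      Real.exp (-(ε * n ^ 2 * p / 100)) := by
    intro c hc hc'
    apply Real.exp_le_exp.2
    have h3 : p / 100 ≤ p / c := by gcongr
    have h4 : p / 100 * (ε * n ^ 2) ≤ p / c * (tot / n) :=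
      mul_le_mul h3 htn (by positivity) (by positivity)
    linarith
  have b1 : pr p (fun S => Q₁ S ≤ p / 4 * tot) ≤ Real.exp (-(ε * n ^ 2 * p / 100)) := by
    have h3 := pr_weighted_pairs_le hp0 h1 hZX (fun z x => ∑ y ∈ Y, ind (o z x y)) hn0 (by
      intro z _ x _
      refine ⟨Finset.sum_nonneg fun _ _ => ind_nonneg _, ?_⟩
      calc ∑ y ∈ Y, ind (o z x y) ≤ ∑ y ∈ Y, (1 : ℝ) := Finset.sum_le_sum fun _ _ => ind_le_one _
        _ = (Y.card : ℝ) := by simp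
        _ ≤ n := by exact_mod_cast (Finset.card_le_univ Y).trans_eq (Fintype.card_fin n))
    refine le_trans (le_of_eq ?_) (h3.trans (le_trans (le_of_eq ?_) (hle 4 (by norm_num)
      (by norm_num))))
    · congr 1; funext S
      have : Q₁ S = ∑ z ∈ Z, ∑ x ∈ X, (∑ y ∈ Y, ind (o z x y)) * ind (s(z, x) ∈ S) := by
        refine Finset.sum_congr rfl fun z _ => ?_
        simp only [q]
        rw [Finset.sum_comm]
        exact Finset.sum_congr rfl fun x _ => by rw [Finset.sum_mul]
      rw [this]
    · congr 1
      change -(p / (4 * n) * tot) = _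
      field_simp
  -- Conditionally on the ZX edges, the weights q are fixed and at most 2np by the degree bound, so
  -- the lower tail applies to the ZY edges.
  have b2 : pr p (fun S => (∀ z ∈ Z, ∑ x ∈ X, ind (s(z, x) ∈ S) ≤ 2 * (n * p)) ∧
      p / 4 * tot < Q₁ S ∧ Q₂ S ≤ p / 4 * Q₁ S) ≤ Real.exp (-(ε * n ^ 2 * p / 100)) := by
    refine pr_le_of_resample hp0 h1 (pairSet (Z ×ˢ X)) fun S => ?_
    have m1 : ∀ T : Finset (Sym2 (Fin n)), ∀ z ∈ Z, ∀ x ∈ X,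
        (s(z, x) ∈ (S ∩ pairSet (Z ×ˢ X)) ∪ (T \ pairSet (Z ×ˢ X)) ↔ s(z, x) ∈ S) := by
      intro T z hz x hx
      simp [mem_pairSet_product hz hx]
    have m2 : ∀ T : Finset (Sym2 (Fin n)), ∀ z ∈ Z, ∀ y ∈ Y,
        (s(z, y) ∈ (S ∩ pairSet (Z ×ˢ X)) ∪ (T \ pairSet (Z ×ˢ X)) ↔ s(z, y) ∈ T) := by
      intro T z hz y hy
      have : s(z, y) ∉ pairSet (Z ×ˢ X) := by
        rw [Sym2.eq_swap]
        exact notMem_pairSet_product (fun h => Finset.disjoint_left.1 hZY h hy)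
          (fun h => Finset.disjoint_left.1 hXY h hy)
      simp [this]
    have eq1 : ∀ T : Finset (Sym2 (Fin n)), ∀ z ∈ Z, ∀ y,
        q ((S ∩ pairSet (Z ×ˢ X)) ∪ (T \ pairSet (Z ×ˢ X))) z y = q S z y := fun T z hz y =>
      Finset.sum_congr rfl fun x hx => by rw [propext (m1 T z hz x hx)]
    have eQ1 : ∀ T : Finset (Sym2 (Fin n)),
        Q₁ ((S ∩ pairSet (Z ×ˢ X)) ∪ (T \ pairSet (Z ×ˢ X))) = Q₁ S := fun T =>
      Finset.sum_congr rfl fun z hz => Finset.sum_congr rfl fun y _ => eq1 T z hz y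
    have eQ2 : ∀ T : Finset (Sym2 (Fin n)),
        Q₂ ((S ∩ pairSet (Z ×ˢ X)) ∪ (T \ pairSet (Z ×ˢ X))) =
        ∑ z ∈ Z, ∑ y ∈ Y, q S z y * ind (s(z, y) ∈ T) := fun T =>
      Finset.sum_congr rfl fun z hz => Finset.sum_congr rfl fun y hy => by
        rw [eq1 T z hz y, propext (m2 T z hz y hy)]
    have ed : ∀ T : Finset (Sym2 (Fin n)), ∀ z ∈ Z, ∑ x ∈ X,
        ind (s(z, x) ∈ (S ∩ pairSet (Z ×ˢ X)) ∪ (T \ pairSet (Z ×ˢ X))) =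
        ∑ x ∈ X, ind (s(z, x) ∈ S) := fun T z hz =>
      Finset.sum_congr rfl fun x hx => by rw [propext (m1 T z hz x hx)]
    by_cases hdeg : ∀ z ∈ Z, ∑ x ∈ X, ind (s(z, x) ∈ S) ≤ 2 * (n * p)
    · by_cases hQ : p / 4 * tot < Q₁ S
      · have h3 := pr_weighted_pairs_le hp0 h1 hZY (q S) (m := 2 * (n * p)) (by positivity) (by
          intro z hz y _
          refine ⟨hq0 S z y, (Finset.sum_le_sum fun x _ => ?_).trans (hdeg z hz)⟩
          exact mul_le_of_le_one_left (ind_nonneg _) (ind_le_one _))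
        refine (pr_mono hp0 h1 ?_).trans (h3.trans (le_trans ?_ (hle 32 (by norm_num) (by norm_num))))
        · rintro T ⟨_, _, h⟩
          rwa [eQ1, eQ2] at h
        · apply Real.exp_le_exp.2
          have h5 : p / (4 * (2 * (n * p))) * (p / 4 * tot) ≤ p / (4 * (2 * (n * p))) * Q₁ S :=
            mul_le_mul_of_nonneg_left hQ.le (by positivity)
          have h6 : p / (4 * (2 * (n * p))) * (p / 4 * tot) = p / 32 * (tot / n) := by
            field_simp; ring
          have h7 : Q₁ S = ∑ z ∈ Z, ∑ y ∈ Y, q S z y := rfl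
          rw [← h7]
          linarith
      · refine (pr_mono hp0 h1 (Q := fun _ => False) ?_).trans ?_
        · rintro T ⟨_, h, _⟩; rw [eQ1] at h; exact hQ h
        · simp [pr, ind, Real.exp_nonneg]
    · refine (pr_mono hp0 h1 (Q := fun _ => False) ?_).trans ?_
      · rintro T ⟨h, _⟩; exact hdeg fun z hz => (ed T z hz).ge.trans (h z hz)
      · simp [pr, ind, Real.exp_nonneg]
  have b3 : pr p (fun S => (∀ x ∈ X, ∀ y ∈ Y, ∑ z ∈ Z, ind (s(z, x) ∈ S) * ind (s(z, y) ∈ S) ≤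
      6 * (n * p ^ 2)) ∧ p / 4 * (p / 4 * tot) < Q₂ S ∧
      ∀ z ∈ Z, ∀ x ∈ X, ∀ y ∈ Y, o z x y → ¬ (s(z, x) ∈ S ∧ s(z, y) ∈ S ∧ s(x, y) ∈ S)) ≤
      Real.exp (-(ε * n ^ 2 * p / 100)) := by
    classical
    set A := (pairSet (X ×ˢ Y))ᶜ with hA
    refine pr_le_of_resample hp0 h1 A fun S => ?_
    have m1 : ∀ T : Finset (Sym2 (Fin n)), ∀ z ∈ Z, ∀ x,
        (s(z, x) ∈ (S ∩ A) ∪ (T \ A) ↔ s(z, x) ∈ S) := by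
      intro T z hz x
      have : s(z, x) ∈ A := Finset.mem_compl.2 <| notMem_pairSet_product
        (Finset.disjoint_left.1 hZX hz) (Finset.disjoint_left.1 hZY hz)
      simp [this]
    have m2 : ∀ T : Finset (Sym2 (Fin n)), ∀ x ∈ X, ∀ y ∈ Y,
        (s(x, y) ∈ (S ∩ A) ∪ (T \ A) ↔ s(x, y) ∈ T) := by
      intro T x hx y hy
      have : s(x, y) ∉ A := fun h => Finset.mem_compl.1 h (mem_pairSet_product hx hy)
      simp [this]
    -- The pairs xy that would complete a triangle. Each accounts for at most 6np² of Q₂ by the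
    -- codegree bound, so |R| ≥ tot/(96n), and all these still unexposed pairs would have to be
    -- absent.
    let R := (X ×ˢ Y).filter fun a => ∃ z ∈ Z, o z a.1 a.2 ∧ s(z, a.1) ∈ S ∧ s(z, a.2) ∈ S
    have hRcard : (pairSet R).card = R.card := by
      refine Finset.card_image_of_injOn (Set.InjOn.mono (Finset.coe_subset.2
        (Finset.filter_subset _ _)) ?_)
      exact Finset.card_image_iff.1 ((card_pairSet_product hXY).trans (Finset.card_product _ _).symm)
    by_cases hgood : (∀ x ∈ X, ∀ y ∈ Y, ∑ z ∈ Z, ind (s(z, x) ∈ S) * ind (s(z, y) ∈ S) ≤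
      6 * (n * p ^ 2)) ∧ p / 4 * (p / 4 * tot) < Q₂ S
    · obtain ⟨hcod, hQ⟩ := hgood
      have hQR : Q₂ S ≤ R.card * (6 * (n * p ^ 2)) := by
        have e1 : Q₂ S = ∑ a ∈ X ×ˢ Y, ∑ z ∈ Z, ind (o z a.1 a.2) *
            (ind (s(z, a.1) ∈ S) * ind (s(z, a.2) ∈ S)) := by
          rw [Finset.sum_product]
          have : ∀ z ∈ Z, ∑ y ∈ Y, q S z y * ind (s(z, y) ∈ S) = ∑ x ∈ X, ∑ y ∈ Y,
              ind (o z x y) * (ind (s(z, x) ∈ S) * ind (s(z, y) ∈ S)) := by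
            intro z _
            rw [Finset.sum_comm]
            refine Finset.sum_congr rfl fun y _ => ?_
            simp only [q, Finset.sum_mul, mul_assoc]
          simp only [Q₂]
          rw [Finset.sum_congr rfl this, Finset.sum_comm]
          refine Finset.sum_congr rfl fun x _ => ?_
          rw [Finset.sum_comm]
        rw [e1, ← Finset.sum_filter_add_sum_filter_not (X ×ˢ Y)
          fun a => ∃ z ∈ Z, o z a.1 a.2 ∧ s(z, a.1) ∈ S ∧ s(z, a.2) ∈ S]
        have e2 : ∑ a ∈ (X ×ˢ Y).filter (fun a => ¬ ∃ z ∈ Z, o z a.1 a.2 ∧ s(z, a.1) ∈ S ∧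
            s(z, a.2) ∈ S), ∑ z ∈ Z, ind (o z a.1 a.2) *
            (ind (s(z, a.1) ∈ S) * ind (s(z, a.2) ∈ S)) = 0 := by
          refine Finset.sum_eq_zero fun a ha => Finset.sum_eq_zero fun z hz => ?_
          rw [← ind_and, ← ind_and, ind_false]
          intro h
          exact (Finset.mem_filter.1 ha).2 ⟨z, hz, h⟩
        rw [e2, add_zero, ← nsmul_eq_mul]
        refine Finset.sum_le_card_nsmul _ _ _ fun a ha => ?_
        have hmem := Finset.mem_product.1 (Finset.mem_filter.1 ha).1
        refine (Finset.sum_le_sum fun z _ => ?_).trans (hcod _ hmem.1 _ hmem.2)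
        exact mul_le_of_le_one_left (mul_nonneg (ind_nonneg _) (ind_nonneg _)) (ind_le_one _)
      have hR : 1 / 96 * (tot / n) ≤ R.card := by
        have h3 : p / 4 * (p / 4 * tot) ≤ R.card * (6 * (n * p ^ 2)) := hQ.le.trans hQR
        have h4 : p / 4 * (p / 4 * tot) = 1 / 96 * (tot / n) * (6 * (n * p ^ 2)) := by
          field_simp; ring
        rw [h4] at h3
        exact le_of_mul_le_mul_right h3 (by positivity)
      refine (pr_mono hp0 h1 ?_).trans ((pr_disjoint_le h1 (pairSet R)).trans
        (le_trans ?_ (hle 96 (by norm_num) (by norm_num))))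
      · rintro T ⟨_, _, h⟩ e he heT
        obtain ⟨x, y, hxy, rfl⟩ := mem_pairSet.1 he
        obtain ⟨hmem, z, hz, hoz, hzx, hzy⟩ := Finset.mem_filter.1 hxy
        have hmem := Finset.mem_product.1 hmem
        exact h z hz x hmem.1 y hmem.2 hoz ⟨(m1 T z hz x).2 hzx, (m1 T z hz y).2 hzy,
          (m2 T x hmem.1 y hmem.2).2 heT⟩
      · apply Real.exp_le_exp.2
        rw [hRcard]
        have := mul_le_mul_of_nonneg_left hR hp0
        linarith
    · refine (pr_mono hp0 h1 (Q := fun _ => False) ?_).trans ?_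
      · rintro T ⟨h, h', _⟩
        refine hgood ⟨fun x hx y hy => ?_, ?_⟩
        · refine le_trans (le_of_eq ?_) (h x hx y hy)
          exact Finset.sum_congr rfl fun z hz => by
            rw [propext (m1 T z hz x), propext (m1 T z hz y)]
        · refine h'.trans_eq ?_
          refine Finset.sum_congr rfl fun z hz => Finset.sum_congr rfl fun y _ => ?_
          rw [propext (m1 T z hz y)]
          congr 1
          exact Finset.sum_congr rfl fun x _ => by rw [propext (m1 T z hz x)]
      · simp [pr, ind, Real.exp_nonneg]
  refine (pr_mono hp0 h1 (Q := fun S => (Q₁ S ≤ p / 4 * tot) ∨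
    (((∀ z ∈ Z, ∑ x ∈ X, ind (s(z, x) ∈ S) ≤ 2 * (n * p)) ∧
      p / 4 * tot < Q₁ S ∧ Q₂ S ≤ p / 4 * Q₁ S) ∨
    ((∀ x ∈ X, ∀ y ∈ Y, ∑ z ∈ Z, ind (s(z, x) ∈ S) * ind (s(z, y) ∈ S) ≤
      6 * (n * p ^ 2)) ∧ p / 4 * (p / 4 * tot) < Q₂ S ∧
      ∀ z ∈ Z, ∀ x ∈ X, ∀ y ∈ Y, o z x y → ¬ (s(z, x) ∈ S ∧ s(z, y) ∈ S ∧ s(x, y) ∈ S))))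
    ?_).trans ((pr_or_le hp0 h1 _ _).trans ((add_le_add b1 ((pr_or_le hp0 h1 _ _).trans
      (add_le_add b2 b3))).trans_eq (by ring)))
  rintro S ⟨hd, hc, ht⟩
  by_cases c1 : Q₁ S ≤ p / 4 * tot
  · exact Or.inl c1
  · push Not at c1
    by_cases c2 : Q₂ S ≤ p / 4 * Q₁ S
    · exact Or.inr (Or.inl ⟨hd, c1, c2⟩)
    · push Not at c2
      refine Or.inr (Or.inr ⟨hc, lt_of_le_of_lt ?_ c2, ht⟩)
      exact mul_le_mul_of_nonneg_left c1.le (by positivity)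

end Exposure

/-! ### What a cocycle's values on the edges at K force elsewhere. -/

section StarData

open Finset

variable {n : ℕ} {p : ℝ} {K : Finset (Fin n)}

/-- `x` and `y` have a common neighbour in `K`. -/
def Covered (K : Finset (Fin n)) (H : Finset (Sym2 (Fin n))) (x y : Fin n) : Prop :=
  ∃ v ∈ K, s(v, x) ∈ H ∧ s(v, y) ∈ H

/-- The value on the pair `xy` that a cocycle with given restriction to the edges at `K` has to
take if `xy` is a covered edge. -/
def Forced (K : Finset (Fin n)) (H E : Finset (Sym2 (Fin n))) (x y : Fin n) : Prop :=
  ∃ v ∈ K, (s(v, x) ∈ H ∧ s(v, y) ∈ H) ∧ ¬ (s(v, x) ∈ E ↔ s(v, y) ∈ E)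

/-- The pairs of `xyz` are covered. -/
def AllCovered (K : Finset (Fin n)) (H : Finset (Sym2 (Fin n))) (z x y : Fin n) : Prop :=
  Covered K H z x ∧ Covered K H z y ∧ Covered K H x y

/-- The forced values on the triple `xyz` are inconsistent. -/
def OddTriple (K : Finset (Fin n)) (H E : Finset (Sym2 (Fin n))) (z x y : Fin n) : Prop :=
  AllCovered K H z x y ∧ (Forced K H E x y ↔ (Forced K H E z x ↔ Forced K H E z y))

/-- The pairs with one end in `K`. -/
def star (K : Finset (Fin n)) : Finset (Sym2 (Fin n)) := pairSet (K ×ˢ Kᶜ)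

open Classical in
/-- The pairs in `H` on which `f` is one. -/
noncomputable def oddPairs (f : Fin n → Fin n → ZMod 2) (H : Finset (Sym2 (Fin n))) :
    Finset (Sym2 (Fin n)) := H.filter fun e => ∃ a b, e = s(a, b) ∧ f a b = 1

open Classical in
/-- The pairs in `Y` that are not consistent with the coboundary defined by `z`. -/
noncomputable def badPairs (K : Finset (Fin n)) (H E : Finset (Sym2 (Fin n))) (Y : Finset (Fin n))
    (z : Fin n) : Finset (Fin n × Fin n) :=
  (Y ×ˢ Y).filter fun a => a.1 ≠ a.2 ∧ (AllCovered K H z a.1 a.2 → OddTriple K H E z a.1 a.2)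

theorem badPairs_subset {H E : Finset (Sym2 (Fin n))} {Y : Finset (Fin n)} {z : Fin n} :
    badPairs K H E Y z ⊆ Y ×ˢ Y := by
  unfold badPairs
  classical exact Finset.filter_subset _ _

theorem oddPairs_subset {f : Fin n → Fin n → ZMod 2} {H : Finset (Sym2 (Fin n))} :
    oddPairs f H ⊆ H := by
  unfold oddPairs
  classical exact Finset.filter_subset _ _

theorem mem_oddPairs {f : Fin n → Fin n → ZMod 2} (hf : ∀ a b, f a b = f b a)
    {H : Finset (Sym2 (Fin n))} {a b : Fin n} : s(a, b) ∈ oddPairs f H ↔ s(a, b) ∈ H ∧ f a b = 1 := by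
  simp only [oddPairs, mem_filter]
  refine and_congr_right fun _ => ⟨?_, fun h => ⟨a, b, rfl, h⟩⟩
  rintro ⟨c, d, h, h1⟩
  rcases Sym2.eq_iff.1 h with ⟨rfl, rfl⟩ | ⟨rfl, rfl⟩
  · exact h1
  · rw [hf]; exact h1

theorem mem_star {v x : Fin n} (hv : v ∈ K) (hx : x ∉ K) : s(v, x) ∈ star K :=
  mem_pairSet_product hv (by simpa using hx)

theorem notMem_star {x y : Fin n} (hx : x ∉ K) (hy : y ∉ K) : s(x, y) ∉ star K := by
  rw [star, mem_pairSet]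
  rintro ⟨a, b, hab, h⟩
  have := Finset.mem_product.1 hab
  rcases Sym2.eq_iff.1 h with ⟨rfl, _⟩ | ⟨rfl, _⟩
  · exact hx this.1
  · exact hy this.1

theorem card_star_le (K : Finset (Fin n)) : ((star K).card : ℝ) ≤ K.card * n := by
  rw [star, card_pairSet_product disjoint_compl_right]
  have : Kᶜ.card ≤ n := (Finset.card_le_univ _).trans_eq (Fintype.card_fin n)
  push_cast
  gcongr

theorem covered_inter_star {S : Finset (Sym2 (Fin n))} {x y : Fin n} (hx : x ∉ K) (hy : y ∉ K) :
    Covered K (S ∩ star K) x y ↔ Covered K S x y := by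
  constructor
  · rintro ⟨v, hv, h1, h2⟩
    exact ⟨v, hv, Finset.mem_of_mem_inter_left h1, Finset.mem_of_mem_inter_left h2⟩
  · rintro ⟨v, hv, h1, h2⟩
    exact ⟨v, hv, Finset.mem_inter.2 ⟨h1, mem_star hv hx⟩, Finset.mem_inter.2 ⟨h2, mem_star hv hy⟩⟩

/-- A common neighbour v in K closes a triangle vxy, so f(xy) = f(vx) + f(vy). On an actual edge the
answer therefore does not depend on the choice of v. -/
theorem IsCocycle.eq_one_iff_forced {S : Finset (Sym2 (Fin n))} {f : Fin n → Fin n → ZMod 2}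
    (hf : IsCocycle (gr S) f) {x y : Fin n} (hx : x ∉ K) (hy : y ∉ K) (hxy : (gr S).Adj x y)
    (hc : Covered K (S ∩ star K) x y) :
    f x y = 1 ↔ Forced K (S ∩ star K) (oddPairs f (S ∩ star K)) x y := by
  have key : ∀ v ∈ K, s(v, x) ∈ S ∩ star K → s(v, y) ∈ S ∩ star K →
      (f x y = 1 ↔ ¬ (s(v, x) ∈ oddPairs f (S ∩ star K) ↔ s(v, y) ∈ oddPairs f (S ∩ star K))) := by
    intro v hv h1 h2
    rw [mem_oddPairs hf.symm, mem_oddPairs hf.symm]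
    simp only [h1, h2, true_and]
    have ne1 : v ≠ x := by rintro rfl; exact hx hv
    have ne2 : v ≠ y := by rintro rfl; exact hy hv
    have t := hf.tri v x y (gr_adj.2 ⟨Finset.mem_of_mem_inter_left h1, ne1⟩) hxy
      (gr_adj.2 ⟨Finset.mem_of_mem_inter_left h2, ne2⟩).symm
    rw [hf.symm y v] at t
    have dec : ∀ a b c : ZMod 2, a + b + c = 0 → (b = 1 ↔ ¬ (a = 1 ↔ c = 1)) := by decide
    exact dec _ _ _ t
  constructor
  · intro h
    obtain ⟨v, hv, h1, h2⟩ := hc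
    exact ⟨v, hv, ⟨h1, h2⟩, (key v hv h1 h2).1 h⟩
  · rintro ⟨v, hv, ⟨h1, h2⟩, h⟩
    exact (key v hv h1 h2).2 h

/-- On a triangle of the graph the forced values are the true values of f, and these sum to zero. -/
theorem IsCocycle.not_oddTriple {S : Finset (Sym2 (Fin n))} {f : Fin n → Fin n → ZMod 2}
    (hf : IsCocycle (gr S) f) {z x y : Fin n} (hz : z ∉ K) (hx : x ∉ K) (hy : y ∉ K)
    (hzx : (gr S).Adj z x) (hzy : (gr S).Adj z y) (hxy : (gr S).Adj x y) :
    ¬ OddTriple K (S ∩ star K) (oddPairs f (S ∩ star K)) z x y := by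
  rintro ⟨⟨c1, c2, c3⟩, h⟩
  rw [← hf.eq_one_iff_forced hx hy hxy c3, ← hf.eq_one_iff_forced hz hx hzx c1,
    ← hf.eq_one_iff_forced hz hy hzy c2] at h
  have t := hf.tri z x y hzx hxy hzy.symm
  rw [hf.symm y z] at t
  revert h t
  generalize f x y = b; generalize f z x = a; generalize f z y = c
  revert a b c; decide

/-- Odd triples are determined by the star edges H and the subset E on which f is one. For fixed H
and E, `pr_no_triangle_le` concerns only edges avoiding K, which are independent of H. The first
factor pays for all choices of E. -/
theorem pr_many_oddTriples_le (h0 : 0 < p) (h1 : p ≤ 1) {Z X Y : Finset (Fin n)}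
    (hKZ : Disjoint K Z) (hKX : Disjoint K X) (hKY : Disjoint K Y)
    (hZX : Disjoint Z X) (hZY : Disjoint Z Y) (hXY : Disjoint X Y) {ε : ℝ}
    (hε : 0 < ε) (hn : 0 < n) :
    pr p (fun S : Finset (Sym2 (Fin n)) => (∀ v, ((nbr (gr S) v).card : ℝ) ≤ 2 * (n * p)) ∧
      (∀ u v, u ≠ v → codeg (gr S) u v ≤ 6 * (n * p ^ 2)) ∧
      ∃ f, IsCocycle (gr S) f ∧ ε * (n : ℝ) ^ 3 ≤ ∑ z ∈ Z, ∑ x ∈ X, ∑ y ∈ Y,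
        ind (OddTriple K (S ∩ star K) (oddPairs f (S ∩ star K)) z x y)) ≤
      Real.exp (p * (K.card * n)) * (3 * Real.exp (-(ε * n ^ 2 * p / 100))) := by
  let R : Finset (Sym2 (Fin n)) → Finset (Sym2 (Fin n)) → Finset (Sym2 (Fin n)) → Prop :=
    fun H E S => ε * (n : ℝ) ^ 3 ≤ ∑ z ∈ Z, ∑ x ∈ X, ∑ y ∈ Y, ind (OddTriple K H E z x y) ∧
      (∀ z ∈ Z, ∑ x ∈ X, ind (s(z, x) ∈ S) ≤ 2 * (n * p)) ∧
      (∀ x ∈ X, ∀ y ∈ Y, ∑ z ∈ Z, ind (s(z, x) ∈ S) * ind (s(z, y) ∈ S) ≤ 6 * (n * p ^ 2)) ∧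
      ∀ z ∈ Z, ∀ x ∈ X, ∀ y ∈ Y, OddTriple K H E z x y →
        ¬ (s(z, x) ∈ S ∧ s(z, y) ∈ S ∧ s(x, y) ∈ S)
  have nZ : ∀ z ∈ Z, z ∉ K := fun z hz h => Finset.disjoint_left.1 hKZ h hz
  have nX : ∀ z ∈ X, z ∉ K := fun z hz h => Finset.disjoint_left.1 hKX h hz
  have nY : ∀ z ∈ Y, z ∉ K := fun z hz h => Finset.disjoint_left.1 hKY h hz
  have main := pr_exists_subset_le h0.le h1 (star K) (R := R)
    (δ := 3 * Real.exp (-(ε * n ^ 2 * p / 100))) (by positivity) ?_ ?_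
  · refine (pr_mono h0.le h1 ?_).trans (main.trans ?_)
    · rintro S ⟨hd, hc, f, hf, ho⟩
      refine ⟨oddPairs f (S ∩ star K), oddPairs_subset, ho, fun z hz => ?_,
        fun x hx y hy => ?_, fun z hz x hx y hy hodd => ?_⟩
      · refine le_trans ?_ (hd z)
        have e1 : ∑ x ∈ X, ind (s(z, x) ∈ S) = ∑ x ∈ X, adj (gr S) z x :=
          Finset.sum_congr rfl fun x hx => (adj_gr (by
            rintro rfl; exact Finset.disjoint_left.1 hZX hz hx)).symm
        have e2 : ((nbr (gr S) z).card : ℝ) = ∑ y, adj (gr S) z y := by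
          simpa using sum_nbr (G := gr S) z fun _ => 1
        rw [e1, e2]
        exact Finset.sum_le_sum_of_subset_of_nonneg (subset_univ _) fun _ _ _ => adj_nonneg _ _
      · refine le_trans ?_ (hc x y (by rintro rfl; exact Finset.disjoint_left.1 hXY hx hy))
        rw [codeg_gr]
        refine Finset.sum_le_sum_of_subset_of_nonneg (fun z hz => ?_) fun _ _ _ =>
          mul_nonneg (ind_nonneg _) (ind_nonneg _)
        simp only [mem_compl, mem_insert, mem_singleton, not_or]
        exact ⟨by rintro rfl; exact Finset.disjoint_left.1 hZX hz hx,
          by rintro rfl; exact Finset.disjoint_left.1 hZY hz hy⟩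
      · rintro ⟨a1, a2, a3⟩
        refine hf.not_oddTriple (nZ z hz) (nX x hx) (nY y hy) (gr_adj.2 ⟨a1, ?_⟩)
          (gr_adj.2 ⟨a2, ?_⟩) (gr_adj.2 ⟨a3, ?_⟩) hodd
        · rintro rfl; exact Finset.disjoint_left.1 hZX hz hx
        · rintro rfl; exact Finset.disjoint_left.1 hZY hz hy
        · rintro rfl; exact Finset.disjoint_left.1 hXY hx hy
    · refine mul_le_mul_of_nonneg_right (Real.exp_le_exp.2 ?_) (by positivity)
      exact mul_le_mul_of_nonneg_left (card_star_le K) h0.le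
  · intro H E S T hST
    have m : ∀ x y, x ∉ K → y ∉ K → (s(x, y) ∈ S ↔ s(x, y) ∈ T) := by
      intro x y hx hy
      have := notMem_star hx hy
      have h2 : s(x, y) ∈ S \ star K ↔ s(x, y) ∈ T \ star K := by rw [hST]
      simpa [this] using h2
    refine and_congr_right fun _ => and_congr ?_ (and_congr ?_ ?_)
    · refine forall₂_congr fun z hz => ?_
      rw [Finset.sum_congr rfl fun x hx => by rw [propext (m z x (nZ z hz) (nX x hx))]]
    · refine forall₂_congr fun x hx => forall₂_congr fun y hy => ?_
      rw [Finset.sum_congr rfl fun z hz => by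
        rw [propext (m z x (nZ z hz) (nX x hx)), propext (m z y (nZ z hz) (nY y hy))]]
    · refine forall₂_congr fun z hz => forall₂_congr fun x hx => forall₂_congr fun y hy => ?_
      rw [m z x (nZ z hz) (nX x hx), m z y (nZ z hz) (nY y hy), m x y (nX x hx) (nY y hy)]
  · intro H E
    by_cases ho : ε * (n : ℝ) ^ 3 ≤ ∑ z ∈ Z, ∑ x ∈ X, ∑ y ∈ Y, ind (OddTriple K H E z x y)
    · exact (pr_mono h0.le h1 fun S hS => hS.2).trans
        (pr_no_triangle_le h0 h1 hZX hZY hXY _ hε hn ho)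
    · refine (pr_mono h0.le h1 (Q := fun _ => False) fun S hS => ho hS.1).trans ?_
      simp [pr, ind, Real.exp_nonneg]

theorem card_pairSet_le (R : Finset (Fin n × Fin n)) : (pairSet R).card ≤ R.card :=
  Finset.card_image_le

/-- For given star data the set of bad pairs is fixed and its edges are still unrevealed, so a
Chernoff bound applies to each choice. -/
theorem pr_many_badPairs_le (h0 : 0 ≤ p) (h1 : p ≤ 1) {Y : Finset (Fin n)}
    (hKY : Disjoint K Y) (z : Fin n) (M : ℝ) :
    pr p (fun S : Finset (Sym2 (Fin n)) => ∃ f : Fin n → Fin n → ZMod 2,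
      ((badPairs K (S ∩ star K) (oddPairs f (S ∩ star K)) Y z).card : ℝ) ≤ M ∧
      21 / 20 * (p * M) ≤ ((pairSet (badPairs K (S ∩ star K) (oddPairs f (S ∩ star K)) Y z) ∩
        S).card : ℝ)) ≤ Real.exp (p * (K.card * n)) * Real.exp (-(p * M / 1600)) := by
  have nY : ∀ z ∈ Y, z ∉ K := fun z hz h => Finset.disjoint_left.1 hKY h hz
  have main := pr_exists_subset_le h0 h1 (star K) (R := fun H E S =>
    ((badPairs K H E Y z).card : ℝ) ≤ M ∧
      21 / 20 * (p * M) ≤ ((pairSet (badPairs K H E Y z) ∩ S).card : ℝ))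
    (δ := Real.exp (-(p * M / 1600))) (by positivity) ?_ ?_
  · refine (pr_mono h0 h1 ?_).trans (main.trans ?_)
    · rintro S ⟨f, hf⟩
      exact ⟨oddPairs f (S ∩ star K), oddPairs_subset, hf⟩
    · refine mul_le_mul_of_nonneg_right (Real.exp_le_exp.2 ?_) (by positivity)
      exact mul_le_mul_of_nonneg_left (card_star_le K) h0
  · intro H E S T hST
    have m : pairSet (badPairs K H E Y z) ∩ S = pairSet (badPairs K H E Y z) ∩ T := by
      ext e
      simp only [mem_inter, and_congr_right_iff]
      intro he
      obtain ⟨x, y, hxy, rfl⟩ := mem_pairSet.1 he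
      have hm := Finset.mem_product.1 (badPairs_subset hxy)
      have := notMem_star (nY x hm.1) (nY y hm.2)
      have h2 : s(x, y) ∈ S \ star K ↔ s(x, y) ∈ T \ star K := by rw [hST]
      simpa [this] using h2
    rw [m]
  · intro H E
    by_cases hM : ((badPairs K H E Y z).card : ℝ) ≤ M
    · have hM' : ((pairSet (badPairs K H E Y z)).card : ℝ) ≤ M :=
        (Nat.cast_le.2 (card_pairSet_le _)).trans hM
      exact (pr_mono h0 h1 fun S hS => hS.2).trans (pr_card_ge_mul_le h0 h1 _ hM')
    · refine (pr_mono h0 h1 (Q := fun _ => False) fun S hS => hM hS.1).trans ?_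
      simp [pr, ind, Real.exp_nonneg]

/-- First moment: a pair outside K is uncovered with probability (1 - p²)^|K|; then Markov's
inequality. -/
theorem pr_many_uncovered_le (h0 : 0 ≤ p) (h1 : p ≤ 1) (K : Finset (Fin n)) {M : ℝ} (hM : 0 < M) :
    pr p (fun S : Finset (Sym2 (Fin n)) => M ≤ ∑ x ∈ Kᶜ, ∑ y ∈ Kᶜ,
      ind (x ≠ y ∧ ¬ Covered K S x y)) ≤ (n : ℝ) ^ 2 * Real.exp (-(K.card * p ^ 2)) / M := by
  have hone : ∀ x ∈ Kᶜ, ∀ y ∈ Kᶜ,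
      ex p (fun S : Finset (Sym2 (Fin n)) => ind (x ≠ y ∧ ¬ Covered K S x y)) ≤
        Real.exp (-(K.card * p ^ 2)) := by
    intro x hx y hy
    by_cases hxy : x = y
    · simp [hxy, ind, Real.exp_nonneg]
    · have e1 : ∀ S : Finset (Sym2 (Fin n)), ind (x ≠ y ∧ ¬ Covered K S x y) =
          ∏ v ∈ K, (1 + (-1) * (ind (s(v, x) ∈ S) * ind (s(v, y) ∈ S))) := by
        intro S
        have : (x ≠ y ∧ ¬ Covered K S x y) ↔ ∀ v ∈ K, ¬ (s(v, x) ∈ S ∧ s(v, y) ∈ S) := by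
          simp only [Covered, ne_eq, hxy, not_false_eq_true, true_and, not_exists, not_and]
        rw [propext this, ind_forall]
        refine Finset.prod_congr rfl fun v _ => ?_
        rw [← ind_and]
        by_cases h : s(v, x) ∈ S ∧ s(v, y) ∈ S
        · rw [ind_true h, ind_false (not_not.2 h)]; norm_num
        · rw [ind_false h, ind_true h]; norm_num
      simp only [e1]
      rw [ex_prod_one_add_codeg hxy (-1) K]
      · rw [neg_mul, one_mul, ← sub_eq_add_neg, ← mul_neg, Real.exp_nat_mul]
        refine pow_le_pow_left₀ (by nlinarith) ?_ _
        linarith [Real.add_one_le_exp (-p ^ 2)]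
      · rw [Finset.disjoint_left]
        intro v hv
        simp only [mem_insert, mem_singleton] at hv
        rcases hv with rfl | rfl
        · exact Finset.mem_compl.1 hx
        · exact Finset.mem_compl.1 hy
  have hnn : ∀ S : Finset (Sym2 (Fin n)),
      0 ≤ ∑ x ∈ Kᶜ, ∑ y ∈ Kᶜ, ind (x ≠ y ∧ ¬ Covered K S x y) := fun S =>
    Finset.sum_nonneg fun _ _ => Finset.sum_nonneg fun _ _ => ind_nonneg _
  calc _ ≤ ex p (fun S : Finset (Sym2 (Fin n)) => (∑ x ∈ Kᶜ, ∑ y ∈ Kᶜ,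
        ind (x ≠ y ∧ ¬ Covered K S x y)) * M⁻¹) := by
        refine pr_le_ex h0 h1 (fun S => mul_nonneg (hnn S) (by positivity)) fun S hS => ?_
        rw [← div_eq_mul_inv, one_le_div hM]; exact hS
    _ = (∑ x ∈ Kᶜ, ∑ y ∈ Kᶜ, ex p (fun S : Finset (Sym2 (Fin n)) =>
        ind (x ≠ y ∧ ¬ Covered K S x y))) * M⁻¹ := by
        rw [ex_mul_const, ex_sum]; simp only [ex_sum]
    _ ≤ (∑ x ∈ Kᶜ, ∑ y ∈ Kᶜ, Real.exp (-(K.card * p ^ 2))) * M⁻¹ := by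
        refine mul_le_mul_of_nonneg_right ?_ (by positivity)
        exact Finset.sum_le_sum fun x hx => Finset.sum_le_sum fun y hy => hone x hx y hy
    _ ≤ _ := by
        rw [div_eq_mul_inv]
        refine mul_le_mul_of_nonneg_right ?_ (by positivity)
        simp only [Finset.sum_const, nsmul_eq_mul]
        rw [← mul_assoc, ← pow_two]
        refine mul_le_mul_of_nonneg_right ?_ (by positivity)
        have : Kᶜ.card ≤ n := (Finset.card_le_univ _).trans_eq (Fintype.card_fin n)
        gcongr

end StarData

/-! ### From few inconsistent triples to a nearby coboundary, deterministically. -/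

section Global

open Finset

variable {n : ℕ} {p : ℝ} {K Z Y : Finset (Fin n)} {S : Finset (Sym2 (Fin n))}

/-- `pr_no_triangle_le` needs disjoint X and Y, while both ends of the pairs of interest lie in one
set. Colouring that set reduces to pairs of distinct colour classes; monochromatic pairs are few
when there are many colours. -/
theorem sum_sum_eq_sum_color {m : ℕ} (c : Fin n → Fin m) (Y : Finset (Fin n))
    (h : Fin n → Fin n → ℝ) :
    ∑ x ∈ Y, ∑ y ∈ Y, h x y = ∑ i, ∑ j, ∑ x ∈ Y.filter (fun x => c x = i),
      ∑ y ∈ Y.filter (fun y => c y = j), h x y := by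
  rw [← Finset.sum_fiberwise Y c]
  refine Finset.sum_congr rfl fun i _ => ?_
  exact (Finset.sum_congr rfl fun x _ => (Finset.sum_fiberwise Y c (h x)).symm).trans
    Finset.sum_comm

theorem card_badPairs (H E : Finset (Sym2 (Fin n))) (Y : Finset (Fin n)) (z : Fin n) :
    ((badPairs K H E Y z).card : ℝ) = ∑ x ∈ Y, ∑ y ∈ Y,
      ind (x ≠ y ∧ (AllCovered K H z x y → OddTriple K H E z x y)) := by
  rw [badPairs, Finset.card_filter, ← Finset.sum_product', Nat.cast_sum]
  exact Finset.sum_congr rfl fun x _ => by simp only [ind]; split_ifs <;> norm_num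

theorem ind_bad_le {m : ℕ} (c : Fin n → Fin m) (H E : Finset (Sym2 (Fin n))) (z x y : Fin n) :
    ind (x ≠ y ∧ (AllCovered K H z x y → OddTriple K H E z x y)) ≤
      ind (c x ≠ c y ∧ OddTriple K H E z x y) + ind (c x = c y) + ind (¬ Covered K H z x) +
      ind (¬ Covered K H z y) + ind (x ≠ y ∧ ¬ Covered K H x y) := by
  have n1 := ind_nonneg (c x ≠ c y ∧ OddTriple K H E z x y)
  have n2 := ind_nonneg (c x = c y)
  have n3 := ind_nonneg (¬ Covered K H z x)
  have n4 := ind_nonneg (¬ Covered K H z y)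
  have n5 := ind_nonneg (x ≠ y ∧ ¬ Covered K H x y)
  by_cases h : x ≠ y ∧ (AllCovered K H z x y → OddTriple K H E z x y)
  · rw [ind_true h]
    by_cases h2 : c x = c y
    · rw [ind_true h2]; linarith
    by_cases h3 : ¬ Covered K H z x
    · rw [ind_true h3]; linarith
    by_cases h4 : ¬ Covered K H z y
    · rw [ind_true h4]; linarith
    by_cases h5 : ¬ Covered K H x y
    · rw [ind_true (P := x ≠ y ∧ _) ⟨h.1, h5⟩]; linarith
    · rw [ind_true (P := c x ≠ c y ∧ _) ⟨h2, h.2 ⟨not_not.1 h3, not_not.1 h4, not_not.1 h5⟩⟩]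
      linarith
  · rw [ind_false h]; linarith

/-- Some vertex of `Z` defines a coboundary that is consistent with most pairs. -/
theorem exists_card_badPairs_le {m : ℕ} (c : Fin n → Fin m) (E : Finset (Sym2 (Fin n)))
    (hKZ : Disjoint K Z) (hKY : Disjoint K Y) (hZY : Disjoint Z Y) (hZ : Z.Nonempty)
    {ε μ ν M : ℝ}
    (hO : ∀ i j, i ≠ j → ∑ z ∈ Z, ∑ x ∈ Y.filter (fun x => c x = i),
      ∑ y ∈ Y.filter (fun y => c y = j), ind (OddTriple K (S ∩ star K) E z x y) ≤ ε)
    (hε : 0 ≤ ε)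
    (hmono : ∑ x, ∑ y, ind (c x = c y) ≤ μ)
    (hunc : ∑ x ∈ Kᶜ, ∑ y ∈ Kᶜ, ind (x ≠ y ∧ ¬ Covered K S x y) ≤ ν)
    (hnum : m ^ 2 * ε + Z.card * μ + 2 * n * ν + Z.card * ν ≤ Z.card * M) :
    ∃ z ∈ Z, ((badPairs K (S ∩ star K) E Y z).card : ℝ) ≤ M := by
  set H := S ∩ star K with hH
  have nZ : ∀ z ∈ Z, z ∉ K := fun z hz h => Finset.disjoint_left.1 hKZ h hz
  have nY : ∀ z ∈ Y, z ∉ K := fun z hz h => Finset.disjoint_left.1 hKY h hz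
  have hYc : Y ⊆ Kᶜ := fun y hy => Finset.mem_compl.2 (nY y hy)
  have hZc : Z ⊆ Kᶜ := fun y hy => Finset.mem_compl.2 (nZ y hy)
  have hYn : (Y.card : ℝ) ≤ n := by
    exact_mod_cast (Finset.card_le_univ Y).trans_eq (Fintype.card_fin n)
  have hν : 0 ≤ ν := le_trans (Finset.sum_nonneg fun _ _ => Finset.sum_nonneg fun _ _ =>
    ind_nonneg _) hunc
  have t1 : ∑ z ∈ Z, ∑ x ∈ Y, ∑ y ∈ Y, ind (c x ≠ c y ∧ OddTriple K H E z x y) ≤ m ^ 2 * ε := by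
    have e1 : ∑ z ∈ Z, ∑ x ∈ Y, ∑ y ∈ Y, ind (c x ≠ c y ∧ OddTriple K H E z x y) =
        ∑ i, ∑ j, ∑ z ∈ Z, ∑ x ∈ Y.filter (fun x => c x = i), ∑ y ∈ Y.filter (fun y => c y = j),
          ind (c x ≠ c y ∧ OddTriple K H E z x y) := by
      rw [Finset.sum_congr rfl fun z _ => sum_sum_eq_sum_color c Y _, Finset.sum_comm]
      exact Finset.sum_congr rfl fun i _ => Finset.sum_comm
    rw [e1]
    calc _ ≤ ∑ i : Fin m, ∑ j : Fin m, ε := by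
          refine Finset.sum_le_sum fun i _ => Finset.sum_le_sum fun j _ => ?_
          by_cases hij : i = j
          · refine le_trans (le_of_eq ?_) hε
            refine Finset.sum_eq_zero fun z _ => Finset.sum_eq_zero fun x hx =>
              Finset.sum_eq_zero fun y hy => ind_false ?_
            rw [(Finset.mem_filter.1 hx).2, (Finset.mem_filter.1 hy).2, hij]
            simp
          · refine le_trans ?_ (hO i j hij)
            exact Finset.sum_le_sum fun z _ => Finset.sum_le_sum fun x _ =>
              Finset.sum_le_sum fun y _ => ind_mono fun h => h.2
      _ = _ := by simp; ring
  have t2 : ∑ z ∈ Z, ∑ x ∈ Y, ∑ y ∈ Y, ind (c x = c y) ≤ Z.card * μ := by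
    rw [Finset.sum_const, nsmul_eq_mul]
    refine mul_le_mul_of_nonneg_left (le_trans ?_ hmono) (Nat.cast_nonneg _)
    calc _ ≤ ∑ x ∈ Y, ∑ y, ind (c x = c y) := Finset.sum_le_sum fun x _ =>
          Finset.sum_le_sum_of_subset_of_nonneg (subset_univ _) fun _ _ _ => ind_nonneg _
      _ ≤ _ := Finset.sum_le_sum_of_subset_of_nonneg (subset_univ _) fun _ _ _ =>
          Finset.sum_nonneg fun _ _ => ind_nonneg _
  have unc : ∀ A B : Finset (Fin n), A ⊆ Kᶜ → B ⊆ Kᶜ →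
      ∑ x ∈ A, ∑ y ∈ B, ind (x ≠ y ∧ ¬ Covered K H x y) ≤ ν := by
    intro A B hA hB
    refine le_trans ?_ hunc
    calc _ ≤ ∑ x ∈ A, ∑ y ∈ Kᶜ, ind (x ≠ y ∧ ¬ Covered K S x y) := by
          refine Finset.sum_le_sum fun x hx => ?_
          rw [Finset.sum_congr rfl fun y hy => by
            rw [hH, covered_inter_star (Finset.mem_compl.1 (hA hx)) (Finset.mem_compl.1 (hB hy))]]
          exact Finset.sum_le_sum_of_subset_of_nonneg hB fun _ _ _ => ind_nonneg _
      _ ≤ _ := Finset.sum_le_sum_of_subset_of_nonneg hA fun _ _ _ =>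
          Finset.sum_nonneg fun _ _ => ind_nonneg _
  have zunc : ∑ z ∈ Z, ∑ x ∈ Y, ind (¬ Covered K H z x) ≤ ν := by
    refine le_trans (Finset.sum_le_sum fun z hz => Finset.sum_le_sum fun x hx => ?_)
      (unc Z Y hZc hYc)
    exact ind_mono fun h => ⟨by rintro rfl; exact Finset.disjoint_left.1 hZY hz hx, h⟩
  have t3 : ∑ z ∈ Z, ∑ x ∈ Y, ∑ y ∈ Y, ind (¬ Covered K H z x) ≤ n * ν := by
    simp only [Finset.sum_const, nsmul_eq_mul, ← Finset.mul_sum]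
    exact mul_le_mul hYn zunc (Finset.sum_nonneg fun _ _ => Finset.sum_nonneg fun _ _ =>
      ind_nonneg _) (Nat.cast_nonneg _)
  have t4 : ∑ z ∈ Z, ∑ x ∈ Y, ∑ y ∈ Y, ind (¬ Covered K H z y) ≤ n * ν := by
    simp only [Finset.sum_const, nsmul_eq_mul, ← Finset.mul_sum]
    exact mul_le_mul hYn zunc (Finset.sum_nonneg fun _ _ => Finset.sum_nonneg fun _ _ =>
      ind_nonneg _) (Nat.cast_nonneg _)
  have t5 : ∑ z ∈ Z, ∑ x ∈ Y, ∑ y ∈ Y, ind (x ≠ y ∧ ¬ Covered K H x y) ≤ Z.card * ν := by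
    rw [Finset.sum_const, nsmul_eq_mul]
    exact mul_le_mul_of_nonneg_left (unc Y Y hYc hYc) (Nat.cast_nonneg _)
  -- Averaging over z in Z. The first four terms of `hnum` bound the odd triples, the monochromatic
  -- pairs, the uncovered pairs at z (twice, for x and y) and the uncovered pairs xy.
  refine Finset.exists_le_of_sum_le hZ ?_
  rw [Finset.sum_const, nsmul_eq_mul]
  refine le_trans ?_ hnum
  calc _ ≤ ∑ z ∈ Z, ∑ x ∈ Y, ∑ y ∈ Y, (ind (c x ≠ c y ∧ OddTriple K H E z x y) +
      ind (c x = c y) + ind (¬ Covered K H z x) + ind (¬ Covered K H z y) +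
      ind (x ≠ y ∧ ¬ Covered K H x y)) := by
        refine Finset.sum_le_sum fun z _ => ?_
        rw [card_badPairs]
        exact Finset.sum_le_sum fun x _ => Finset.sum_le_sum fun y _ => ind_bad_le c H E z x y
    _ ≤ _ := by
        simp only [Finset.sum_add_distrib]
        linarith

/-- If most pairs are consistent with the coboundary defined by `z`, and the inconsistent pairs
contain few edges, then a cocycle is close to a coboundary. -/
theorem IsCocycle.exists_defect_le {f : Fin n → Fin n → ZMod 2} (hf : IsCocycle (gr S) f)
    (hKY : Disjoint K Y) {z : Fin n} {d M : ℝ}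
    (hdeg : ∀ v, ((nbr (gr S) v).card : ℝ) ≤ d)
    (hM : ((pairSet (badPairs K (S ∩ star K) (oddPairs f (S ∩ star K)) Y z) ∩ S).card : ℝ) ≤ M) :
    ∃ g, defect (gr S) f g ≤ 2 * (Yᶜ.card * d) + 2 * M := by
  classical
  set H := S ∩ star K with hH
  set E := oddPairs f H with hE
  let R := badPairs K H E Y z
  have nY : ∀ z ∈ Y, z ∉ K := fun z hz h => Finset.disjoint_left.1 hKY h hz
  -- g(x) is the value forced on zx, whether or not zx is an edge.
  let g : Fin n → ZMod 2 := fun x => if Forced K H E z x then 1 else 0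
  refine ⟨g, ?_⟩
  rw [defect_eq]
  -- An edge uv of Y on which f and the coboundary of g differ is a bad pair: if zuv is all covered,
  -- the disagreement says exactly that it is an odd triple. Other disagreements meet the complement
  -- of Y.
  have key : ∀ u v, ind ((gr S).Adj u v ∧ f u v + g u + g v = 1) ≤
      ind (u ∈ Yᶜ) * adj (gr S) u v + ind (v ∈ Yᶜ) * adj (gr S) v u +
      ind ((u, v) ∈ R ∧ s(u, v) ∈ S) := by
    intro u v
    have p1 : 0 ≤ ind (u ∈ Yᶜ) * adj (gr S) u v := mul_nonneg (ind_nonneg _) (adj_nonneg _ _)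
    have p2 : 0 ≤ ind (v ∈ Yᶜ) * adj (gr S) v u := mul_nonneg (ind_nonneg _) (adj_nonneg _ _)
    have p3 := ind_nonneg ((u, v) ∈ R ∧ s(u, v) ∈ S)
    by_cases h : (gr S).Adj u v ∧ f u v + g u + g v = 1
    · obtain ⟨huv, h⟩ := h
      have i1 := ind_le_one ((gr S).Adj u v ∧ f u v + g u + g v = 1)
      by_cases hu : u ∈ Y
      · by_cases hv : v ∈ Y
        · have hR : (u, v) ∈ R := by
            simp only [R, badPairs, mem_filter, mem_product]
            refine ⟨⟨hu, hv⟩, huv.ne, fun hc => ⟨hc, ?_⟩⟩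
            rw [← hf.eq_one_iff_forced (nY u hu) (nY v hv) huv hc.2.2]
            have dec : ∀ a : ZMod 2, ∀ P Q : Prop, [Decidable P] → [Decidable Q] →
                a + (if P then 1 else 0) + (if Q then 1 else 0) = 1 → (a = 1 ↔ (P ↔ Q)) := by
              intro a P Q _ _ h
              by_cases hP : P <;> by_cases hQ : Q <;> simp only [hP, hQ, if_true, if_false] at h ⊢ <;>
                revert a <;> decide
            exact dec _ _ _ h
          rw [ind_true (P := (u, v) ∈ R ∧ _) ⟨hR, (gr_adj.1 huv).1⟩]
          linarith
        · rw [ind_true (Finset.mem_compl.2 hv), adj, adj, ind_true huv.symm] at *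
          linarith
      · rw [ind_true (Finset.mem_compl.2 hu), adj, adj, ind_true huv] at *
        linarith
    · rw [ind_false h]; linarith
  have hcount : ∑ u, ∑ v, ind (u ∈ Yᶜ) * adj (gr S) u v ≤ Yᶜ.card * d := by
    have e1 : ∀ u, ∑ v, adj (gr S) u v = ((nbr (gr S) u).card : ℝ) := fun u => by
      simpa using (sum_nbr (G := gr S) u fun _ => 1).symm
    simp only [← Finset.mul_sum, e1]
    calc ∑ u, ind (u ∈ Yᶜ) * ((nbr (gr S) u).card : ℝ) ≤ ∑ u, ind (u ∈ Yᶜ) * d :=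
          Finset.sum_le_sum fun u _ => mul_le_mul_of_nonneg_left (hdeg u) (ind_nonneg _)
      _ = _ := by
          rw [← Finset.sum_mul, sum_ind_mem, Finset.univ_inter]
  have hRS : ∑ u, ∑ v, ind ((u, v) ∈ R ∧ s(u, v) ∈ S) ≤ 2 * M := by
    have e1 : ∑ u, ∑ v, ind ((u, v) ∈ R ∧ s(u, v) ∈ S) =
        ((R.filter fun x => s(x.1, x.2) ∈ S).card : ℝ) := by
      rw [← Fintype.sum_prod_type' fun u v => ind ((u, v) ∈ R ∧ s(u, v) ∈ S), Finset.card_filter,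
        Nat.cast_sum, ← Finset.sum_filter_add_sum_filter_not univ (· ∈ R)]
      rw [Finset.sum_eq_zero (s := univ.filter (· ∉ R)), add_zero, Finset.filter_univ_mem]
      · exact Finset.sum_congr rfl fun x hx => by simp [ind, hx]
      · intro x hx
        exact ind_false fun h => (Finset.mem_filter.1 hx).2 h.1
    rw [e1]
    exact (card_filter_le_two_mul R S).trans (by linarith)
  calc _ ≤ ∑ u, ∑ v, (ind (u ∈ Yᶜ) * adj (gr S) u v + ind (v ∈ Yᶜ) * adj (gr S) v u +
      ind ((u, v) ∈ R ∧ s(u, v) ∈ S)) :=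
        Finset.sum_le_sum fun u _ => Finset.sum_le_sum fun v _ => key u v
    _ ≤ _ := by
        simp only [Finset.sum_add_distrib]
        have : ∑ u, ∑ v, ind (v ∈ Yᶜ) * adj (gr S) v u = ∑ u, ∑ v, ind (u ∈ Yᶜ) * adj (gr S) u v :=
          Finset.sum_comm
        linarith

end Global

/-! ### With high probability every cocycle is near a coboundary. -/

section NearCoboundary

open Finset

variable {ε δ : ℝ} {K Z Y : ∀ n, Finset (Fin n)}

/-- The condition δ ≤ ε/200 makes the cost exp(p|K|n) of the union bound at most half, in the
exponent, of the gain εn²p/100. -/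
theorem negligible_many_oddTriples (m : ℕ) (c : ∀ n, Fin n → Fin m) (hε : 0 < ε)
    (hδ : δ ≤ ε / 200) (hK : ∀ n, ((K n).card : ℝ) ≤ δ * n) (hKZ : ∀ n, Disjoint (K n) (Z n))
    (hKY : ∀ n, Disjoint (K n) (Y n)) (hZY : ∀ n, Disjoint (Z n) (Y n)) :
    Negligible fun n p S => (∀ v, ((nbr (gr S) v).card : ℝ) ≤ 2 * (n * p)) ∧
      (∀ u v, u ≠ v → codeg (gr S) u v ≤ 6 * (n * p ^ 2)) ∧
      ∃ f, IsCocycle (gr S) f ∧ ∃ i j, i ≠ j ∧ ε * (n : ℝ) ^ 3 ≤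
        ∑ z ∈ Z n, ∑ x ∈ (Y n).filter (fun x => c n x = i),
        ∑ y ∈ (Y n).filter (fun x => c n x = j),
        ind (OddTriple (K n) (S ∩ star (K n)) (oddPairs f (S ∩ star (K n))) z x y) := by
  have hb := (tendsto_mul_exp_neg_sqrt (c := ε / 200) (by positivity)).const_mul ((m : ℝ) ^ 2 * 3)
  rw [mul_zero] at hb
  refine negligible_of_le hb ?_
  filter_upwards [eventually_gt_atTop 0, eventually_sqrt_le,
    tendsto_sqrt_natCast.eventually_gt_atTop 0] with n hn hsq hs0 p h0 h1 hD
  have hn0 : (1 : ℝ) ≤ n := by exact_mod_cast hn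
  have h2 := hsq p h0 hD
  have hp : 0 < p := by
    by_contra h
    have : p = 0 := le_antisymm (not_lt.1 h) h0
    rw [this, mul_zero] at h2
    linarith
  have hexp : Real.exp (p * ((K n).card * n)) * (3 * Real.exp (-(ε * n ^ 2 * p / 100))) ≤
      3 * (n * Real.exp (-(ε / 200 * √(n : ℝ)))) := by
    have e1 : Real.exp (p * ((K n).card * n)) * (3 * Real.exp (-(ε * n ^ 2 * p / 100))) =
        3 * Real.exp (p * ((K n).card * n) + -(ε * n ^ 2 * p / 100)) := by rw [Real.exp_add]; ring
    have h3 : p * ((K n).card * n) ≤ p * (ε / 200 * n * n) := by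
      gcongr
      exact (hK n).trans (by gcongr)
    have h4 : √(n : ℝ) ≤ n * (n * p) := by nlinarith
    have h5 := mul_le_mul_of_nonneg_left h4 (show 0 ≤ ε / 200 by positivity)
    rw [e1]
    refine mul_le_mul_of_nonneg_left ?_ (by norm_num)
    calc Real.exp (p * ((K n).card * n) + -(ε * n ^ 2 * p / 100)) ≤
          Real.exp (-(ε / 200 * √(n : ℝ))) := Real.exp_le_exp.2 (by linarith)
      _ ≤ _ := le_mul_of_one_le_left (Real.exp_pos _).le hn0
  calc _ ≤ pr p (fun S : Finset (Sym2 (Fin n)) => ∃ q ∈ (univ : Finset (Fin m × Fin m)),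
        q.1 ≠ q.2 ∧ ((∀ v, ((nbr (gr S) v).card : ℝ) ≤ 2 * (n * p)) ∧
      (∀ u v, u ≠ v → codeg (gr S) u v ≤ 6 * (n * p ^ 2)) ∧
      ∃ f, IsCocycle (gr S) f ∧ ε * (n : ℝ) ^ 3 ≤
        ∑ z ∈ Z n, ∑ x ∈ (Y n).filter (fun x => c n x = q.1),
        ∑ y ∈ (Y n).filter (fun x => c n x = q.2),
        ind (OddTriple (K n) (S ∩ star (K n)) (oddPairs f (S ∩ star (K n))) z x y))) := by
        refine pr_mono h0 h1 ?_
        rintro S ⟨a, b, f, hf, i, j, hij, h⟩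
        exact ⟨(i, j), mem_univ _, hij, a, b, f, hf, h⟩
    _ ≤ ∑ _q : Fin m × Fin m, 3 * (n * Real.exp (-(ε / 200 * √(n : ℝ)))) := by
        refine (pr_exists_le h0 h1 _ _).trans <| Finset.sum_le_sum ?_
        rintro ⟨i, j⟩ _
        by_cases hij : i = j
        · refine (pr_mono h0 h1 (Q := fun _ => False) fun S hS => hS.1 hij).trans ?_
          have : pr p (fun _ : Finset (Sym2 (Fin n)) => False) = 0 := by simp [pr, ind]
          rw [this]
          positivity
        · refine (pr_mono h0 h1 fun S hS => hS.2).trans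
            ((pr_many_oddTriples_le hp h1 (hKZ n) ?_ ?_ ?_ ?_ ?_ hε hn).trans hexp)
          · exact (hKY n).mono_right (Finset.filter_subset _ _)
          · exact (hKY n).mono_right (Finset.filter_subset _ _)
          · exact (hZY n).mono_right (Finset.filter_subset _ _)
          · exact (hZY n).mono_right (Finset.filter_subset _ _)
          · rw [Finset.disjoint_left]
            intro x hx hy
            exact hij ((Finset.mem_filter.1 hx).2.symm.trans (Finset.mem_filter.1 hy).2)
    _ = _ := by
        simp only [Finset.sum_const, Finset.card_univ, Fintype.card_prod, Fintype.card_fin,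
          nsmul_eq_mul]
        push_cast
        ring

/-- As before, δ ≤ ε/3200 spends half of the Chernoff exponent εn²p/1600 on the star data; the rest
also covers the choice of z. -/
theorem negligible_many_badPairs (hε : 0 < ε) (hδ : δ ≤ ε / 3200)
    (hK : ∀ n, ((K n).card : ℝ) ≤ δ * n) (hKY : ∀ n, Disjoint (K n) (Y n)) :
    Negligible fun n p S => ∃ z, ∃ f : Fin n → Fin n → ZMod 2,
      ((badPairs (K n) (S ∩ star (K n)) (oddPairs f (S ∩ star (K n))) (Y n) z).card : ℝ) ≤
        ε * n ^ 2 ∧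
      21 / 20 * (p * (ε * n ^ 2)) ≤ ((pairSet (badPairs (K n) (S ∩ star (K n))
        (oddPairs f (S ∩ star (K n))) (Y n) z) ∩ S).card : ℝ) := by
  refine negligible_of_le (tendsto_mul_exp_neg_sqrt (c := ε / 3200) (by positivity)) ?_
  filter_upwards [eventually_gt_atTop 0, eventually_sqrt_le] with n hn hsq p h0 h1 hD
  have hn0 : (1 : ℝ) ≤ n := by exact_mod_cast hn
  have h2 := hsq p h0 hD
  have hexp : Real.exp (p * ((K n).card * n)) * Real.exp (-(p * (ε * n ^ 2) / 1600)) ≤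
      Real.exp (-(ε / 3200 * √(n : ℝ))) := by
    rw [← Real.exp_add]
    apply Real.exp_le_exp.2
    have h3 : p * ((K n).card * n) ≤ p * (ε / 3200 * n * n) := by
      gcongr
      exact (hK n).trans (by gcongr)
    have h4 : √(n : ℝ) ≤ n * (n * p) := by nlinarith [Real.sqrt_nonneg (n : ℝ)]
    have h5 := mul_le_mul_of_nonneg_left h4 (show 0 ≤ ε / 3200 by positivity)
    linarith
  calc _ ≤ ∑ z : Fin n, Real.exp (-(ε / 3200 * √(n : ℝ))) := by
        refine le_trans (pr_mono h0 h1 ?_) ((pr_exists_le h0 h1 (univ : Finset (Fin n))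
          (fun z S => ∃ f : Fin n → Fin n → ZMod 2,
          ((badPairs (K n) (S ∩ star (K n)) (oddPairs f (S ∩ star (K n))) (Y n) z).card : ℝ) ≤
            ε * n ^ 2 ∧
          21 / 20 * (p * (ε * n ^ 2)) ≤ ((pairSet (badPairs (K n) (S ∩ star (K n))
            (oddPairs f (S ∩ star (K n))) (Y n) z) ∩ S).card : ℝ))).trans <| Finset.sum_le_sum
            fun z _ => (pr_many_badPairs_le h0 h1 (hKY n) z _).trans hexp)
        rintro S ⟨z, h⟩
        exact ⟨z, mem_univ _, h⟩
    _ = _ := by simp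

/-- K of linear size makes |K|p² at least a constant times log n, so the expected proportion of
uncovered pairs tends to 0. -/
theorem negligible_many_uncovered (hε : 0 < ε) (hδ : 0 < δ)
    (hK : ∀ᶠ n : ℕ in atTop, δ * n ≤ ((K n).card : ℝ)) :
    Negligible fun n _ S => ε * n ^ 2 ≤ ∑ x ∈ (K n)ᶜ, ∑ y ∈ (K n)ᶜ,
      ind (x ≠ y ∧ ¬ Covered (K n) S x y) := by
  have hb := (tendsto_exp_neg_log (c := δ * (5 / 4)) (by positivity)).const_mul (1 / ε)
  rw [mul_zero] at hb
  refine negligible_of_le hb ?_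
  filter_upwards [eventually_gt_atTop 0, hK] with n hn hKn p h0 h1 hD
  have hn0 : (0 : ℝ) < n := by exact_mod_cast hn
  refine (pr_many_uncovered_le h0 h1 (K n) (by positivity)).trans ?_
  have h2 : Real.exp (-((K n).card * p ^ 2)) ≤ Real.exp (-(δ * (5 / 4) * Real.log n)) := by
    apply Real.exp_le_exp.2
    have h3 := mul_le_mul_of_nonneg_right hKn (sq_nonneg p)
    have h4 := mul_le_mul_of_nonneg_left hD hδ.le
    linarith
  calc _ = 1 / ε * Real.exp (-((K n).card * p ^ 2)) := by field_simp
    _ ≤ _ := mul_le_mul_of_nonneg_left h2 (by positivity)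

theorem sum_sum_ind_mod_le {n m : ℕ} (c : Fin n → Fin m)
    (hc : ∀ x, (c x : ℕ) = x % m) : ∑ x, ∑ y, ind (c x = c y) ≤ n * (n / m + 1 : ℝ) := by
  have hone : ∀ x, ∑ y, ind (c x = c y) ≤ (n / m + 1 : ℝ) := by
    intro x
    have e1 : ∑ y, ind (c x = c y) = ((univ.filter fun y => c x = c y).card : ℝ) := by
      rw [Finset.card_filter, Nat.cast_sum]
      exact Finset.sum_congr rfl fun y _ => by simp [ind]
    have h2 : (univ.filter fun y => c x = c y).card ≤ (Finset.range (n / m + 1)).card := by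
      refine Finset.card_le_card_of_injOn (fun y => (y : ℕ) / m) ?_ ?_
      · intro y _
        simp only [Finset.coe_range, Set.mem_Iio]
        exact Nat.lt_succ_of_le (Nat.div_le_div_right y.2.le)
      · intro y hy w hw h
        simp only [coe_filter, mem_univ, true_and, Set.mem_ofPred_eq] at hy hw
        have h3 : (y : ℕ) % m = w % m := by rw [← hc, ← hc, ← hy, ← hw]
        apply Fin.ext
        rw [← Nat.div_add_mod (y : ℕ) m, ← Nat.div_add_mod (w : ℕ) m, h3]
        simp only at h
        rw [h]
    rw [Finset.card_range] at h2
    rw [e1]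
    calc _ ≤ ((n / m + 1 : ℕ) : ℝ) := Nat.cast_le.2 h2
      _ ≤ _ := by push_cast; gcongr; exact Nat.cast_div_le
  calc _ ≤ ∑ x : Fin n, (n / m + 1 : ℝ) := Finset.sum_le_sum fun x _ => hone x
    _ = _ := by simp; ring

/-- With high probability every cocycle is close to a coboundary. -/
theorem negligible_far (hε : 0 < ε) (hε1 : ε ≤ 1) : Negligible fun n p S =>
    ∃ f, IsCocycle (gr S) f ∧ ∀ g, ε * (n ^ 2 * p) < defect (gr S) f g := by
  -- l and d are the densities of Z and K, and e is the permitted density of bad pairs. The number m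
  -- of colours and the error densities a (odd triples) and b (uncovered pairs) are chosen so that
  -- each error term is a quarter of the allowance |Z|en², given |Z| ≥ ln/2. d comes last, since the
  -- star data must be cheap compared with a and e.
  obtain ⟨l, hl⟩ : ∃ l, l = ε / 20 := ⟨_, rfl⟩
  obtain ⟨e, he⟩ : ∃ e, e = ε / 4 := ⟨_, rfl⟩
  have hl0 : 0 < l := by rw [hl]; positivity
  have he0 : 0 < e := by rw [he]; positivity
  obtain ⟨m, hm⟩ := exists_nat_ge (8 / e)
  have hm0' : (0 : ℝ) < m := lt_of_lt_of_le (by positivity) hm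
  have hm0 : 0 < m := by exact_mod_cast hm0'
  obtain ⟨a, ha⟩ : ∃ a, a = l / 2 * e / (4 * m ^ 2) := ⟨_, rfl⟩
  have ha0 : 0 < a := by rw [ha]; positivity
  obtain ⟨b, hb⟩ : ∃ b, b = l / 2 * e / 8 := ⟨_, rfl⟩
  have hb0 : 0 < b := by rw [hb]; positivity
  obtain ⟨d, hd0, hdl, hda, hde⟩ : ∃ d, 0 < d ∧ d ≤ l ∧ d ≤ a / 200 ∧ d ≤ e / 3200 :=
    ⟨min l (min (a / 200) (e / 3200)), by positivity, min_le_left _ _,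
      (min_le_right _ _).trans (min_le_left _ _), (min_le_right _ _).trans (min_le_right _ _)⟩
  have floor_le : ∀ (t : ℝ) (n : ℕ), 0 ≤ t → (⌊t * n⌋₊ : ℝ) ≤ t * n := fun t n ht =>
    Nat.floor_le (by positivity)
  have le_floor : ∀ t : ℝ, 0 < t → ∀ᶠ n : ℕ in atTop, t / 2 * n ≤ (⌊t * n⌋₊ : ℝ) := by
    intro t ht
    filter_upwards [tendsto_natCast_atTop_atTop.eventually_ge_atTop (2 / t)] with n hn
    rw [div_le_iff₀ ht] at hn
    have := Nat.sub_one_lt_floor (t * (n : ℝ))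
    linarith
  have hex : ∀ n : ℕ, ∃ K Z : Finset (Fin n), K.card = ⌊d * n⌋₊ ∧ Z.card = ⌊l * n⌋₊ ∧
      Disjoint K Z := by
    intro n
    have hn : (0 : ℝ) ≤ n := Nat.cast_nonneg n
    have h1 : ⌊d * n⌋₊ + ⌊l * n⌋₊ ≤ n := by
      have := floor_le d n hd0.le
      have := floor_le l n hl0.le
      have : (d + l) * n ≤ 1 * n := mul_le_mul_of_nonneg_right (by linarith) hn
      have h3 : ((⌊d * n⌋₊ + ⌊l * n⌋₊ : ℕ) : ℝ) ≤ n := by push_cast; linarith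
      exact_mod_cast h3
    obtain ⟨K, -, hK⟩ := Finset.exists_subset_card_eq (s := (univ : Finset (Fin n)))
      (n := ⌊d * n⌋₊) (by rw [Finset.card_univ, Fintype.card_fin]; omega)
    obtain ⟨Z, hZ, hZc⟩ := Finset.exists_subset_card_eq (s := Kᶜ)
      (n := ⌊l * n⌋₊) (by rw [Finset.card_compl, Fintype.card_fin]; omega)
    exact ⟨K, Z, hK, hZc, (disjoint_compl_right (a := K)).mono_right hZ⟩
  choose K Z hK hZ hKZ using hex
  let Y : ∀ n, Finset (Fin n) := fun n => (K n ∪ Z n)ᶜ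
  have hKY : ∀ n, Disjoint (K n) (Y n) := fun n =>
    (disjoint_compl_right (a := K n ∪ Z n)).mono_left subset_union_left
  have hZY : ∀ n, Disjoint (Z n) (Y n) := fun n =>
    (disjoint_compl_right (a := K n ∪ Z n)).mono_left subset_union_right
  let c : ∀ n, Fin n → Fin m := fun n x => ⟨x % m, Nat.mod_lt _ hm0⟩
  have hKd : ∀ n, ((K n).card : ℝ) ≤ d * n := fun n => by rw [hK]; exact floor_le d n hd0.le
  have hKl : ∀ᶠ n : ℕ in atTop, d / 2 * n ≤ ((K n).card : ℝ) := by
    filter_upwards [le_floor d hd0] with n hn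
    rwa [hK]
  refine (negligible_degree.or <| negligible_codeg.or <|
    (negligible_many_oddTriples m c ha0 hda hKd hKZ hKY hZY).or <|
    (negligible_many_badPairs he0 hde hKd hKY).or
    (negligible_many_uncovered hb0 (half_pos hd0) hKl)).mono ?_
  filter_upwards [le_floor l hl0, eventually_gt_atTop 0,
    tendsto_natCast_atTop_atTop.eventually_ge_atTop (8 / e)] with n hZl hn hne p h0 h1 hD
  rintro S ⟨f, hf, hfar⟩
  by_contra! hcon
  obtain ⟨c1, c2, c3, c4, c5⟩ := hcon
  have hn0 : (0 : ℝ) < n := by exact_mod_cast hn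
  have hdeg : ∀ v, ((nbr (gr S) v).card : ℝ) ≤ 21 / 20 * (p * n) := fun v => (c1 v).2.le
  have hnp : 0 ≤ p * n := by positivity
  have hodd := c3 (fun v => (hdeg v).trans (by linarith)) (fun u v huv => (c2 u v huv).le) f hf
  rw [← hZ] at hZl
  have hZ0 : (0 : ℝ) < (Z n).card := lt_of_lt_of_le (by positivity) hZl
  obtain ⟨z, -, hzM⟩ := exists_card_badPairs_le (S := S) (m := m) (c n) (oddPairs f (S ∩ star (K n)))
    (hKZ n) (hKY n) (hZY n) (Finset.card_pos.1 (by exact_mod_cast hZ0))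
    (fun i j hij => (hodd i j hij).le) (by positivity)
    (sum_sum_ind_mod_le (c n) fun _ => rfl) c5.le (M := e * n ^ 2) (by
      have t1 : (m : ℝ) ^ 2 * (a * n ^ 3) ≤ (Z n).card * (e / 4 * n ^ 2) := by
        have : (m : ℝ) ^ 2 * (a * n ^ 3) = l / 2 * n * (e / 4 * n ^ 2) := by
          rw [ha]; field_simp
        rw [this]
        gcongr
      have t2 : ((Z n).card : ℝ) * (n * (n / m + 1)) ≤ (Z n).card * (e / 4 * n ^ 2) := by
        refine mul_le_mul_of_nonneg_left ?_ hZ0.le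
        rw [div_le_iff₀ he0] at hm hne
        have h3 : (n : ℝ) / m ≤ e / 8 * n := by
          rw [div_le_iff₀ hm0']; nlinarith
        have h4 : (1 : ℝ) ≤ e / 8 * n := by linarith
        nlinarith
      have t3 : 2 * (n : ℝ) * (b * n ^ 2) ≤ (Z n).card * (e / 4 * n ^ 2) := by
        have : 2 * (n : ℝ) * (b * n ^ 2) = l / 2 * n * (e / 4 * n ^ 2) := by
          rw [hb]; ring
        rw [this]
        gcongr
      have t4 : ((Z n).card : ℝ) * (b * n ^ 2) ≤ (Z n).card * (e / 4 * n ^ 2) := by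
        have : b ≤ e / 4 := by rw [hb]; nlinarith
        gcongr
      linarith)
  have hM := (c4 z f hzM).le
  obtain ⟨g, hg⟩ := hf.exists_defect_le (hKY n) hdeg hM
  have hYc : ((Y n)ᶜ.card : ℝ) ≤ (d + l) * n := by
    have h3 : (Y n)ᶜ.card ≤ (K n).card + (Z n).card := by
      simp only [Y, compl_compl]; exact Finset.card_union_le _ _
    have h4 : ((Z n).card : ℝ) ≤ l * n := by rw [hZ]; exact floor_le l n hl0.le
    have h5 : ((Y n)ᶜ.card : ℝ) ≤ (K n).card + (Z n).card := by exact_mod_cast h3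
    linarith [hKd n]
  -- At most εn/10 vertices lie outside Y, so the total is at most (0.21 + 0.525)ε·n²p < ε·n²p.
  have hlt := (hfar g).trans_le hg
  have h6 := mul_le_mul_of_nonneg_right hYc (show 0 ≤ 21 / 20 * (p * n) by positivity)
  have h7 : (d + l) * n * (21 / 20 * (p * n)) ≤ (ε / 10) * n * (21 / 20 * (p * n)) := by
    gcongr; linarith
  have h8 : 0 ≤ ε * (n ^ 2 * p) := by positivity
  rw [he] at hlt
  nlinarith

end NearCoboundary

/-! ### Assembling the dense range. -/

section DenseRange

open Finset

/-- The theorem in the range `n p² ≥ (5/4) log n`. -/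
theorem negligible_triangleSpace_ne : Negligible fun _ _ S =>
    EveryEdgeInTriangle (gr S) ∧ triangleSpace (gr S) ≠ cycleSpace (gr S) := by
  obtain ⟨κ, hκ⟩ : ∃ κ, κ = Real.exp (-6400) := ⟨_, rfl⟩
  have hκ0 : 0 < κ := hκ ▸ Real.exp_pos _
  have hκ1 : κ ≤ 1 := by rw [hκ, Real.exp_le_one_iff]; norm_num
  -- The distance κ²/360·n²p is β·κr with β = κn/360 and r = np, as the local theorem requires.
  refine (negligible_degree.or <| negligible_codeg.or <| negligible_two_light.or <|
    (negligible_dense hκ.le).or <| (negligible_sparse hκ0).or <| (negligible_bad_cut hκ0 hκ1).or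
    (negligible_far (ε := κ ^ 2 / 360) (by positivity) (by nlinarith))).mono ?_
  filter_upwards [eventually_ge_atTop 400, tendsto_log_natCast.eventually_gt_atTop 0] with
    n hn hlog p h0 h1 hD
  rintro S ⟨hQ, hne⟩
  by_contra! hcon
  obtain ⟨c1, c2, c3, c4, c5, c6, c7⟩ := hcon
  have hn' : (400 : ℝ) ≤ n := by exact_mod_cast hn
  have hn0 : (0 : ℝ) < n := by linarith
  have hD0 : 0 < n * p ^ 2 := by linarith
  have hp0 : 0 < p := by
    rcases h0.eq_or_lt with rfl | h
    · simp at hD0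
    · exact h
  refine hne (triangleSpace_eq_cycleSpace fun f hf => hf.isCoboundary_of_defect_le
    (r := n * p) (D := n * p ^ 2) (θ := 1 / 100) (κ := κ) (β := κ / 360 * n) (by positivity) hD0
    hκ0 hQ ?_ (by norm_num) ?_ ?_ c5 ?_ ?_)
  · intro v u w huv hvw huw
    by_contra! h
    exact absurd (c3 v u w huv hvw huw h.1) (not_lt.2 h.2)
  · intro A hA
    exact (c4 A hA).trans (by linarith)
  -- The complement of A has at least half of the degree, and 19/20·19/40 is just above 9/20; n ≥
  -- 400 covers the difference between n - 1 and n. The second bound reduces to 2|A| - (19/20)·deg ≤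
  -- deg/20.
  · intro v A hA hκA hA2
    obtain ⟨d1, d2⟩ := c1 v
    have hAd : (((nbr (gr S) v) \ A).card : ℝ) = (nbr (gr S) v).card - A.card :=
      Finset.cast_card_sdiff hA
    obtain ⟨e1, e2⟩ := c6 v _ rfl (by nlinarith) (by nlinarith) A hA hκA hA2
    rw [hAd] at e1
    have hA0 : (0 : ℝ) ≤ A.card := Nat.cast_nonneg _
    have hpA : 0 ≤ p * A.card := by positivity
    constructor
    · have h2 : p * A.card * (19 / 40 * (19 / 20 * (p * (n - 1)))) ≤
          p * A.card * (19 / 20 * ((nbr (gr S) v).card - A.card)) := by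
        refine mul_le_mul_of_nonneg_left ?_ hpA
        linarith
      have h3 : p * A.card * (9 / 20 * (p * n)) ≤
          p * A.card * (19 / 40 * (19 / 20 * (p * (n - 1)))) := by
        refine mul_le_mul_of_nonneg_left ?_ hpA
        nlinarith
      linarith
    · have h2 : p * A.card * (2 * A.card - 19 / 20 * (nbr (gr S) v).card) ≤
          p * A.card * (1 / 10 * (p * n)) := by
        refine mul_le_mul_of_nonneg_left ?_ hpA
        linarith
      linarith
  · intro u v huv
    exact (c2 u v huv.ne).le
  · obtain ⟨g, hg⟩ := c7 f hf
    exact ⟨g, hg.trans (le_of_eq (by ring))⟩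

end DenseRange

/-! ### Second moment of the number of edges in no triangle. -/

section SecondMoment

open Finset

variable {n : ℕ} {p : ℝ}

/-- Edges with both ends in `P` are independent of the edges between `P` and its complement. -/
theorem ex_mul_prod_star (P : Finset (Fin n)) {g : Finset (Sym2 (Fin n)) → ℝ}
    {h : Fin n → Finset (Sym2 (Fin n)) → ℝ} (hg : DependsOn g (pairSet (P ×ˢ P)))
    (hdep : ∀ w ∈ Pᶜ, DependsOn (h w) (P.image fun a => s(w, a))) :
    ex p (fun S => g S * ∏ w ∈ Pᶜ, h w S) = ex p g * ∏ w ∈ Pᶜ, ex p (h w) := by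
  rw [ex_mul_of_disjoint hg (B := Pᶜ.biUnion fun w => P.image fun a => s(w, a)),
    ex_prod_star P Pᶜ disjoint_compl_right _ hdep]
  · exact DependsOn.prod fun w hw => (hdep w hw).mono
      (Finset.subset_biUnion_of_mem (fun w => P.image fun a => s(w, a)) hw)
  · rw [Finset.disjoint_left]
    intro e he he'
    obtain ⟨w, hw, he'⟩ := Finset.mem_biUnion.1 he'
    obtain ⟨a, -, rfl⟩ := Finset.mem_image.1 he'
    obtain ⟨b, c, hbc, he⟩ := mem_pairSet.1 he
    have hbc := Finset.mem_product.1 hbc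
    have hw := Finset.mem_compl.1 hw
    rcases Sym2.eq_iff.1 he with ⟨rfl, _⟩ | ⟨_, rfl⟩
    · exact hw hbc.1
    · exact hw hbc.2

/-- The indicator of the event that no vertex of `W` is joined to both `a` and `b`. -/
noncomputable def avoid (W : Finset (Fin n)) (a b : Fin n) (S : Finset (Sym2 (Fin n))) : ℝ :=
  ∏ w ∈ W, (1 - 1 * (ind (s(w, a) ∈ S) * ind (s(w, b) ∈ S)))

/-- The indicator of the event that `ab` is an edge in no triangle. -/
noncomputable def lonely (a b : Fin n) (S : Finset (Sym2 (Fin n))) : ℝ :=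
  ind (s(a, b) ∈ S) * avoid ({a, b} : Finset (Fin n))ᶜ a b S

theorem sum_ind_eq (a : Fin n) : ∑ c, ind (c = a) = 1 := by
  rw [Finset.sum_eq_single a (fun b _ h => ind_false h) fun h => absurd (mem_univ a) h,
    ind_true rfl]

theorem one_sub_ind_mem_unitInterval (P Q : Prop) :
    0 ≤ 1 - 1 * (ind P * ind Q) ∧ 1 - 1 * (ind P * ind Q) ≤ 1 := by
  rcases ind_eq_zero_or_one P with h | h <;> rcases ind_eq_zero_or_one Q with h' | h' <;>
    simp [h, h']

theorem avoid_nonneg (W : Finset (Fin n)) (a b : Fin n) (S : Finset (Sym2 (Fin n))) :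
    0 ≤ avoid W a b S := Finset.prod_nonneg fun _ _ => (one_sub_ind_mem_unitInterval _ _).1

theorem avoid_le_one (W : Finset (Fin n)) (a b : Fin n) (S : Finset (Sym2 (Fin n))) :
    avoid W a b S ≤ 1 := Finset.prod_le_one (fun _ _ => (one_sub_ind_mem_unitInterval _ _).1)
  fun _ _ => (one_sub_ind_mem_unitInterval _ _).2

theorem avoid_anti {W W' : Finset (Fin n)} (h : W ⊆ W') (a b : Fin n)
    (S : Finset (Sym2 (Fin n))) : avoid W' a b S ≤ avoid W a b S := by
  rw [avoid, avoid, ← Finset.prod_sdiff h]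
  exact mul_le_of_le_one_left (avoid_nonneg W a b S) (avoid_le_one (W' \ W) a b S)

theorem avoid_comm (W : Finset (Fin n)) (a b : Fin n) (S : Finset (Sym2 (Fin n))) :
    avoid W a b S = avoid W b a S := by simp only [avoid, mul_comm]

theorem lonely_comm (a b : Fin n) (S : Finset (Sym2 (Fin n))) : lonely a b S = lonely b a S := by
  rw [lonely, lonely, avoid_comm, Finset.pair_comm, Sym2.eq_swap]

theorem lonely_nonneg (a b : Fin n) (S : Finset (Sym2 (Fin n))) : 0 ≤ lonely a b S :=
  mul_nonneg (ind_nonneg _) (avoid_nonneg _ _ _ _)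

theorem lonely_le_one (a b : Fin n) (S : Finset (Sym2 (Fin n))) : lonely a b S ≤ 1 :=
  mul_le_one₀ (ind_le_one _) (avoid_nonneg _ _ _ _) (avoid_le_one _ _ _ _)

theorem lonely_eq_zero {S : Finset (Sym2 (Fin n))} (hQ : EveryEdgeInTriangle (gr S)) {a b : Fin n}
    (hab : a ≠ b) : lonely a b S = 0 := by
  by_cases h : s(a, b) ∈ S
  · obtain ⟨c, h1, h2⟩ := hQ a b (gr_adj.2 ⟨h, hab⟩)
    rw [lonely, avoid, Finset.prod_eq_zero (i := c), mul_zero]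
    · simp [h1.ne', h2.ne]
    · rw [ind_true (gr_adj.1 h2).1, ind_true (gr_adj.1 h1.symm).1]; norm_num
  · rw [lonely, ind_false h, zero_mul]

theorem sym2_ne {w a b : Fin n} (hab : a ≠ b) : s(w, a) ≠ s(w, b) :=
  fun h => hab (Sym2.congr_right.1 h)

theorem dependsOn_avoid_factor {P : Finset (Fin n)} {a b : Fin n} (ha : a ∈ P) (hb : b ∈ P)
    (w : Fin n) : DependsOn (fun S : Finset (Sym2 (Fin n)) =>
      1 - 1 * (ind (s(w, a) ∈ S) * ind (s(w, b) ∈ S))) (P.image fun a => s(w, a)) :=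
  (dependsOn_ind_mem (Finset.mem_image_of_mem _ ha)).comp₂ (fun x y => 1 - 1 * (x * y))
    (dependsOn_ind_mem (Finset.mem_image_of_mem _ hb))

theorem dependsOn_edge {P : Finset (Fin n)} {a b : Fin n} (ha : a ∈ P) (hb : b ∈ P) :
    DependsOn (fun S : Finset (Sym2 (Fin n)) => ind (s(a, b) ∈ S)) (pairSet (P ×ˢ P)) :=
  dependsOn_ind_mem (mem_pairSet_product ha hb)

theorem ex_avoid_factor {w a b : Fin n} (hab : a ≠ b) :
    ex p (fun S : Finset (Sym2 (Fin n)) => 1 - 1 * (ind (s(w, a) ∈ S) * ind (s(w, b) ∈ S))) =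
      1 - p ^ 2 := by
  rw [ex_sub, ex_const, ex_const_mul, ex_ind_mul_ind (sym2_ne hab), one_mul]

theorem ex_lonely {a b : Fin n} (hab : a ≠ b) :
    ex p (lonely a b) = p * (1 - p ^ 2) ^ (n - 2) := by
  have hP : (({a, b} : Finset (Fin n))ᶜ).card = n - 2 := by
    rw [Finset.card_compl, Fintype.card_fin, Finset.card_pair hab]
  have h := ex_mul_prod_star (p := p) {a, b} (dependsOn_edge (a := a) (b := b) (by simp) (by simp))
    (fun w _ => dependsOn_avoid_factor (a := a) (b := b) (by simp) (by simp) w)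
  rw [Finset.prod_congr rfl fun w _ => ex_avoid_factor hab, Finset.prod_const, hP] at h
  refine h.trans ?_
  congr 1
  simpa using ex_prod_mem (p := p) {s(a, b)}

/-- For vertex-disjoint pairs, ignoring apexes among a, b, c, d only increases the expectation; each
remaining w uses disjoint edges for the two pairs, so the events are independent. -/
theorem ex_lonely_mul_lonely_le (h0 : 0 ≤ p) (h1 : p ≤ 1) {a b c d : Fin n} (hab : a ≠ b)
    (hcd : c ≠ d) (hac : a ≠ c) (had : a ≠ d) (hbc : b ≠ c) (hbd : b ≠ d) :
    ex p (fun S => lonely a b S * lonely c d S) ≤ p ^ 2 * ((1 - p ^ 2) ^ 2) ^ (n - 4) := by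
  let P : Finset (Fin n) := {a, b, c, d}
  have hP : Pᶜ.card = n - 4 := by
    rw [Finset.card_compl, Fintype.card_fin]
    congr 1
    simp [P, Finset.card_insert_of_notMem, *]
  have hmem : a ∈ P ∧ b ∈ P ∧ c ∈ P ∧ d ∈ P := by simp [P]
  have h := ex_mul_prod_star (p := p) P
    ((dependsOn_edge hmem.1 hmem.2.1).mul (dependsOn_edge hmem.2.2.1 hmem.2.2.2))
    (fun w _ => (dependsOn_avoid_factor hmem.1 hmem.2.1 w).mul
      (dependsOn_avoid_factor hmem.2.2.1 hmem.2.2.2 w))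
  have hw : ∀ w ∈ Pᶜ, ex p (fun S : Finset (Sym2 (Fin n)) =>
      (1 - 1 * (ind (s(w, a) ∈ S) * ind (s(w, b) ∈ S))) *
      (1 - 1 * (ind (s(w, c) ∈ S) * ind (s(w, d) ∈ S)))) = (1 - p ^ 2) ^ 2 := by
    intro w hw
    rw [ex_mul_of_disjoint (dependsOn_avoid_factor (P := {a, b}) (a := a) (b := b) (by simp)
      (by simp) w) (dependsOn_avoid_factor (P := {c, d}) (a := c) (b := d) (by simp) (by simp) w),
      ex_avoid_factor hab, ex_avoid_factor hcd, ← pow_two]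
    rw [Finset.disjoint_left]
    intro e he he'
    obtain ⟨x, hx, rfl⟩ := Finset.mem_image.1 he
    obtain ⟨y, hy, he⟩ := Finset.mem_image.1 he'
    have := Sym2.congr_right.1 he
    simp only [mem_insert, mem_singleton] at hx hy
    subst this
    rcases hx with rfl | rfl <;> rcases hy with h | h <;> exact absurd h (by assumption)
  rw [Finset.prod_congr rfl hw, Finset.prod_const, hP, ex_ind_mul_ind] at h
  · refine le_trans (ex_mono h0 h1 fun S => ?_) h.le
    have e1 := avoid_anti (W := Pᶜ) (W' := ({a, b} : Finset (Fin n))ᶜ)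
      (Finset.compl_subset_compl.2 (by intro y; simp [P]; tauto)) a b S
    have e2 := avoid_anti (W := Pᶜ) (W' := ({c, d} : Finset (Fin n))ᶜ)
      (Finset.compl_subset_compl.2 (by intro y; simp [P]; tauto)) c d S
    have e3 := mul_le_mul e1 e2 (avoid_nonneg _ _ _ _) (avoid_nonneg _ _ _ _)
    have e4 := mul_le_mul_of_nonneg_left e3
      (mul_nonneg (ind_nonneg (s(a, b) ∈ S)) (ind_nonneg (s(c, d) ∈ S)))
    rw [Finset.prod_mul_distrib]
    refine le_trans (le_of_eq ?_) e4
    rw [lonely, lonely]; ring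
  · intro h
    rcases Sym2.eq_iff.1 h with ⟨h, _⟩ | ⟨h, _⟩
    · exact hac h
    · exact had h

/-- For two pairs sharing v the events at an apex w are correlated through wv; this is
`ex_two_edges_cherries` with c = 1. -/
theorem ex_lonely_mul_lonely_cherry_le (h0 : 0 ≤ p) (h1 : p ≤ 1) {v u x : Fin n} (huv : u ≠ v)
    (hxv : x ≠ v) (hux : u ≠ x) :
    ex p (fun S => lonely v u S * lonely v x S) ≤ p ^ 2 * (1 - 2 * p ^ 2 + p ^ 3) ^ (n - 3) := by
  have h := ex_two_edges_cherries (p := p) huv hxv hux 1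
  refine le_trans (ex_mono h0 h1 fun S => ?_) (h.le.trans_eq (by ring))
  have e1 := avoid_anti (W := ({u, v, x} : Finset (Fin n))ᶜ) (W' := ({v, u} : Finset (Fin n))ᶜ)
    (Finset.compl_subset_compl.2 (by intro y; simp; tauto)) u v S
  have e2 := avoid_anti (W := ({u, v, x} : Finset (Fin n))ᶜ) (W' := ({v, x} : Finset (Fin n))ᶜ)
    (Finset.compl_subset_compl.2 (by intro y; simp; tauto)) x v S
  have e3 := mul_le_mul e1 e2 (avoid_nonneg _ _ _ _) (avoid_nonneg _ _ _ _)
  have e4 := mul_le_mul_of_nonneg_left e3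
    (mul_nonneg (ind_nonneg (s(v, u) ∈ S)) (ind_nonneg (s(v, x) ∈ S)))
  rw [Finset.prod_mul_distrib]
  refine le_trans (le_of_eq ?_) e4
  rw [lonely, lonely, avoid_comm _ v u, avoid_comm _ v x]; ring

/-- One bound covers disjoint, intersecting and equal pairs; the indicators record how often each
overlap occurs, so the double sum can be taken termwise. -/
theorem ex_lonely_mul_lonely_le_add (h0 : 0 ≤ p) (h1 : p ≤ 1) {a b c d : Fin n} (hab : a ≠ b)
    (hcd : c ≠ d) :
    ex p (fun S => lonely a b S * lonely c d S) ≤ p ^ 2 * ((1 - p ^ 2) ^ 2) ^ (n - 4) +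
      p ^ 2 * (1 - 2 * p ^ 2 + p ^ 3) ^ (n - 3) *
        (ind (c = a) + ind (d = a) + ind (c = b) + ind (d = b)) +
      p * (1 - p ^ 2) ^ (n - 2) * (ind (c = a ∧ d = b) + ind (c = b ∧ d = a)) := by
  have q0 : 0 ≤ 1 - p ^ 2 := by nlinarith
  have n1 : 0 ≤ p ^ 2 * ((1 - p ^ 2) ^ 2) ^ (n - 4) := by positivity
  have n2 : 0 ≤ p ^ 2 * (1 - 2 * p ^ 2 + p ^ 3) ^ (n - 3) := by
    have : 1 - 2 * p ^ 2 + p ^ 3 = (1 - p) + p * (1 - p) ^ 2 := by ring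
    have : 0 ≤ 1 - 2 * p ^ 2 + p ^ 3 := by
      rw [this]; exact add_nonneg (by linarith) (by positivity)
    positivity
  have n3 : 0 ≤ p * (1 - p ^ 2) ^ (n - 2) := by positivity
  have i1 := ind_nonneg (c = a)
  have i2 := ind_nonneg (d = a)
  have i3 := ind_nonneg (c = b)
  have i4 := ind_nonneg (d = b)
  have i5 := ind_nonneg (c = a ∧ d = b)
  have i6 := ind_nonneg (c = b ∧ d = a)
  have same : ex p (fun S => lonely a b S * lonely a b S) ≤ p * (1 - p ^ 2) ^ (n - 2) := by
    rw [← ex_lonely hab]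
    exact ex_mono h0 h1 fun S => mul_le_of_le_one_left (lonely_nonneg _ _ _) (lonely_le_one _ _ _)
  have cherry : ∀ {x y z : Fin n}, y ≠ x → z ≠ x → y ≠ z →
      ex p (fun S => lonely x y S * lonely x z S) ≤
        p ^ 2 * (1 - 2 * p ^ 2 + p ^ 3) ^ (n - 3) := ex_lonely_mul_lonely_cherry_le h0 h1
  have distinct := ex_lonely_mul_lonely_le h0 h1 hab hcd
  generalize p ^ 2 * ((1 - p ^ 2) ^ 2) ^ (n - 4) = T1 at *
  generalize p ^ 2 * (1 - 2 * p ^ 2 + p ^ 3) ^ (n - 3) = T2 at *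
  generalize p * (1 - p ^ 2) ^ (n - 2) = T3 at *
  have n36 := mul_nonneg n3 (add_nonneg i5 i6)
  have n25 := mul_nonneg n2 (add_nonneg (add_nonneg (add_nonneg i1 i2) i3) i4)
  have use_same : 1 ≤ ind (c = a ∧ d = b) + ind (c = b ∧ d = a) →
      ex p (fun S => lonely a b S * lonely c d S) ≤ T3 →
      ex p (fun S => lonely a b S * lonely c d S) ≤ T1 +
        T2 * (ind (c = a) + ind (d = a) + ind (c = b) + ind (d = b)) +
        T3 * (ind (c = a ∧ d = b) + ind (c = b ∧ d = a)) := fun h h' => by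
    have := mul_le_mul_of_nonneg_left h n3
    linarith
  have use_cherry : 1 ≤ ind (c = a) + ind (d = a) + ind (c = b) + ind (d = b) →
      ex p (fun S => lonely a b S * lonely c d S) ≤ T2 →
      ex p (fun S => lonely a b S * lonely c d S) ≤ T1 +
        T2 * (ind (c = a) + ind (d = a) + ind (c = b) + ind (d = b)) +
        T3 * (ind (c = a ∧ d = b) + ind (c = b ∧ d = a)) := fun h h' => by
    have := mul_le_mul_of_nonneg_left h n2
    linarith
  by_cases h5 : c = a ∧ d = b
  · refine use_same (by rw [ind_true h5]; linarith) ?_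
    obtain ⟨rfl, rfl⟩ := h5
    exact same
  by_cases h6 : c = b ∧ d = a
  · refine use_same (by rw [ind_true h6]; linarith) ?_
    obtain ⟨rfl, rfl⟩ := h6
    simpa only [lonely_comm c d] using same
  by_cases hca : c = a
  · refine use_cherry (by rw [ind_true hca]; linarith) ?_
    subst hca
    exact cherry hab.symm hcd.symm fun h => h5 ⟨rfl, h.symm⟩
  by_cases hda : d = a
  · refine use_cherry (by rw [ind_true hda]; linarith) ?_
    subst hda
    simp only [lonely_comm c d]
    exact cherry hab.symm hcd fun h => h6 ⟨h.symm, rfl⟩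
  by_cases hcb : c = b
  · refine use_cherry (by rw [ind_true hcb]; linarith) ?_
    subst hcb
    simp only [lonely_comm a c]
    exact cherry hab hcd.symm fun h => hda h.symm
  by_cases hdb : d = b
  · refine use_cherry (by rw [ind_true hdb]; linarith) ?_
    subst hdb
    simp only [lonely_comm a d, lonely_comm c d]
    exact cherry hab hcd fun h => hca h.symm
  have := distinct (Ne.symm hca) (Ne.symm hda) (Ne.symm hcb) (Ne.symm hdb)
  linarith

/-- If the expected number of edges in no triangle is large then some edge is in no triangle. -/
theorem pr_everyEdgeInTriangle_le (h0 : 0 ≤ p) (h1 : p ≤ 1) {N μ : ℝ} (hN : N = n * (n - 1))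
    (hμ : μ = p * (1 - p ^ 2) ^ (n - 2)) (hNμ : 0 < N * μ) :
    pr p (fun S : Finset (Sym2 (Fin n)) => EveryEdgeInTriangle (gr S)) ≤
      p ^ 2 * ((1 - p ^ 2) ^ 2) ^ (n - 4) / μ ^ 2 - 1 +
        4 * n * (p ^ 2 * (1 - 2 * p ^ 2 + p ^ 3) ^ (n - 3)) / (N * μ ^ 2) + 2 / (N * μ) := by
  let s : Finset (Fin n × Fin n) := (univ : Finset (Fin n)).offDiag
  have hs : (s.card : ℝ) = N := by
    rw [hN, Finset.offDiag_card, Finset.card_univ, Fintype.card_fin, Nat.cast_sub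
      (Nat.le_mul_self n)]
    push_cast
    ring
  let X : Finset (Sym2 (Fin n)) → ℝ := fun S => ∑ e ∈ s, lonely e.1 e.2 S
  have hX : ex p X = N * μ := by
    rw [ex_sum, Finset.sum_congr rfl fun e he => ex_lonely (Finset.mem_offDiag.1 he).2.2,
      Finset.sum_const, nsmul_eq_mul, hs, hμ]
  have q0 : 0 ≤ 1 - p ^ 2 := by nlinarith
  have n2 : 0 ≤ p ^ 2 * (1 - 2 * p ^ 2 + p ^ 3) ^ (n - 3) := by
    have : 1 - 2 * p ^ 2 + p ^ 3 = (1 - p) + p * (1 - p) ^ 2 := by ring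
    have : 0 ≤ 1 - 2 * p ^ 2 + p ^ 3 := by
      rw [this]; exact add_nonneg (by linarith) (by positivity)
    positivity
  have n3 : 0 ≤ μ := by rw [hμ]; positivity
  have hinner : ∀ e ∈ s, ∑ e' ∈ s, ex p (fun S => lonely e.1 e.2 S * lonely e'.1 e'.2 S) ≤
      N * (p ^ 2 * ((1 - p ^ 2) ^ 2) ^ (n - 4)) +
        4 * n * (p ^ 2 * (1 - 2 * p ^ 2 + p ^ 3) ^ (n - 3)) + 2 * μ := by
    rintro ⟨a, b⟩ he
    have hab : a ≠ b := (Finset.mem_offDiag.1 he).2.2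
    have u1 : ∀ h : Fin n × Fin n → ℝ, (∀ e, 0 ≤ h e) → ∑ e ∈ s, h e ≤ ∑ c, ∑ d, h (c, d) := by
      intro h hh
      rw [← Fintype.sum_prod_type]
      exact Finset.sum_le_sum_of_subset_of_nonneg (subset_univ _) fun _ _ _ => hh _
    have c1 : ∑ e' ∈ s, (ind (e'.1 = a) + ind (e'.2 = a) + ind (e'.1 = b) + ind (e'.2 = b)) ≤
        4 * n := by
      refine (u1 _ fun e => add_nonneg (add_nonneg (add_nonneg (ind_nonneg _) (ind_nonneg _))
        (ind_nonneg _)) (ind_nonneg _)).trans (le_of_eq ?_)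
      simp only [Finset.sum_add_distrib, sum_ind_eq, Finset.sum_const, Finset.card_univ,
        Fintype.card_fin, nsmul_eq_mul, ← Finset.mul_sum]
      ring
    have c2 : ∑ e' ∈ s, (ind (e'.1 = a ∧ e'.2 = b) + ind (e'.1 = b ∧ e'.2 = a)) ≤ 2 := by
      refine (u1 _ fun e => add_nonneg (ind_nonneg _) (ind_nonneg _)).trans (le_of_eq ?_)
      simp only [Finset.sum_add_distrib, ind_and, ← Finset.mul_sum, sum_ind_eq,
        mul_one]
      norm_num
    calc _ ≤ ∑ e' ∈ s, (p ^ 2 * ((1 - p ^ 2) ^ 2) ^ (n - 4) +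
          p ^ 2 * (1 - 2 * p ^ 2 + p ^ 3) ^ (n - 3) *
            (ind (e'.1 = a) + ind (e'.2 = a) + ind (e'.1 = b) + ind (e'.2 = b)) +
          μ * (ind (e'.1 = a ∧ e'.2 = b) + ind (e'.1 = b ∧ e'.2 = a))) :=
          Finset.sum_le_sum fun e' he' => by
            rw [hμ]
            exact ex_lonely_mul_lonely_le_add h0 h1 hab (Finset.mem_offDiag.1 he').2.2
      _ ≤ _ := by
          rw [Finset.sum_add_distrib, Finset.sum_add_distrib, Finset.sum_const, nsmul_eq_mul, hs,
            ← Finset.mul_sum, ← Finset.mul_sum]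
          have := mul_le_mul_of_nonneg_left c1 n2
          have := mul_le_mul_of_nonneg_left c2 n3
          linarith
  have hX2 : ex p (fun S => X S * X S) ≤ N * (N * (p ^ 2 * ((1 - p ^ 2) ^ 2) ^ (n - 4)) +
        4 * n * (p ^ 2 * (1 - 2 * p ^ 2 + p ^ 3) ^ (n - 3)) + 2 * μ) := by
    have e1 : ∀ S, X S * X S = ∑ e ∈ s, ∑ e' ∈ s, lonely e.1 e.2 S * lonely e'.1 e'.2 S :=
      fun S => Finset.sum_mul_sum _ _ _ _
    simp only [e1]
    rw [ex_sum]
    simp only [ex_sum]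
    refine (Finset.sum_le_sum hinner).trans_eq ?_
    rw [Finset.sum_const, nsmul_eq_mul, hs]
  set m := N * μ with hm
  -- Chebyshev's inequality: under Q the count X vanishes, so (X/m - 1)² = 1.
  have hcheb : pr p (fun S : Finset (Sym2 (Fin n)) => EveryEdgeInTriangle (gr S)) ≤
      ex p (fun S => (X S * X S) * (1 / m ^ 2) - X S * (2 / m) + 1) := by
    refine pr_le_ex h0 h1 (fun S => ?_) fun S hS => ?_
    · have : X S * X S * (1 / m ^ 2) - X S * (2 / m) + 1 = (X S / m - 1) ^ 2 := by
        field_simp; ring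
      rw [this]; positivity
    · have : X S = 0 := Finset.sum_eq_zero fun e he =>
        lonely_eq_zero hS (Finset.mem_offDiag.1 he).2.2
      simp [this]
  rw [ex_add, ex_sub, ex_mul_const, ex_mul_const, ex_const, hX] at hcheb
  have h3 := mul_le_mul_of_nonneg_right hX2 (show 0 ≤ 1 / m ^ 2 by positivity)
  have hN0 : N ≠ 0 := left_ne_zero_of_mul hNμ.ne'
  have hμ0 : μ ≠ 0 := right_ne_zero_of_mul hNμ.ne'
  have e2 : m * (2 / m) = 2 := by field_simp
  rw [e2] at hcheb
  refine hcheb.trans ((add_le_add_left (sub_le_sub_right h3 _) _).trans (le_of_eq ?_))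
  rw [hm]
  generalize p ^ 2 * ((1 - p ^ 2) ^ 2) ^ (n - 4) = T1
  generalize p ^ 2 * (1 - 2 * p ^ 2 + p ^ 3) ^ (n - 3) = T2
  field_simp
  ring

end SecondMoment

/-! ### The sparse range and the combination of all ranges. -/

section SparseRange

open Finset

variable {n : ℕ} {p : ℝ}

theorem exists_adj_of_triangleSpace_ne {V : Type*} [Fintype V] {G : SimpleGraph V}
    (h : triangleSpace G ≠ cycleSpace G) : ∃ a b, G.Adj a b := by
  by_contra! hG
  exact h (triangleSpace_eq_cycleSpace fun f _ => ⟨0, fun a b hab => absurd hab (hG a b)⟩)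

/-- If the two spaces differ there is an edge, and Q puts it in a triangle; the bound counts ordered
triples. -/
theorem pr_triangle_le (h0 : 0 ≤ p) (h1 : p ≤ 1) :
    pr p (fun S : Finset (Sym2 (Fin n)) => EveryEdgeInTriangle (gr S) ∧
      triangleSpace (gr S) ≠ cycleSpace (gr S)) ≤ (n : ℝ) ^ 3 * p ^ 3 := by
  calc _ ≤ pr p (fun S : Finset (Sym2 (Fin n)) => ∃ y ∈ (univ : Finset (Fin n × Fin n × Fin n)),
        (y.1 ≠ y.2.1 ∧ y.2.1 ≠ y.2.2 ∧ y.2.2 ≠ y.1) ∧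
        ((s(y.1, y.2.1) ∈ S ∧ s(y.2.1, y.2.2) ∈ S) ∧ s(y.2.2, y.1) ∈ S)) := by
        refine pr_mono h0 h1 ?_
        rintro S ⟨hQ, hne⟩
        obtain ⟨a, b, hab⟩ := exists_adj_of_triangleSpace_ne hne
        obtain ⟨c, hbc, hca⟩ := hQ a b hab
        rw [gr_adj] at hab hbc hca
        exact ⟨(a, b, c), mem_univ _, ⟨hab.2, hbc.2, hca.2⟩, ⟨hab.1, hbc.1⟩, hca.1⟩
    _ ≤ ∑ y : Fin n × Fin n × Fin n, p ^ 3 := by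
        refine (pr_exists_le h0 h1 _ _).trans <| Finset.sum_le_sum ?_
        rintro ⟨a, b, c⟩ _
        by_cases h : a ≠ b ∧ b ≠ c ∧ c ≠ a
        · refine (pr_mono h0 h1 fun S hS => hS.2).trans (le_of_eq ?_)
          have h2 : ∀ {a b c : Fin n}, b ≠ c → c ≠ a → s(a, b) ≠ s(b, c) := by
            intro a b c h1 h2 h
            rcases Sym2.eq_iff.1 h with ⟨_, h⟩ | ⟨h, _⟩
            · exact h1 h
            · exact h2 h.symm
          rw [← ex_ind_mul_ind_mul_ind (p := p) (h2 h.2.1 h.2.2) (h2 h.1 h.2.1).symm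
            (h2 h.2.2 h.1)]
          simp only [pr, ind_and]
        · refine (pr_mono h0 h1 (Q := fun _ => False) fun S hS => h hS.1).trans ?_
          have : pr p (fun _ : Finset (Sym2 (Fin n)) => False) = 0 := by simp [pr, ind]
          rw [this]
          positivity
    _ = _ := by
        rw [Finset.sum_const, Finset.card_univ, nsmul_eq_mul]
        simp only [Fintype.card_prod, Fintype.card_fin]
        push_cast
        ring

theorem le_expected_lonely (hn : 2 ≤ n) (h0 : 0 ≤ p) (hp : p ^ 2 ≤ 1 / 400)
    (hD : n * p ^ 2 ≤ 5 / 4 * Real.log n) (hlow : Real.exp (-(3 / 2 * Real.log n)) ≤ p) :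
    1 / 2 * Real.exp (1 / 8 * Real.log n - 2) ≤ n * (n - 1) * (p * (1 - p ^ 2) ^ (n - 2)) := by
  have hn0 : (0 : ℝ) < n := by exact_mod_cast (by omega : 0 < n)
  have hn2 : (2 : ℝ) ≤ n := by exact_mod_cast hn
  have hL0 : 0 ≤ Real.log n := Real.log_natCast_nonneg n
  have hexp : Real.exp (Real.log n) = n := Real.exp_log hn0
  have hx0 : 0 ≤ p ^ 2 := by positivity
  have hq : Real.exp (-(21 / 20 * p ^ 2)) ≤ 1 - p ^ 2 := by
    have h2 := Real.add_one_le_exp (21 / 20 * p ^ 2)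
    rw [Real.exp_neg, inv_le_comm₀ (Real.exp_pos _) (by linarith)]
    refine le_trans ?_ h2
    rw [inv_le_iff_one_le_mul₀ (by linarith)]
    nlinarith
  have hqn : Real.exp (-(21 / 20 * (n * p ^ 2))) ≤ (1 - p ^ 2) ^ (n - 2) := by
    calc _ = Real.exp (-(21 / 20 * p ^ 2)) ^ n := by rw [← Real.exp_nat_mul]; ring_nf
      _ ≤ (1 - p ^ 2) ^ n := by gcongr
      _ ≤ _ := pow_le_pow_of_le_one (by linarith) (by linarith) (by omega)
  have hN : 1 / 2 * Real.exp (2 * Real.log n) ≤ n * (n - 1) := by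
    have : Real.exp (2 * Real.log n) = n * n := by
      rw [two_mul, Real.exp_add, hexp]
    rw [this]; nlinarith
  obtain ⟨t, ht, hsum⟩ : ∃ t, Real.exp t ≤ p ∧
      1 / 8 * Real.log n - 2 ≤ 2 * Real.log n + (t + -(21 / 20 * (n * p ^ 2))) := by
    -- If np² ≤ 1 the avoidance factor is bounded below and p ≥ n^(-3/2) leaves n^(1/2). Otherwise p
    -- ≥ n^(-1/2), and the exponent is at least 3/2 - (21/20)(5/4) = 3/16 > 1/8.
    rcases le_total (n * p ^ 2) 1 with h | h
    · exact ⟨_, hlow, by linarith⟩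
    · refine ⟨-(1 / 2 * Real.log n), ?_, by linarith⟩
      rw [← pow_le_pow_iff_left₀ (Real.exp_pos _).le h0 two_ne_zero, ← Real.exp_nat_mul]
      have e1 : ((2 : ℕ) : ℝ) * -(1 / 2 * Real.log n) = -Real.log n := by push_cast; ring
      rw [e1, Real.exp_neg, hexp, inv_le_iff_one_le_mul₀ hn0]
      linarith
  calc _ ≤ 1 / 2 * Real.exp (2 * Real.log n + (t + -(21 / 20 * (n * p ^ 2)))) := by gcongr
    _ = 1 / 2 * Real.exp (2 * Real.log n) * (Real.exp t * Real.exp (-(21 / 20 * (n * p ^ 2)))) := by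
        rw [Real.exp_add, Real.exp_add]; ring
    _ ≤ _ := mul_le_mul hN (mul_le_mul ht hqn (Real.exp_pos _).le h0) (by positivity)
        (mul_nonneg hn0.le (by linarith))

theorem tendsto_sparse_bound : Tendsto (fun n : ℕ => (1 / (1 - 1 / √(n : ℝ)) ^ 4 - 1) +
    16 * (1 / √(n : ℝ)) + 4 * Real.exp 2 * Real.exp (-(1 / 8 * Real.log n))) atTop (𝓝 0) := by
  have h1 : Tendsto (fun n : ℕ => 1 / √(n : ℝ)) atTop (𝓝 0) := by
    simpa only [one_div, Function.comp_def] using tendsto_inv_atTop_zero.comp tendsto_sqrt_natCast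
  have h2 : Tendsto (fun n : ℕ => 1 / (1 - 1 / √(n : ℝ)) ^ 4 - 1) atTop (𝓝 (1 / (1 - 0) ^ 4 - 1)) :=
    ((tendsto_const_nhds.div ((h1.const_sub 1).pow 4) (by norm_num))).sub_const 1
  have h3 := (tendsto_exp_neg_log (c := 1 / 8) (by norm_num)).const_mul (4 * Real.exp 2)
  have h4 := (h2.add (h1.const_mul 16)).add h3
  simpa using h4

/-- Below the range of `negligible_triangleSpace_ne`, either there are edges in no triangle, or
there are no triangles. -/
theorem eventually_pr_everyEdgeInTriangle_le : ∀ᶠ n : ℕ in atTop, ∀ p : ℝ, 0 ≤ p →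
    n * p ^ 2 ≤ 5 / 4 * Real.log n → Real.exp (-(3 / 2 * Real.log n)) ≤ p →
    pr p (fun S : Finset (Sym2 (Fin n)) => EveryEdgeInTriangle (gr S)) ≤
      (1 / (1 - 1 / √(n : ℝ)) ^ 4 - 1) + 16 * (1 / √(n : ℝ)) +
        4 * Real.exp 2 * Real.exp (-(1 / 8 * Real.log n)) := by
  filter_upwards [eventually_ge_atTop 4, tendsto_sqrt_natCast.eventually_ge_atTop 400,
    eventually_log_le_sqrt (c := 4 / 5) (by norm_num)] with n hn hs400 hlog p h0 hD hlow
  have hn4 : (4 : ℝ) ≤ n := by exact_mod_cast hn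
  have hn0 : (0 : ℝ) < n := by linarith
  have hss : √(n : ℝ) * √(n : ℝ) = n := Real.mul_self_sqrt hn0.le
  have hL0 : 0 ≤ Real.log n := Real.log_natCast_nonneg n
  generalize hr : √(n : ℝ) = r at *
  have hr0 : 0 < r := by linarith
  have hx : p ^ 2 ≤ 1 / r := by
    rw [le_div_iff₀ hr0]
    have : n * p ^ 2 ≤ r := by linarith
    rw [← hss] at this
    nlinarith
  have hr400 : 1 / r ≤ 1 / 400 := one_div_le_one_div_of_le (by norm_num) hs400
  have hx400 : p ^ 2 ≤ 1 / 400 := hx.trans hr400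
  have hp20 : p ≤ 1 / 20 := by
    rw [← pow_le_pow_iff_left₀ h0 (by norm_num) two_ne_zero]
    exact hx400.trans (by norm_num)
  have hp0 : 0 < p := (Real.exp_pos _).trans_le hlow
  have hq0 : 0 < 1 - p ^ 2 := by linarith
  have hbig := le_expected_lonely (by omega) h0 hx400 hD hlow
  have hpos : (0 : ℝ) < n * (n - 1) * (p * (1 - p ^ 2) ^ (n - 2)) :=
    lt_of_lt_of_le (by positivity) hbig
  refine (pr_everyEdgeInTriangle_le h0 (by linarith) rfl rfl hpos).trans ?_
  refine add_le_add (add_le_add (sub_le_sub_right ?_ 1) ?_) ?_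
  · have e1 : p ^ 2 * ((1 - p ^ 2) ^ 2) ^ (n - 4) / (p * (1 - p ^ 2) ^ (n - 2)) ^ 2 =
        1 / (1 - p ^ 2) ^ 4 := by
      obtain ⟨k, rfl⟩ := Nat.exists_eq_add_of_le hn
      rw [show 4 + k - 4 = k by omega, show 4 + k - 2 = k + 2 by omega, ← pow_mul]
      field_simp
      rw [← pow_add, ← pow_mul]
      congr 1
      ring
    rw [e1]
    have : 0 < 1 - 1 / r := by linarith
    refine one_div_le_one_div_of_le (by positivity) ?_
    gcongr
  -- The correlation of intersecting pairs costs a factor exp(2np³) ≤ √n, because np² ≤ (5/4) log n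
  -- and p ≤ 1/20. Such pairs are a fraction of order 1/n of all, so their contribution is of order
  -- 1/√n.
  · have hcherry : (1 - 2 * p ^ 2 + p ^ 3) ^ (n - 3) ≤ r * ((1 - p ^ 2) ^ 2) ^ (n - 3) := by
      have h2 : 1 - 2 * p ^ 2 + p ^ 3 ≤ (1 - p ^ 2) ^ 2 * Real.exp (2 * p ^ 3) := by
        have h3 := mul_le_mul_of_nonneg_left (Real.add_one_le_exp (2 * p ^ 3)) (sq_nonneg (1 - p ^ 2))
        refine le_trans ?_ h3
        have : 0 ≤ p ^ 3 * (1 + p - 4 * p ^ 2 + 2 * p ^ 4) := by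
          refine mul_nonneg (by positivity) ?_
          have : 0 ≤ p ^ 4 := by positivity
          linarith
        nlinarith
      have hnn : 0 ≤ 1 - 2 * p ^ 2 + p ^ 3 := by
        have : 0 ≤ p ^ 3 := by positivity
        linarith
      have h4 : Real.exp (2 * p ^ 3) ^ (n - 3) ≤ r := by
        rw [← Real.exp_nat_mul]
        have h5 : r = Real.exp (1 / 2 * Real.log n) := by
          rw [← hr, Real.sqrt_eq_rpow, Real.rpow_def_of_pos hn0, mul_comm]
        rw [h5]
        apply Real.exp_le_exp.2
        have h6 : ((n - 3 : ℕ) : ℝ) ≤ n := Nat.cast_le.2 (Nat.sub_le _ _)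
        have h7 : ((n - 3 : ℕ) : ℝ) * (2 * p ^ 3) ≤ n * (2 * p ^ 3) := by gcongr
        have h8 : p * (n * p ^ 2) ≤ 1 / 20 * (n * p ^ 2) := by gcongr
        linarith
      refine (pow_le_pow_left₀ hnn h2 _).trans ?_
      rw [mul_pow, mul_comm]
      gcongr
    have e2 : 4 * n * (p ^ 2 * (r * ((1 - p ^ 2) ^ 2) ^ (n - 3))) /
        (n * (n - 1) * (p * (1 - p ^ 2) ^ (n - 2)) ^ 2) = 4 * r / ((n - 1) * (1 - p ^ 2) ^ 2) := by
      have : (n : ℝ) - 1 ≠ 0 := by linarith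
      have e3 : (1 - p ^ 2) ^ (n - 2) = (1 - p ^ 2) ^ (n - 3) * (1 - p ^ 2) := by
        rw [← pow_succ]; congr 1; omega
      rw [e3, ← pow_mul, mul_comm 2, pow_mul]
      field_simp
    have hd : (0 : ℝ) < n * (n - 1) * (p * (1 - p ^ 2) ^ (n - 2)) ^ 2 := by
      have : (0 : ℝ) < n - 1 := by linarith
      positivity
    calc _ ≤ 4 * n * (p ^ 2 * (r * ((1 - p ^ 2) ^ 2) ^ (n - 3))) /
        (n * (n - 1) * (p * (1 - p ^ 2) ^ (n - 2)) ^ 2) := by gcongr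
      _ ≤ _ := by
          rw [e2, div_le_iff₀ (by have : (0 : ℝ) < n - 1 := by linarith
                                  positivity)]
          have h3 : (n : ℝ) / 4 ≤ (n - 1) * (1 - p ^ 2) ^ 2 := by
            have : (1 / 2 : ℝ) ≤ (1 - p ^ 2) ^ 2 := by nlinarith
            nlinarith
          have h4 := mul_le_mul_of_nonneg_left h3 (show 0 ≤ 16 * (1 / r) by positivity)
          refine le_trans (le_of_eq ?_) h4
          rw [← hss]
          field_simp
          norm_num
  · rw [div_le_iff₀ hpos]
    have h2 := mul_le_mul_of_nonneg_left hbig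
      (show 0 ≤ 4 * Real.exp 2 * Real.exp (-(1 / 8 * Real.log n)) by positivity)
    refine le_trans (le_of_eq ?_) h2
    have : Real.exp 2 * Real.exp (-(1 / 8 * Real.log n)) * Real.exp (1 / 8 * Real.log n - 2) = 1 := by
      rw [← Real.exp_add, ← Real.exp_add, ← Real.exp_zero]; congr 1; ring
    linear_combination (-2 : ℝ) * this

/-- Three ranges of p, with the last cut at n^(-3/2): there the triangle bound n³p³ is already at
most n^(-3/2). -/
theorem eventually_pr_le {ε : ℝ} (hε : 0 < ε) : ∀ᶠ n : ℕ in atTop, ∀ p : ℝ, 0 ≤ p → p ≤ 1 →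
    pr p (fun S : Finset (Sym2 (Fin n)) => EveryEdgeInTriangle (gr S) ∧
      triangleSpace (gr S) ≠ cycleSpace (gr S)) ≤ ε := by
  filter_upwards [negligible_triangleSpace_ne ε hε, eventually_pr_everyEdgeInTriangle_le,
    tendsto_sparse_bound.eventually (ge_mem_nhds hε), eventually_gt_atTop 0,
    (tendsto_exp_neg_log (c := 3 / 2) (by norm_num)).eventually (ge_mem_nhds hε)] with
    n hdense hmid hb hn hb' p h0 h1
  rcases le_total (5 / 4 * Real.log n) (n * p ^ 2) with hD | hD
  · exact hdense p h0 h1 hD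
  rcases le_total (Real.exp (-(3 / 2 * Real.log n))) p with hlow | hlow
  · exact (pr_mono h0 h1 fun S hS => hS.1).trans ((hmid p h0 hD hlow).trans hb)
  · refine (pr_triangle_le h0 h1).trans (le_trans ?_ hb')
    have hn0 : (0 : ℝ) < n := by exact_mod_cast hn
    calc (n : ℝ) ^ 3 * p ^ 3 ≤ n ^ 3 * Real.exp (-(3 / 2 * Real.log n)) ^ 3 := by gcongr
      _ = Real.exp (Real.log n) ^ 3 * Real.exp (-(3 / 2 * Real.log n)) ^ 3 := by
          rw [Real.exp_log hn0]
      _ = _ := by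
          rw [← Real.exp_nat_mul, ← Real.exp_nat_mul, ← Real.exp_add]; congr 1; push_cast; ring

end SparseRange

end TriangleSpace

theorem theorem1p3 :
    ∃ M : ℕ → ℝ,
      (∀ n : ℕ, IsGreatest
        (Set.range fun p : I =>
          (SimpleGraph.binomialRandom (Fin n) p).real
            {G : SimpleGraph (Fin n) | TriangleSpace.EveryEdgeInTriangle G ∧
              TriangleSpace.triangleSpace G ≠ TriangleSpace.cycleSpace G})
        (M n)) ∧
      Tendsto M atTop (𝓝 0) := by
  have h := fun n : ℕ => TriangleSpace.exists_isGreatest_pr fun S : Finset (Sym2 (Fin n)) =>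
    TriangleSpace.EveryEdgeInTriangle (TriangleSpace.gr S) ∧
      TriangleSpace.triangleSpace (TriangleSpace.gr S) ≠
        TriangleSpace.cycleSpace (TriangleSpace.gr S)
  choose M hM using h
  refine ⟨M, fun n => ?_, ?_⟩
  · simp only [TriangleSpace.binomialRandom_real]
    exact hM n
  · rw [Metric.tendsto_atTop']
    intro ε hε
    obtain ⟨N, hN⟩ := eventually_atTop.1 (TriangleSpace.eventually_pr_le (half_pos hε))
    refine ⟨N, fun n hn => ?_⟩
    -- The maximum is attained at some p, so the uniform bound applies there.
    obtain ⟨p, hp⟩ := (hM n).1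
    have h1 := hN n hn.le p p.2.1 p.2.2
    have h2 := TriangleSpace.pr_nonneg (p := (p : ℝ)) p.2.1 p.2.2 fun S : Finset (Sym2 (Fin n)) =>
      TriangleSpace.EveryEdgeInTriangle (TriangleSpace.gr S) ∧
        TriangleSpace.triangleSpace (TriangleSpace.gr S) ≠
          TriangleSpace.cycleSpace (TriangleSpace.gr S)
    simp only at hp
    rw [hp] at h1 h2
    rw [Real.dist_eq, sub_zero, abs_of_nonneg h2]
    linarith
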